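/- Let $\mathfrak g$ be a finite-dimensional simple Lie algebra over $\mathbb C$ of rank $n$ and dimension $N$, with Coxeter number $h$, dual Coxeter number $h^\vee$, exponents $1=m_1\le\dots\le m_n=h-1$, and normalized Cartan–Killing form $(x|y)=\frac1{2h^\vee}\operatorname{tr}(\operatorname{ad}_x\operatorname{ad}_y)$, extended $\mathbb C((\lambda^{-1}))$-bilinearly to $\mathfrak g((\lambda^{-1}))$. Put $\eta_{ab}=\delta_{a+b,n+1}$. Fix a Cartan subalgebra, Weyl generators $E_i,F_i$ ($1\le i\le n$), the highest root $\theta$, and root vectors $E_{\pm\theta}\in\mathfrak g_{\pm\theta}$ with $(E_\theta|E_{-\theta})=1$ and $\omega(E_{-\theta})=-E_\theta$, where $\omega$ is the Chevalley involution. Use the principal gradation $\deg E_i=-\deg F_i=1$, $\deg\lambda=h$; an upper index $k$ on a space denotes its homogeneous part of degree $k$. Let $\Lambda(\lambda)=\sum_iE_i+\lambda E_{-\theta}$ and fix homogeneous $\Lambda_{m_a}(\lambda)\in\operatorname{Ker}\operatorname{ad}_{\Lambda(\lambda)}\subset\mathfrak g((\lambda^{-1}))$ of degree $m_a$ ($a=1,\dots,n$)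 with $\Lambda_{m_1}=\Lambda$ and $(\Lambda_{m_a}(\lambda)|\Lambda_{m_b}(\lambda))=h\,\eta_{ab}\lambda$; put $\Lambda_{m_a+kh}=\lambda^k\Lambda_{m_a}$ for $k\in\mathbb Z$. Let $(e_j)_{j=1}^N$ be a basis of $\mathfrak g$, homogeneous of degrees $d_j$, with dual basis $(e^j)$ for $(\cdot|\cdot)$ and $[e^i,e^j]=\sum_kC^{ij}_ke^k$. Let $\mathcal P$ be the polynomial ring over $\mathbb C$ in indeterminates $u^j_k$ ($1\le j\le N$, $k\in\mathbb Z$, $k\ge d_j/h-1$), put $u^j(\lambda)=\sum_ku^j_k\lambda^{-k-1}$ and $W(\lambda)=\Lambda(\lambda)+\sum_ju^j(\lambda)e_j$, and equip $\mathcal P$ with the Poisson bracket determined by $$\{u^i(\lambda),u^j(\mu)\}=\sum_kC^{ij}_k\frac{u^k(\lambda)-u^k(\mu)}{\lambda-\mu}+\frac{([e^i,e^j]\,|\,\Lambda(\lambda)-\Lambda(\mu))}{\lambda-\mu}.$$ Let $(U(\lambda),H(\lambda))$ be the unique pair of series $U=\sum_{k\ge1}U^{[-k]}$, $U^{[-k]}\in\mathcal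 P\otimes(\operatorname{Im}\operatorname{ad}_\Lambda)^{-k}$, and $H=\sum_{k\ge0}H^{[-k]}$, $H^{[-k]}\in\mathcal P\otimes(\operatorname{Ker}\operatorname{ad}_\Lambda)^{-k}$, with $e^{-\operatorname{ad}_U}W=\Lambda+H$. Define $h_{a,k}\in\mathcal P$ by $H(\lambda)=\sum_{a=1}^n\sum_{k\ge-1}\frac{h_{n+1-a,k}}h\Lambda_{m_a-kh-2h}(\lambda)$, the flows by $\frac{df}{dT^a_k}=\{h_{a,k},f\}$ for $f\in\mathcal P$ and $k\ge0$, and the basic resolvents by $R_a(\lambda)=e^{\operatorname{ad}_{U(\lambda)}}\Lambda_{m_a}(\lambda)$. Then there are unique polynomials $\omega_{a,k;b,l}\in\mathcal P$ ($1\le a,b\le n$, $k,l\ge0$) with $$\sum_{k,l\ge0}\frac{\omega_{a,k;b,l}}{\lambda^{k+1}\mu^{l+1}}=\frac{(R_a(\lambda)|R_b(\mu))}{(\lambda-\mu)^2}-\eta_{ab}\frac{m_a\lambda+m_b\mu}{(\lambda-\mu)^2}$$ (an identity of formal series, understood after multiplication by $(\lambda-\mu)^2$), and they form a $\tau$-structure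 for the flows: for all $a,b,c\in\{1,\dots,n\}$ and $k,l,m\ge0$, $$\omega_{a,k;b,l}=\omega_{b,l;a,k},\qquad\frac{d\omega_{a,k;b,l}}{dT^c_m}=\frac{d\omega_{c,m;a,k}}{dT^b_l}=\frac{d\omega_{b,l;c,m}}{dT^a_k}.$$ -/

import Mathlib

open scoped TensorProduct

noncomputable section

namespace DSTau

section FiniteDim

variable {L : Type*} [LieRing L] [LieAlgebra ℂ L] {H : LieSubalgebra ℂ L} {n : ℕ}

/-- The element `ρ^∨ = ∑ c_j h_j` of the Cartan subalgebra with `[ρ^∨, E_i] = E_i` for all `i`;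
its coordinates are the row sums of the inverse Cartan matrix. -/
def principalElement (b : LieAlgebra.Basis (Fin n) H) : L :=
  ∑ j, ((b.A.map (Int.cast : ℤ → ℂ))⁻¹.mulVec 1) j • b.h j

lemma cartan_mulVec (b : LieAlgebra.Basis (Fin n) H) (i : Fin n) :
    ∑ j, (b.A i j : ℂ) * ((b.A.map (Int.cast : ℤ → ℂ))⁻¹.mulVec 1) j = 1 := by
  have hdet : IsUnit (b.A.map (Int.cast : ℤ → ℂ)).det := by
    have h1 : (b.A.map (Int.cast : ℤ → ℂ)).det = (b.A.det : ℂ) :=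
      ((Int.castRingHom ℂ).map_det b.A).symm
    rw [h1, isUnit_iff_ne_zero]
    exact_mod_cast b.nondegen.det_ne_zero
  have h2 := congrFun (Matrix.mulVec_mulVec (1 : Fin n → ℂ) (b.A.map (Int.cast : ℤ → ℂ))
    (b.A.map (Int.cast : ℤ → ℂ))⁻¹) i
  rw [Matrix.mul_nonsing_inv _ hdet, Matrix.one_mulVec] at h2
  simpa [Matrix.mulVec, dotProduct] using h2

/-- The generators `E_i` have principal degree `1`. -/
lemma principalElement_lie_e (b : LieAlgebra.Basis (Fin n) H) (i : Fin n) :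
    ⁅principalElement b, b.e i⁆ = b.e i := by
  have h := cartan_mulVec b i
  simp only [principalElement, sum_lie, smul_lie, b.lie_h_e]
  simp_rw [← Int.cast_smul_eq_zsmul ℂ, smul_smul]
  rw [← Finset.sum_smul]
  simp_rw [mul_comm _ ((b.A i _ : ℤ) : ℂ)]
  rw [h, one_smul]

/-- The generators `F_i` have principal degree `-1`. -/
lemma principalElement_lie_f (b : LieAlgebra.Basis (Fin n) H) (i : Fin n) :
    ⁅principalElement b, b.f i⁆ = -b.f i := by
  have h := cartan_mulVec b i
  simp only [principalElement, sum_lie, smul_lie, b.lie_h_f]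
  simp_rw [neg_smul, smul_neg, ← Int.cast_smul_eq_zsmul ℂ, smul_smul]
  rw [Finset.sum_neg_distrib, ← Finset.sum_smul]
  simp_rw [mul_comm _ ((b.A i _ : ℤ) : ℂ)]
  rw [h, one_smul]

/-- The component `𝔤^k` of the principal gradation of `𝔤`, for which `deg E_i = 1` and
`deg F_i = -1`: the `k`-eigenspace of `ad ρ^∨`. -/
def principalPart (b : LieAlgebra.Basis (Fin n) H) (k : ℤ) : Submodule ℂ L :=
  Module.End.eigenspace (LieAlgebra.ad ℂ L (principalElement b)) (k : ℂ)

/-- The Coxeter number `h`, which is one more than the height of the highest root, that is,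
one more than the largest principal degree occurring in `𝔤`. -/
def coxeterNumber (b : LieAlgebra.Basis (Fin n) H) : ℕ :=
  sSup {k : ℕ | principalPart b (k : ℤ) ≠ ⊥} + 1

/-- The principal nilpotent element `I₊ = ∑ E_i`. -/
def principalNilpotent (b : LieAlgebra.Basis (Fin n) H) : L := ∑ i, b.e i

/-- The exponents `m_1 ≤ ⋯ ≤ m_n` (here indexed from `0`): the principal degrees of a homogeneous
basis of the centralizer of the principal nilpotent element, in nondecreasing order and repeated
according to multiplicity. -/
def exponent (b : LieAlgebra.Basis (Fin n) H) (a : Fin n) : ℕ :=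
  sInf {k : ℕ | (a : ℕ) < ∑ j ∈ Finset.range (k + 1),
    Module.finrank ℂ
      ↥(LinearMap.ker (LieAlgebra.ad ℂ L (principalNilpotent b)) ⊓ principalPart b (j : ℤ))}

/-- The basis of the Cartan subalgebra formed by the simple coroots `α_i^∨ = h_i`. -/
def simpleCorootBasis (b : LieAlgebra.Basis (Fin n) H) : Module.Basis (Fin n) ℂ H :=
  (Module.Basis.span b.linInd).map (LinearEquiv.ofEq _ _ b.coe_cartan_eq_span).symm

end FiniteDim

section Simple

variable {L : Type*} [LieRing L] [LieAlgebra ℂ L] [FiniteDimensional ℂ L]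
  [LieAlgebra.IsSimple ℂ L] {H : LieSubalgebra ℂ L} [H.IsCartanSubalgebra] {n : ℕ}

/-- `θ` is the highest root: `θ - β` is a sum of simple roots for every root `β`. -/
def IsHighestRoot (b : LieAlgebra.Basis (Fin n) H) (θ : LieModule.Weight ℂ H L) : Prop :=
  θ ∈ H.root ∧ ∀ β ∈ H.root, ∃ c : Fin n → ℕ,
    (θ : H → ℂ) = fun x => β x + ∑ i, (c i : ℂ) * b.baseSupp i x

/-- The dual Coxeter number `h^∨ = 1 + ∑ a_i^∨`, where `θ^∨ = ∑ a_i^∨ α_i^∨` is the coroot of the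
highest root. -/
def dualCoxeterNumber (b : LieAlgebra.Basis (Fin n) H) (θ : LieModule.Weight ℂ H L) : ℂ :=
  1 + ∑ i, (simpleCorootBasis b).repr (LieAlgebra.IsKilling.coroot θ) i

/-- The normalized Cartan-Killing form `(x|y) = tr (ad_x ad_y) / (2 h^∨)`. -/
def normalizedForm (b : LieAlgebra.Basis (Fin n) H) (θ : LieModule.Weight ℂ H L) :
    LinearMap.BilinForm ℂ L :=
  (2 * dualCoxeterNumber b θ)⁻¹ • killingForm ℂ L

variable (H n) in
/-- The standard choices for a simple Lie algebra with Cartan subalgebra `H`: Weyl generators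
`E_i, F_i` (hence simple roots), the highest root `θ`, and root vectors `E_θ`, `E_{-θ}` with
`(E_θ|E_{-θ}) = 1` that are related by the Chevalley involution `ω(E_{-θ}) = -E_θ`. -/
structure Setup where
  gen : LieAlgebra.Basis (Fin n) H
  θ : LieModule.Weight ℂ H L
  isHighestRoot : IsHighestRoot gen θ
  Epos : L
  Eneg : L
  Epos_mem : Epos ∈ LieAlgebra.rootSpace H (θ : H → ℂ)
  Eneg_mem : Eneg ∈ LieAlgebra.rootSpace H (-(θ : H → ℂ))
  form_Epos_Eneg : normalizedForm gen θ Epos Eneg = 1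
  chevalley : ∃ ω : L ≃ₗ⁅ℂ⁆ L,
    (∀ i, ω (gen.e i) = -gen.f i) ∧ (∀ i, ω (gen.f i) = -gen.e i) ∧ ω Eneg = -Epos

end Simple

section Loop

/-- Laurent series in `λ⁻¹` with coefficients in `A`: the variable of the Hahn series is `λ⁻¹`,
so the coefficient at `i` is the coefficient of `λ^{-i}`. -/
def Series (A : Type*) [CommRing A] : Type _ := HahnSeries ℤ A

instance (A : Type*) [CommRing A] : CommRing (Series A) :=
  inferInstanceAs (CommRing (HahnSeries ℤ A))

/-- The embedding of the constants. -/
def Series.C (A : Type*) [CommRing A] : A →+* Series A := (HahnSeries.C : A →+* HahnSeries ℤ A)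

instance (R A : Type*) [CommRing R] [CommRing A] [Algebra R A] : Algebra R (Series A) :=
  ((Series.C A).comp (algebraMap R A)).toAlgebra

instance (R A : Type*) [CommRing R] [CommRing A] [Algebra R A] : IsScalarTower R A (Series A) :=
  IsScalarTower.of_algebraMap_eq fun _ => rfl

lemma Series.coeff_smul {R A : Type*} [CommRing R] [CommRing A] [Algebra R A] (c : R)
    (x : Series A) (i : ℤ) :
    HahnSeries.coeff (c • x : Series A) i = c • HahnSeries.coeff x i := by
  rw [Algebra.smul_def c (HahnSeries.coeff x i)]
  exact HahnSeries.coeff_single_zero_mul (R := A) (Γ := ℤ) (r := algebraMap R A c) (x := x)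

/-- The coefficient of `λ^{-i}`. -/
def Series.coeff {A : Type*} [CommRing A] (R : Type*) [CommRing R] [Algebra R A] (i : ℤ) :
    Series A →ₗ[R] A where
  toFun x := HahnSeries.coeff x i
  map_add' _ _ := rfl
  map_smul' c x := Series.coeff_smul c x i

/-- The monomial `λ^p`. -/
def lam (A : Type*) [CommRing A] (p : ℤ) : Series A := HahnSeries.single (-p) (1 : A)

/-- The series `∑_{k ≥ 0} f_k λ^{-k}`. -/
def Series.ofCoeffs {A : Type*} [CommRing A] (f : ℕ → A) : Series A :=
  HahnSeries.ofPowerSeries ℤ A (PowerSeries.mk f)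

/-- The algebra `𝔤((λ⁻¹))` with coefficients extended to `A`, that is, the Laurent series in
`λ⁻¹` with coefficients in `A ⊗ 𝔤`, realized as `A((λ⁻¹)) ⊗ 𝔤` (as `𝔤` is finite dimensional).
It carries the Lie bracket of the extension of scalars. -/
abbrev Loop (A L : Type*) [CommRing A] [Algebra ℂ A] [LieRing L] [LieAlgebra ℂ L] : Type _ :=
  Series A ⊗[ℂ] L

variable {A L : Type*} [CommRing A] [Algebra ℂ A] [LieRing L] [LieAlgebra ℂ L]

/-- The coefficient in `A ⊗ 𝔤` of `λ^{-i}`. -/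
def coeffAt (i : ℤ) : Loop A L →ₗ[ℂ] A ⊗[ℂ] L := LinearMap.rTensor L (Series.coeff ℂ i)

/-- Extension of constants `ℂ((λ⁻¹)) → A((λ⁻¹))`. -/
def constSeries (A : Type*) [CommRing A] [Algebra ℂ A] : Series ℂ →ₗ[ℂ] Series A where
  toFun x := HahnSeries.map (x : HahnSeries ℤ ℂ) (algebraMap ℂ A)
  map_add' x y := HahnSeries.ext (funext fun i => (algebraMap ℂ A).map_add _ _)
  map_smul' c x := by
    refine HahnSeries.ext (funext fun i => ?_)
    have h := congrArg (algebraMap ℂ A) (Series.coeff_smul c x i)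
    rw [smul_eq_mul, map_mul, ← Algebra.smul_def] at h
    exact h.trans (Series.coeff_smul (A := A) c
      (HahnSeries.map (x : HahnSeries ℤ ℂ) (algebraMap ℂ A)) i).symm

/-- The inclusion `𝔤((λ⁻¹)) → A ⊗ 𝔤((λ⁻¹))`. -/
def constLoop (A : Type*) [CommRing A] [Algebra ℂ A] : Loop ℂ L →ₗ[ℂ] Loop A L :=
  LinearMap.rTensor L (constSeries A)

/-- `x = ∑_{k ≥ 0} f k`, where for every power of `λ` the coefficients of the partial sums are
eventually constant, with value the coefficient of `x`. -/
def HasFormalSum (f : ℕ → Loop A L) (x : Loop A L) : Prop :=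
  ∀ i : ℤ, ∀ᶠ K in Filter.atTop, coeffAt i (∑ k ∈ Finset.range K, f k) = coeffAt i x

/-- `y = e^{ad_U} x = ∑_{k ≥ 0} (ad_U)^k x / k!`. -/
def IsExpAd (U x y : Loop A L) : Prop :=
  HasFormalSum (fun k => ((k.factorial : ℂ)⁻¹) • ((fun z => ⁅U, z⁆)^[k] x)) y

/-- The element `e^{ad_U} x` (when the series converges). -/
def expAd (U x : Loop A L) : Loop A L := Classical.epsilon (IsExpAd U x)

end Loop

namespace Setup

variable {L : Type*} [LieRing L] [LieAlgebra ℂ L] [FiniteDimensional ℂ L]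
  [LieAlgebra.IsSimple ℂ L] {H : LieSubalgebra ℂ L} [H.IsCartanSubalgebra] {n : ℕ}
  (S : Setup H n)

/-- The Coxeter number. -/
def h : ℕ := coxeterNumber S.gen

/-- The normalized Cartan-Killing form on `𝔤`. -/
def form : LinearMap.BilinForm ℂ L := normalizedForm S.gen S.θ

/-- The cyclic element `Λ(λ) = I₊ + λ E_{-θ}`. -/
def cyclicElement : Loop ℂ L :=
  (1 : Series ℂ) ⊗ₜ principalNilpotent S.gen + lam ℂ 1 ⊗ₜ S.Eneg

/-- The homogeneous elements of degree `k` of `𝔤((λ⁻¹))`, where `deg λ = h`: the coefficient of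
`λ^{-i}` has principal degree `k + h i`. -/
def homogeneous (k : ℤ) : Submodule ℂ (Loop ℂ L) :=
  ⨅ i : ℤ, ((principalPart S.gen (k + S.h * i)).baseChange ℂ).comap (coeffAt i)

/-- The operator `ad_{Λ(λ)}` on `𝔤((λ⁻¹))`. -/
def adCyclic : Module.End ℂ (Loop ℂ L) := LieAlgebra.ad ℂ (Loop ℂ L) S.cyclicElement

/-- `A ⊗ (Ker ad_Λ)^k`. -/
def kerPart (A : Type*) [CommRing A] [Algebra ℂ A] (k : ℤ) : Submodule A (Loop A L) :=
  Submodule.span A (constLoop A '' (LinearMap.ker S.adCyclic ⊓ S.homogeneous k : Submodule ℂ _))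

/-- `A ⊗ (Im ad_Λ)^k`. -/
def imPart (A : Type*) [CommRing A] [Algebra ℂ A] (k : ℤ) : Submodule A (Loop A L) :=
  Submodule.span A (constLoop A '' (LinearMap.range S.adCyclic ⊓ S.homogeneous k : Submodule ℂ _))

/-- `η_{ab} = δ_{a+b,n+1}` for `a, b = 1, …, n` (here the indices start at `0`). -/
def eta (_S : Setup H n) (a b : Fin n) : ℂ := if (a : ℕ) + b + 1 = n then 1 else 0

/-- Normalized elements `Λ_{m_a}(λ)` of `Ker ad_Λ`, homogeneous of degree `m_a`, with
`Λ_{m_1} = Λ` and `(Λ_{m_a}|Λ_{m_b}) = h η_{ab} λ`. (They form a basis of the kernel over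
`ℂ((λ⁻¹))`; that is, the elements `λ^k Λ_{m_a}`, `k ∈ ℤ`, form a topological basis over `ℂ`.) -/
structure KernelBasis where
  Λ : Fin n → Loop ℂ L
  mem_ker : ∀ a, Λ a ∈ LinearMap.ker S.adCyclic
  mem_homogeneous : ∀ a, Λ a ∈ S.homogeneous (exponent S.gen a)
  first : ∀ a : Fin n, (a : ℕ) = 0 → Λ a = S.cyclicElement
  form_eq : ∀ a b, S.form.baseChange (Series ℂ) (Λ a) (Λ b) =
    ((S.h : ℂ) * S.eta a b) • lam ℂ 1

/-- A basis `e_1, …, e_N` of `𝔤`, homogeneous of degrees `d_j` in the principal gradation. -/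
structure HomogeneousBasis (N : ℕ) where
  e : Module.Basis (Fin N) ℂ L
  d : Fin N → ℤ
  mem : ∀ j, e j ∈ principalPart S.gen (d j)

end Setup

namespace Setup.HomogeneousBasis

variable {L : Type*} [LieRing L] [LieAlgebra ℂ L] [FiniteDimensional ℂ L]
  [LieAlgebra.IsSimple ℂ L] {H : LieSubalgebra ℂ L} [H.IsCartanSubalgebra] {n N : ℕ}
  {S : Setup H n} (B : S.HomogeneousBasis N)

/-- The dual basis `e^i = ∑_j K^{ij} e_j`, where `(K^{ij})` is the inverse of the matrix
`K_{ij} = (e_i|e_j)`. -/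
def dual (i : Fin N) : L :=
  ∑ j, (Matrix.of fun p q => S.form (B.e p) (B.e q))⁻¹ i j • B.e j

/-- The structure constants `C^{ij}_k` in `[e^i, e^j] = ∑_k C^{ij}_k e^k`, which are
`([e^i, e^j]|e_k)` because `(e^k|e_l) = δ_{kl}`. -/
def structureConst (i j k : Fin N) : ℂ := S.form ⁅B.dual i, B.dual j⁆ (B.e k)

/-- The index set of the indeterminates `u^j_k`: `j = 1, …, N` and `k ∈ ℤ`, `k ≥ d_j / h - 1`. -/
abbrev Index : Type := {p : Fin N × ℤ // (B.d p.1 : ℚ) / S.h - 1 ≤ (p.2 : ℚ)}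

/-- The polynomial ring `𝒫 = ℂ[u^j_k]`. -/
abbrev Poly : Type := MvPolynomial B.Index ℂ

open Classical in
/-- The indeterminate `u^j_k`, and `0` for the pairs `(j, k)` for which there is none. -/
def u (j : Fin N) (k : ℤ) : B.Poly :=
  if hk : (B.d j : ℚ) / S.h - 1 ≤ (k : ℚ) then MvPolynomial.X ⟨(j, k), hk⟩ else 0

/-- `u^j(λ) = ∑_k u^j_k λ^{-k-1}`. -/
def uSeries (j : Fin N) : Series B.Poly :=
  HahnSeries.ofSuppBddBelow (fun i => B.u j (i - 1)) <| by
    refine ⟨⌊(B.d j : ℚ) / S.h⌋, fun i hi => ?_⟩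
    by_contra hlt
    apply hi
    have h1 : ¬ ((B.d j : ℚ) / S.h - 1 ≤ ((i - 1 : ℤ) : ℚ)) := by
      intro hc
      apply hlt
      have h2 : (B.d j : ℚ) / S.h ≤ (i : ℚ) := by
        push_cast at hc
        linarith
      exact_mod_cast (Int.floor_le _).trans h2
    simp only [u, dif_neg h1]

/-- `W(λ) = Λ(λ) + ∑_j u^j(λ) e_j`. -/
def W : Loop B.Poly L :=
  constLoop B.Poly S.cyclicElement + ∑ j, B.uSeries j ⊗ₜ B.e j

/-- The Poisson brackets `{u^i_r, u^j_s}` of the generators: the coefficient of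
`λ^{-r-1} μ^{-s-1}` in
`{u^i(λ), u^j(μ)} = ∑_k C^{ij}_k (u^k(λ) - u^k(μ)) / (λ - μ) + ([e^i,e^j]|Λ(λ) - Λ(μ)) / (λ - μ)`.
Here `(λ^{-p-1} - μ^{-p-1}) / (λ - μ)` is `-∑_{r+s=p, r,s ≥ 0} λ^{-r-1} μ^{-s-1}` for `p ≥ 0`
and `0` for `p = -1`, and `(Λ(λ) - Λ(μ)) / (λ - μ) = E_{-θ}`. -/
def genBracket (x y : B.Index) : B.Poly :=
  if 0 ≤ x.1.2 ∧ 0 ≤ y.1.2 then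
    -∑ k, B.structureConst x.1.1 y.1.1 k • B.u k (x.1.2 + y.1.2)
  else if x.1.2 = -1 ∧ y.1.2 = -1 then
    MvPolynomial.C (S.form ⁅B.dual x.1.1, B.dual y.1.1⁆ S.Eneg)
  else 0

/-- The derivation `{f, ·}` of `𝒫`: the Poisson bracket is the extension of the brackets of the
generators to a biderivation of `𝒫`. -/
def poisson (f : B.Poly) : Derivation ℂ B.Poly B.Poly :=
  MvPolynomial.mkDerivation ℂ fun y =>
    MvPolynomial.mkDerivation ℂ (fun x => B.genBracket x y) f

/-- The pairs `(U(λ), H(λ))` with `U = ∑_{k ≥ 1} U^{[-k]}`, `U^{[-k]} ∈ 𝒫 ⊗ (Im ad_Λ)^{-k}`,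
`H = ∑_{k ≥ 0} H^{[-k]}`, `H^{[-k]} ∈ 𝒫 ⊗ (Ker ad_Λ)^{-k}`, and `e^{-ad_U} W = Λ + H`. -/
def IsDressingPair (UH : Loop B.Poly L × Loop B.Poly L) : Prop :=
  (∃ f : ℕ → Loop B.Poly L,
    (∀ k : ℕ, f k ∈ S.imPart B.Poly (-((k : ℤ) + 1))) ∧ HasFormalSum f UH.1) ∧
  (∃ f : ℕ → Loop B.Poly L,
    (∀ k : ℕ, f k ∈ S.kerPart B.Poly (-(k : ℤ))) ∧ HasFormalSum f UH.2) ∧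
  IsExpAd (-UH.1) B.W (constLoop B.Poly S.cyclicElement + UH.2)

/-- The unique pair `(U(λ), H(λ))` as above. -/
def dressingPair : Loop B.Poly L × Loop B.Poly L := Classical.epsilon B.IsDressingPair

variable (Λ : S.KernelBasis)

/-- The expansion `H(λ) = ∑_a ∑_{k ≥ -1} (h_{n+1-a,k} / h) Λ_{m_a - kh - 2h}(λ)`, where
`Λ_{m_a - kh - 2h} = λ^{-k-2} Λ_{m_a}`, `n + 1 - a` is `a.rev` and `h_{a,k}` is `g a (k + 1)`. -/
def IsHamiltonianFamily (g : Fin n → ℕ → B.Poly) : Prop :=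
  B.dressingPair.2 = ∑ a : Fin n, (S.h : ℂ)⁻¹ •
    ((lam B.Poly (-1) *
      Series.ofCoeffs (g a.rev)) • constLoop B.Poly (Λ.Λ a))

/-- The hamiltonian `h_{a,k}`, `k ≥ 0`. -/
def hamiltonian (a : Fin n) (k : ℕ) : B.Poly :=
  Classical.epsilon (B.IsHamiltonianFamily Λ) a (k + 1)

/-- The derivative `d/dT^a_k = {h_{a,k}, ·}` on `𝒫` along the flow `dW/dT^a_k = {h_{a,k}, W}`. -/
def flow (a : Fin n) (k : ℕ) : Derivation ℂ B.Poly B.Poly := B.poisson (B.hamiltonian Λ a k)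

/-- The basic resolvents `R_a(λ) = e^{ad_U} Λ_{m_a}(λ)`. -/
def resolvent (a : Fin n) : Loop B.Poly L :=
  expAd B.dressingPair.1 (constLoop B.Poly (Λ.Λ a))

/-- The form `(·|·)` on `𝒫 ⊗ 𝔤`. -/
def polyForm : LinearMap.BilinForm B.Poly (B.Poly ⊗[ℂ] L) := S.form.baseChange B.Poly

end Setup.HomogeneousBasis

/-- Formal series in `λ^{±1}` and `μ^{±1}` with coefficients in `A`: `F i j` is the coefficient of
`λ^i μ^j`. -/
abbrev Series₂ (A : Type*) : Type _ := ℤ → ℤ → A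

/-- Multiplication by `λ - μ`. -/
def mulDiff {A : Type*} [CommRing A] (F : Series₂ A) : Series₂ A :=
  fun i j => F (i - 1) j - F i (j - 1)

/-- The series `∑_{k,l ≥ 0} w_{k,l} λ^{-k-1} μ^{-l-1}`. -/
def negSeries {A : Type*} [CommRing A] (w : ℕ → ℕ → A) : Series₂ A :=
  fun i j => if i < 0 ∧ j < 0 then w (-i - 1).toNat (-j - 1).toNat else 0

namespace Setup.HomogeneousBasis

variable {L : Type*} [LieRing L] [LieAlgebra ℂ L] [FiniteDimensional ℂ L]
  [LieAlgebra.IsSimple ℂ L] {H : LieSubalgebra ℂ L} [H.IsCartanSubalgebra] {n N : ℕ}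
  {S : Setup H n} (B : S.HomogeneousBasis N) (Λ : S.KernelBasis)

/-- The series `(R_a(λ)|R_b(μ)) - η_{ab} (m_a λ + m_b μ)`. -/
def tauNumerator (a b : Fin n) : Series₂ B.Poly := fun i j =>
  B.polyForm (coeffAt (-i) (B.resolvent Λ a)) (coeffAt (-j) (B.resolvent Λ b)) -
    MvPolynomial.C (S.eta a b * ((if i = 1 ∧ j = 0 then (exponent S.gen a : ℂ) else 0) +
      (if i = 0 ∧ j = 1 then (exponent S.gen b : ℂ) else 0)))

/-- The defining relation
`∑_{k,l ≥ 0} ω_{a,k;b,l} λ^{-k-1} μ^{-l-1} =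
  (R_a(λ)|R_b(μ)) / (λ - μ)² - η_{ab} (m_a λ + m_b μ) / (λ - μ)²`,
multiplied by `(λ - μ)²`. -/
def IsOmega (ω : Fin n → ℕ → Fin n → ℕ → B.Poly) : Prop :=
  ∀ a b, mulDiff (mulDiff (negSeries fun k l => ω a k b l)) = B.tauNumerator Λ a b

end Setup.HomogeneousBasis

end DSTau

end

set_option linter.unusedSectionVars false

noncomputable section

namespace DSTau

/-! ### The principal gradation and the principal `sl₂`-triple. -/

section

open LieAlgebra

variable {L : Type*} [LieRing L] [LieAlgebra ℂ L] [FiniteDimensional ℂ L]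
  [LieAlgebra.IsSimple ℂ L] {H : LieSubalgebra ℂ L} [H.IsCartanSubalgebra] {n N : ℕ}

/-! Let `Q_c` be the coefficient of `ν` in `R_c(ν)`. In generating functions the flows on the
resolvents read `∑_m ν^{-m-1} dR_a(λ)/dT^c_m = [R_c(ν), R_a(λ)]/(ν-λ) - [Q_c, R_a(λ)]`. By
invariance of the form the `Q_c` terms cancel in the derivative of `(R_a(λ)|R_b(μ))`, which becomes
`T · (1/(ν-λ) - 1/(ν-μ))` with `T = ([R_c(ν), R_a(λ)]|R_b(μ))`. Dividing by `(λ-μ)²` leaves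
`T/((ν-λ)(ν-μ)(λ-μ))`. Numerator and denominator are both invariant under cyclic permutations of the
labelled variables, and this is the `τ`-symmetry (`mulVandermonde_flowSeries`, `flowSeries_cyclic`).

The polynomials `ω` exist because the numerator vanishes to second order on the diagonal: `e^{ad_U}`
preserves the form, so `(R_a|R_b) = h η_{ab} λ` and `(λ∂_λ R_a|R_b) = m_a η_{ab} λ`, while `m_a +
m_b = h` whenever `η_{ab} ≠ 0` (`exists_isOmega`). They are unique because multiplication by `λ-μ`
is injective on series bounded above in `λ`.

The flow on resolvents (`flow_resolvent`) comes from the Lax equation `dW/dT^b_m = -[(λ^m R_b)_-,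
W]` (`flow_W`), itself a residue computation from `dh_{b,m} = res (dW|λ^m R_b)`. To pass from `W` to
`R_a`, conjugate by `e^{-ad_U}`: the discrepancy `Z` satisfies `[Λ, [Z, Λ+H]] = 0`, which forces
`[Λ, Z] = 0`, so `Z` commutes with every `Λ_{m_a}`.

This needs the kernel of `ad_Λ` to be abelian and spanned by the `Λ_{m_a}`, and `ad_Λ` to be
invertible off its kernel. Setting `λ = 1` reduces these facts to the centralizer of `I₊ + E_{-θ}`
in `𝔤`, which is studied through the principal `sl₂`-triple (`kerProj_eq_self`,
`lie_eq_zero_of_lie_cyclic`). Convergence of exponentials is handled by the filtration by total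
degree. Of the pair `(U, H)` only existence and the defining properties are used. -/

lemma mem_principalPart {b : LieAlgebra.Basis (Fin n) H} {k : ℤ} {x : L} :
    x ∈ principalPart b k ↔ ⁅principalElement b, x⁆ = (k : ℂ) • x := by
  simp [principalPart]

lemma lie_mem_principalPart {b : LieAlgebra.Basis (Fin n) H} {i j : ℤ} {x y : L}
    (hx : x ∈ principalPart b i) (hy : y ∈ principalPart b j) :
    ⁅x, y⁆ ∈ principalPart b (i + j) := by
  rw [mem_principalPart] at *
  rw [leibniz_lie, hx, hy, smul_lie, lie_smul, ← add_smul]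
  push_cast; rfl

lemma principalElement_mem (b : LieAlgebra.Basis (Fin n) H) : principalElement b ∈ H := by
  refine sum_mem fun j _ => H.smul_mem _ (b.h' j).2

namespace Setup

variable (S : Setup H n)

lemma form_comm (x y : L) : S.form x y = S.form y x := by
  simp only [form, normalizedForm, LinearMap.smul_apply]
  rw [LieModule.traceForm_comm]

lemma form_lie (x y z : L) : S.form ⁅x, y⁆ z = S.form x ⁅y, z⁆ := by
  simp only [form, normalizedForm, LinearMap.smul_apply]
  rw [LieModule.traceForm_apply_lie_apply]

lemma form_scalar_ne_zero : (2 * dualCoxeterNumber S.gen S.θ)⁻¹ ≠ 0 := by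
  intro h0
  have h1 := S.form_Epos_Eneg
  simp only [normalizedForm, h0, zero_smul, LinearMap.zero_apply] at h1
  exact zero_ne_one h1

lemma form_nondegenerate : S.form.Nondegenerate := by
  have h := IsKilling.killingForm_nondegenerate ℂ L
  refine ⟨fun x hx => h.1 x fun y => ?_, fun x hx => h.2 x fun y => ?_⟩
  · have := hx y
    simpa [form, normalizedForm, S.form_scalar_ne_zero] using
      (smul_eq_zero_iff_right S.form_scalar_ne_zero).1 this
  · have := hx y
    simpa [form, normalizedForm, S.form_scalar_ne_zero] using
      (smul_eq_zero_iff_right S.form_scalar_ne_zero).1 this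

lemma eq_zero_of_form {x : L} (hx : ∀ y, S.form x y = 0) : x = 0 :=
  S.form_nondegenerate.1 x hx

lemma form_eq_zero_of_degree {i j : ℤ} {x y : L} (hx : x ∈ principalPart S.gen i)
    (hy : y ∈ principalPart S.gen j) (hij : i + j ≠ 0) : S.form x y = 0 := by
  rw [mem_principalPart] at hx hy
  have h1 := S.form_lie x (principalElement S.gen) y
  rw [← lie_skew, hx, hy] at h1
  simp only [map_neg, map_smul, LinearMap.neg_apply, LinearMap.smul_apply, smul_eq_mul] at h1
  have h2 : ((i + j : ℤ) : ℂ) * S.form x y = 0 := by push_cast; linear_combination -h1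
  exact (mul_eq_zero.1 h2).resolve_left (by exact_mod_cast hij)

/-- The range of `ad x` is the orthogonal complement of its kernel. -/
lemma exists_eq_lie (x v : L) (hv : ∀ z, ⁅x, z⁆ = 0 → S.form v z = 0) : ∃ w, v = ⁅x, w⁆ := by
  have hr : S.form.IsRefl := fun a b h => by rw [S.form_comm, h]
  have h1 := LinearMap.BilinForm.orthogonal_orthogonal S.form_nondegenerate hr
    (LinearMap.range (LieAlgebra.ad ℂ L x))
  have h2 : v ∈ LinearMap.range (LieAlgebra.ad ℂ L x) := by
    rw [← h1, LinearMap.BilinForm.mem_orthogonal_iff]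
    intro z hz
    rw [LinearMap.BilinForm.mem_orthogonal_iff] at hz
    change S.form z v = 0
    rw [S.form_comm]
    apply hv
    apply S.eq_zero_of_form
    intro y
    have h3 : S.form ⁅x, y⁆ z = 0 := hz ⁅x, y⁆ ⟨y, rfl⟩
    rw [S.form_comm, ← S.form_lie] at h3
    rw [← lie_skew, map_neg, LinearMap.neg_apply, h3, neg_zero]
  obtain ⟨w, hw⟩ := h2
  exact ⟨w, hw.symm⟩

lemma e_mem (i : Fin n) : S.gen.e i ∈ principalPart S.gen 1 := by
  rw [mem_principalPart, principalElement_lie_e]; simp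

lemma f_mem (i : Fin n) : S.gen.f i ∈ principalPart S.gen (-1) := by
  rw [mem_principalPart, principalElement_lie_f]; simp

lemma principalNilpotent_mem : principalNilpotent S.gen ∈ principalPart S.gen 1 :=
  sum_mem fun i _ => S.e_mem i

lemma cartan_le {x : L} (hx : x ∈ H) : x ∈ principalPart S.gen 0 := by
  have hab := S.gen.isLieAbelian_cartan
  rw [mem_principalPart]
  have := hab.trivial ⟨_, principalElement_mem S.gen⟩ ⟨x, hx⟩
  have h2 := congrArg Subtype.val this
  simpa using h2

lemma principalElement_ne_zero (hn : 0 < n) : principalElement S.gen ≠ 0 := by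
  intro h
  have := principalElement_lie_e S.gen ⟨0, hn⟩
  rw [h, zero_lie] at this
  exact (S.gen.sl2 ⟨0, hn⟩).e_ne_zero this.symm

/-- The principal `sl₂`-triple. -/
lemma exists_sl2Triple (hn : 0 < n) :
    ∃ f : L, IsSl2Triple ((2 : ℂ) • principalElement S.gen) (principalNilpotent S.gen) f := by
  set c := ((S.gen.A.map (Int.cast : ℤ → ℂ))⁻¹.mulVec 1) with hc
  -- As `[E_i, F_j] = 0` for `i ≠ j`, the bracket of `I₊` with this element is `∑ 2 c_j h_j = 2ρ^∨`.
  refine ⟨∑ j, (2 * c j) • S.gen.f j, ?_, ?_, ?_, ?_⟩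
  · simpa using S.principalElement_ne_zero hn
  · simp only [principalNilpotent, sum_lie, lie_sum, lie_smul, principalElement]
    rw [Finset.smul_sum]
    refine Finset.sum_congr rfl fun i _ => ?_
    rw [Finset.sum_eq_single i]
    · rw [(S.gen.sl2 i).lie_e_f, smul_smul]
    · intro j _ hj
      rw [S.gen.lie_e_f_ne j i hj]
    · simp
  · rw [smul_lie, mem_principalPart.1 S.principalNilpotent_mem]
    simp [two_smul]
  · have : ⁅principalElement S.gen, ∑ j, (2 * c j) • S.gen.f j⁆ = -∑ j, (2 * c j) • S.gen.f j := by
      simp only [lie_sum, lie_smul, principalElement_lie_f, smul_neg, Finset.sum_neg_distrib]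
    rw [smul_lie, this]
    simp [two_smul]

/-- A nonzero such `x` would be a highest weight vector of weight `2d < 0` for the principal `sl₂`,
impossible in finite dimension. -/
lemma eq_zero_of_lie_principalNilpotent {d : ℤ} (hd : d < 0) {x : L}
    (hx : x ∈ principalPart S.gen d) (h : ⁅principalNilpotent S.gen, x⁆ = 0) : x = 0 := by
  -- Without generators `ρ^∨ = 0`, and every negative degree is empty.
  rcases Nat.eq_zero_or_pos n with rfl | hn
  · rw [mem_principalPart] at hx
    have : principalElement S.gen = 0 := by simp [principalElement]
    rw [this, zero_lie] at hx
    have hd' : (d : ℂ) ≠ 0 := by exact_mod_cast hd.ne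
    exact (smul_eq_zero.1 hx.symm).resolve_left hd'
  by_contra hx0
  obtain ⟨f, ht⟩ := S.exists_sl2Triple hn
  have hp : ht.HasPrimitiveVectorWith x ((2 * d : ℤ) : ℂ) :=
    ⟨hx0, by rw [smul_lie, mem_principalPart.1 hx, smul_smul]; push_cast; rfl, h⟩
  obtain ⟨m, hm⟩ := hp.exists_nat
  have : 2 * d = (m : ℤ) := by exact_mod_cast hm
  omega

/-- The value `I₊ + E_{-θ}` of the cyclic element at `λ = 1`. -/
def cyclic : L := principalNilpotent S.gen + S.Eneg

end Setup

namespace Setup.HomogeneousBasis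

variable {S : Setup H n} (B : S.HomogeneousBasis N)

lemma repr_eq_zero {k : ℤ} {x : L} (hx : x ∈ principalPart S.gen k) {j : Fin N}
    (hj : B.d j ≠ k) : B.e.repr x j = 0 := by
  rw [mem_principalPart] at hx
  have h1 : ∀ y : L, B.e.repr ⁅principalElement S.gen, y⁆ j = (B.d j : ℂ) * B.e.repr y j := by
    intro y
    have : (B.e.coord j) ∘ₗ (LieAlgebra.ad ℂ L (principalElement S.gen)) =
        (B.d j : ℂ) • B.e.coord j := by
      refine B.e.ext fun i => ?_
      have := mem_principalPart.1 (B.mem i)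
      rcases eq_or_ne i j with rfl | hij
      · simp [this]
      · simp [this, hij]
    exact LinearMap.congr_fun this y
  have h2 := h1 x
  rw [hx] at h2
  simp only [map_smul, Finsupp.smul_apply, smul_eq_mul] at h2
  have h3 : ((B.d j - k : ℤ) : ℂ) * B.e.repr x j = 0 := by push_cast; linear_combination -h2
  exact (mul_eq_zero.1 h3).resolve_left (by exact_mod_cast sub_ne_zero.2 hj)

lemma mem_of_repr {k : ℤ} {x : L} (hx : ∀ j, B.d j ≠ k → B.e.repr x j = 0) :
    x ∈ principalPart S.gen k := by
  rw [← B.e.sum_repr x]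
  refine sum_mem fun j _ => ?_
  by_cases hj : B.d j = k
  · exact Submodule.smul_mem _ _ (hj ▸ B.mem j)
  · rw [hx j hj, zero_smul]; exact zero_mem _

open Classical in
/-- The projection of `𝔤` onto the sum of its components of degrees in `s`. -/
def proj (s : Set ℤ) : L →ₗ[ℂ] L :=
  B.e.constr ℂ fun j => if B.d j ∈ s then B.e j else 0

open Classical in
lemma proj_of_mem {k : ℤ} {x : L} (hx : x ∈ principalPart S.gen k) (s : Set ℤ) :
    B.proj s x = if k ∈ s then x else 0 := by
  rw [← B.e.sum_repr x, map_sum]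
  have : ∀ j, B.proj s (B.e.repr x j • B.e j) =
      if k ∈ s then B.e.repr x j • B.e j else 0 := by
    intro j
    rw [map_smul, proj, B.e.constr_basis]
    by_cases hj : B.d j = k
    · rw [hj]; split_ifs <;> simp
    · rw [B.repr_eq_zero hx hj]; simp
  simp only [this]
  split_ifs
  · rfl
  · simp

include B in
/-- Induction on homogeneous elements. -/
lemma induction {p : L → Prop} (h0 : p 0) (hadd : ∀ x y, p x → p y → p (x + y))
    (hom : ∀ k, ∀ x ∈ principalPart S.gen k, p x) (x : L) : p x := by
  rw [← B.e.sum_repr x]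
  refine Finset.sum_induction _ p hadd h0 fun j _ => ?_
  exact hom (B.d j) _ (Submodule.smul_mem _ _ (B.mem j))

lemma repr_proj (s : Set ℤ) (x : L) (j : Fin N) [Decidable (B.d j ∈ s)] :
    B.e.repr (B.proj s x) j = if B.d j ∈ s then B.e.repr x j else 0 := by
  classical
  refine B.induction (p := fun x => B.e.repr (B.proj s x) j = if B.d j ∈ s then B.e.repr x j else 0)
    (by simp) (fun x y hx hy => ?_) (fun k x hx => ?_) x
  · simp only [map_add, Finsupp.add_apply, hx, hy]; split_ifs <;> simp
  · rw [B.proj_of_mem hx]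
    by_cases hj : B.d j = k
    · subst hj; split_ifs <;> simp
    · split_ifs <;> simp [B.repr_eq_zero hx hj]

lemma proj_mem (k : ℤ) (x : L) : B.proj {k} x ∈ principalPart S.gen k := by
  classical
  refine B.mem_of_repr fun j hj => ?_
  rw [B.repr_proj, if_neg (by simpa using hj)]

lemma lie_proj {i : ℤ} {x : L} (hx : x ∈ principalPart S.gen i) (s : Set ℤ) (y : L) :
    ⁅x, B.proj s y⁆ = B.proj {d | d - i ∈ s} ⁅x, y⁆ := by
  classical
  refine B.induction (p := fun y => ⁅x, B.proj s y⁆ = B.proj {d | d - i ∈ s} ⁅x, y⁆)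
    (by simp) (fun a b ha hb => ?_) (fun k y hy => ?_) y
  · simp only [map_add, lie_add, ha, hb]
  · rw [B.proj_of_mem hy, B.proj_of_mem (lie_mem_principalPart hx hy)]
    simp only [Set.mem_ofPred_eq, add_sub_cancel_left]
    split_ifs <;> simp

lemma proj_singleton_eq {k : ℤ} {x : L} (hx : x ∈ principalPart S.gen k) : B.proj {k} x = x := by
  classical
  rw [B.proj_of_mem hx]; simp

lemma eq_of_proj_eq {x y : L} (h : ∀ k : ℤ, B.proj {k} x = B.proj {k} y) : x = y := by
  classical
  refine B.e.ext_elem fun j => ?_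
  have := congrArg (fun z => B.e.repr z j) (h (B.d j))
  simpa [B.repr_proj] using this

include B in
/-- The component of degree `0` is the Cartan subalgebra. -/
lemma mem_cartan_of_mem {x : L} (hx : x ∈ principalPart S.gen 0) : x ∈ H := by
  classical
  -- If `T` is closed under addition, a subalgebra generated in degrees from `T` stays in those
  -- degrees.
  have aux : ∀ (T : Set ℤ) (_ : ∀ a ∈ T, ∀ b ∈ T, a + b ∈ T) (s : Set L)
      (_ : ∀ y ∈ s, ∃ k ∈ T, y ∈ principalPart S.gen k), ∀ y ∈ LieSubalgebra.lieSpan ℂ L s,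
      y ∈ ⨆ k ∈ T, principalPart S.gen k := by
    intro T hT s hs y hy
    induction hy using LieSubalgebra.lieSpan_induction with
    | mem u hu =>
      obtain ⟨k, hk, hu⟩ := hs u hu
      exact Submodule.mem_iSup_of_mem k (Submodule.mem_iSup_of_mem hk hu)
    | zero => exact zero_mem _
    | add u v _ _ hu hv => exact add_mem hu hv
    | smul t u _ hu => exact Submodule.smul_mem _ t hu
    | lie u v _ _ hu hv =>
      rw [iSup_subtype'] at hu hv
      refine Submodule.iSup_induction _ (motive := fun u => ⁅u, v⁆ ∈ _) hu ?_ ?_ ?_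
      · rintro ⟨i, hi⟩ a ha
        refine Submodule.iSup_induction _ (motive := fun v => ⁅a, v⁆ ∈ _) hv ?_ ?_ ?_
        · rintro ⟨j, hj⟩ b hb
          exact Submodule.mem_iSup_of_mem (i + j) (Submodule.mem_iSup_of_mem (hT i hi j hj)
            (lie_mem_principalPart ha hb))
        · simp
        · intro a b ha hb; rw [lie_add]; exact add_mem ha hb
      · simp
      · intro a b ha hb; rw [add_lie]; exact add_mem ha hb
  have hproj : ∀ (T : Set ℤ) (_ : 0 ∉ T) (y : L), y ∈ ⨆ k ∈ T, principalPart S.gen k →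
      B.proj {0} y = 0 := by
    intro T hT y hy
    rw [iSup_subtype'] at hy
    refine Submodule.iSup_induction _ (motive := fun y => B.proj {0} y = 0) hy ?_ ?_ ?_
    · rintro ⟨k, hk⟩ y hy
      rw [B.proj_of_mem hy, if_neg]
      rintro rfl
      exact hT hk
    · simp
    · intro a b ha hb; rw [map_add, ha, hb, add_zero]
  -- In the triangular decomposition the two nilpotent parts have only negative, respectively
  -- positive, degrees, so the degree-zero projection sees only the Cartan summand.
  have htop := S.gen.iSup_cartan_borelLower_borelUpper_eq_top
  have hx' : x ∈ (⊤ : LieSubmodule ℂ H L) := trivial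
  rw [← htop] at hx'
  obtain ⟨c, hc, l, hl, u, hu, rfl⟩ : ∃ᵉ (c ∈ H) (l ∈ LieSubalgebra.lieSpan ℂ L (Set.range S.gen.f))
      (u ∈ LieSubalgebra.lieSpan ℂ L (Set.range S.gen.e)), c + l + u = x := by
    have : x ∈ H.toLieSubmodule ⊔ S.gen.borelLower ⊔ S.gen.borelUpper := by simpa using hx'
    simpa [LieSubmodule.mem_sup] using! this
  have h1 : B.proj {0} l = 0 := hproj {k | k < 0} (by simp) _ <|
    aux {k | k < 0} (fun a (ha : a < 0) b (hb : b < 0) => show a + b < 0 by omega) _ (by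
      rintro _ ⟨i, rfl⟩; exact ⟨-1, by simp, S.f_mem i⟩) l hl
  have h2 : B.proj {0} u = 0 := hproj {k | 0 < k} (by simp) _ <|
    aux {k | 0 < k} (fun a (ha : 0 < a) b (hb : 0 < b) => show 0 < a + b by omega) _ (by
      rintro _ ⟨i, rfl⟩; exact ⟨1, by simp, S.e_mem i⟩) u hu
  have h3 := B.proj_singleton_eq hx
  rw [map_add, map_add, h1, h2, add_zero, add_zero, B.proj_singleton_eq (S.cartan_le hc)] at h3
  rwa [← h3]

end Setup.HomogeneousBasis

end

/-! ### The centralizer of `I₊`, the range of degrees, and the degree of `E_{-θ}`. -/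

section

open LieAlgebra

variable {L : Type*} [LieRing L] [LieAlgebra ℂ L] [FiniteDimensional ℂ L]
  [LieAlgebra.IsSimple ℂ L] {H : LieSubalgebra ℂ L} [H.IsCartanSubalgebra] {n N : ℕ}

namespace Setup.HomogeneousBasis

variable {S : Setup H n} (B : S.HomogeneousBasis N)

lemma proj_proj (s t : Set ℤ) (x : L) : B.proj s (B.proj t x) = B.proj (s ∩ t) x := by
  classical
  refine B.e.ext_elem fun j => ?_
  simp only [B.repr_proj, Set.mem_inter_iff]
  split_ifs <;> simp_all

lemma proj_empty (x : L) : B.proj ∅ x = 0 := by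
  classical
  refine B.e.ext_elem fun j => ?_
  simp [B.repr_proj]

/-- The degrees occurring in `𝔤`. -/
def degrees : Finset ℤ := Finset.univ.image B.d

lemma proj_eq_zero {k : ℤ} (hk : k ∉ B.degrees) (x : L) : B.proj {k} x = 0 := by
  classical
  refine B.e.ext_elem fun j => ?_
  rw [B.repr_proj, if_neg]
  · simp
  · rintro rfl; exact hk (Finset.mem_image_of_mem _ (Finset.mem_univ j))

lemma sum_proj (x : L) : ∑ k ∈ B.degrees, B.proj {k} x = x := by
  classical
  refine B.e.ext_elem fun j => ?_
  simp only [map_sum, Finsupp.coe_finsetSum, Finset.sum_apply, B.repr_proj, Set.mem_singleton_iff]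
  rw [Finset.sum_ite_eq, if_pos]
  exact Finset.mem_image_of_mem _ (Finset.mem_univ j)

lemma form_proj {k : ℤ} {y : L} (hy : y ∈ principalPart S.gen k) (z : L) :
    S.form y (B.proj {-k} z) = S.form y z := by
  refine B.induction (p := fun z => S.form y (B.proj {-k} z) = S.form y z) (by simp)
    (fun a b ha hb => by simp only [map_add, ha, hb]) (fun l z hz => ?_) z
  classical
  rw [B.proj_of_mem hz]
  split_ifs with h
  · rfl
  · rw [map_zero, S.form_eq_zero_of_degree hy hz]
    intro h'; apply h; simp; omega

-- Dual to the injectivity of `ad I₊` in degree `-(d+1)`: the range of `ad I₊` is the orthogonal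
-- complement of its kernel, and that kernel has no component in negative degree.
include B in
lemma exists_lie_principalNilpotent {d : ℤ} (hd : 0 ≤ d) {y : L}
    (hy : y ∈ principalPart S.gen (d + 1)) :
    ∃ x ∈ principalPart S.gen d, ⁅principalNilpotent S.gen, x⁆ = y := by
  obtain ⟨w, hw⟩ := S.exists_eq_lie (principalNilpotent S.gen) y fun z hz => by
    rw [← B.form_proj hy]
    have : B.proj {-(d + 1)} z = 0 := by
      refine S.eq_zero_of_lie_principalNilpotent (d := -(d + 1)) (by omega) (B.proj_mem _ _) ?_
      rw [B.lie_proj S.principalNilpotent_mem, hz, map_zero]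
    rw [this, map_zero]
  refine ⟨B.proj {d} w, B.proj_mem _ _, ?_⟩
  rw [B.lie_proj S.principalNilpotent_mem, ← hw]
  have : {e : ℤ | e - 1 ∈ ({d} : Set ℤ)} = {d + 1} := by
    ext e; simp; omega
  rw [this, B.proj_singleton_eq hy]

-- Iterated surjectivity of `ad I₊` reaches degree `k` from degree `0`, which is the Cartan
-- subalgebra.
include B in
lemma exists_iterate_lie (k : ℕ) {x : L} (hx : x ∈ principalPart S.gen k) :
    ∃ t ∈ H, ((LieAlgebra.ad ℂ L (principalNilpotent S.gen)) ^ k) t = x := by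
  induction k generalizing x with
  | zero => exact ⟨x, B.mem_cartan_of_mem hx, rfl⟩
  | succ k ih =>
    obtain ⟨y, hy, rfl⟩ := B.exists_lie_principalNilpotent (d := k) (by omega) (by exact_mod_cast hx)
    obtain ⟨t, ht, rfl⟩ := ih hy
    exact ⟨t, ht, by rw [pow_succ']; rfl⟩

include B in
/-- The centralizer of the principal nilpotent element is abelian. -/
lemma lie_eq_zero_of_principalNilpotent {x y : L} (hx : ⁅principalNilpotent S.gen, x⁆ = 0)
    (hy : ⁅principalNilpotent S.gen, y⁆ = 0) : ⁅x, y⁆ = 0 := by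
  have key : ∀ (k l : ℕ), ∀ x ∈ principalPart S.gen k, ∀ y ∈ principalPart S.gen l,
      ⁅principalNilpotent S.gen, x⁆ = 0 → ⁅principalNilpotent S.gen, y⁆ = 0 → ⁅x, y⁆ = 0 := by
    intro k l x hx y hy hx0 hy0
    obtain ⟨t, ht, rfl⟩ := B.exists_iterate_lie k hx
    obtain ⟨t', ht', rfl⟩ := B.exists_iterate_lie l hy
    set a := LieAlgebra.ad ℂ L (principalNilpotent S.gen) with ha
    have hab := S.gen.isLieAbelian_cartan
    have h0 : ⁅t, t'⁆ = 0 := by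
      simpa using congrArg Subtype.val (hab.trivial (⟨t, ht⟩ : H) ⟨t', ht'⟩)
    have hz : ∀ (m p : ℕ) (s : L), a ((a ^ m) s) = 0 → m < p → (a ^ p) s = 0 := by
      intro m p s h hmp
      obtain ⟨q, rfl⟩ := Nat.exists_eq_add_of_lt hmp
      have : m + q + 1 = q + (1 + m) := by ring
      rw [this, pow_add, pow_add]
      simp [h]
    -- Write `x = a^k t` and `y = a^l t'` with `t, t'` in the abelian Cartan subalgebra. Expanding
    -- `a^{k+l} [t, t'] = 0` by the Leibniz rule, `a^{k+1} t = 0 = a^{l+1} t'` leaves only a nonzero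
    -- multiple of `[x, y]`.
    have hL := LieDerivation.iterate_apply_lie
      (LieDerivation.ad ℂ L (principalNilpotent S.gen)) (k + l) t t'
    have hit : ∀ (p : ℕ) (s : L), (LieDerivation.ad ℂ L (principalNilpotent S.gen))^[p] s =
        (a ^ p) s := by
      intro p s
      rw [Module.End.pow_apply]
      exact congrFun (congrArg (fun g => g^[p]) (funext fun z => by simp [ha])) s
    rw [h0] at hL
    simp only [hit, map_zero] at hL
    rw [Finset.sum_eq_single (k, l)] at hL
    · have hc : ((k + l).choose k) ≠ 0 := (Nat.choose_pos (by omega)).ne'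
      have hL' : (((k + l).choose k : ℕ) : ℂ) • ⁅(a ^ k) t, (a ^ l) t'⁆ = 0 := by
        rw [Nat.cast_smul_eq_nsmul]; exact hL.symm
      exact (smul_eq_zero.1 hL').resolve_left (by exact_mod_cast hc)
    · rintro ⟨i, j⟩ hij hne
      rw [Finset.HasAntidiagonal.mem_antidiagonal] at hij
      rcases lt_trichotomy i k with hik | hik | hik
      · rw [hz l j t' hy0 (by omega), lie_zero, smul_zero]
      · exact absurd (by ext <;> simp <;> omega) hne
      · rw [hz k i t hx0 hik, zero_lie, smul_zero]
    · intro h; exact absurd (Finset.HasAntidiagonal.mem_antidiagonal.2 (by rfl)) h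
  have hcomp : ∀ (z : L), ⁅principalNilpotent S.gen, z⁆ = 0 → ∀ k,
      ⁅principalNilpotent S.gen, B.proj {k} z⁆ = 0 := by
    intro z hz k
    rw [B.lie_proj S.principalNilpotent_mem, hz, map_zero]
  rw [← B.sum_proj x, ← B.sum_proj y, sum_lie]
  refine Finset.sum_eq_zero fun k _ => ?_
  rw [lie_sum]
  refine Finset.sum_eq_zero fun l _ => ?_
  rcases lt_or_ge k 0 with hk | hk
  · rw [S.eq_zero_of_lie_principalNilpotent hk (B.proj_mem _ _) (hcomp x hx k), zero_lie]
  rcases lt_or_ge l 0 with hl | hl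
  · rw [S.eq_zero_of_lie_principalNilpotent hl (B.proj_mem _ _) (hcomp y hy l), lie_zero]
  lift k to ℕ using hk
  lift l to ℕ using hl
  exact key k l _ (B.proj_mem _ _) _ (B.proj_mem _ _) (hcomp x hx k) (hcomp y hy l)

/-! ### The range of degrees -/

lemma exists_d_eq {k : ℤ} (hk : principalPart S.gen k ≠ ⊥) : ∃ j, B.d j = k := by
  by_contra! h
  apply hk
  rw [Submodule.eq_bot_iff]
  intro x hx
  exact B.e.ext_elem fun j => by simpa using B.repr_eq_zero hx (h j)

include B in
lemma bddAbove : BddAbove {k : ℕ | principalPart S.gen (k : ℤ) ≠ ⊥} := by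
  refine (Set.Finite.subset (Set.finite_range fun j => (B.d j).toNat) ?_).bddAbove
  intro k hk
  obtain ⟨j, hj⟩ := B.exists_d_eq hk
  exact ⟨j, by simp [hj]⟩

include B in
lemma lt_h_of_ne_bot {k : ℤ} (hk : principalPart S.gen k ≠ ⊥) : k < S.h := by
  rcases lt_or_ge k 0 with h | h
  · omega
  lift k to ℕ using h
  have := le_csSup B.bddAbove hk
  simp only [h, coxeterNumber]
  omega

lemma d_lt (j : Fin N) : B.d j < S.h := by
  refine B.lt_h_of_ne_bot fun h => B.e.ne_zero j ?_
  have := B.mem j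
  rwa [h, Submodule.mem_bot] at this

/-- The form pairs degree `d` with degree `-d`, so the degrees are symmetric about `0`. -/
lemma neg_lt_d (j : Fin N) : -(S.h : ℤ) < B.d j := by
  suffices -B.d j < S.h by omega
  refine B.lt_h_of_ne_bot fun h => B.e.ne_zero j ?_
  apply S.eq_zero_of_form
  intro y
  rw [← B.form_proj (B.mem j)]
  have := B.proj_mem (-B.d j) y
  rw [h, Submodule.mem_bot] at this
  rw [this, map_zero]

lemma proj_eq_zero_of_ge {k : ℤ} (hk : (S.h : ℤ) ≤ k) (x : L) : B.proj {k} x = 0 := by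
  refine B.proj_eq_zero (fun h => ?_) x
  obtain ⟨j, _, rfl⟩ := Finset.mem_image.1 h
  have := B.d_lt j
  omega

include B in
/-- The root vector `E_{-θ}` has the lowest possible degree. -/
lemma Eneg_mem (hn : 0 < n) : S.Eneg ∈ principalPart S.gen (1 - S.h) := by
  have h1 : principalPart S.gen 1 ≠ ⊥ := by
    intro h
    refine (S.gen.sl2 ⟨0, hn⟩).e_ne_zero ?_
    have := S.e_mem ⟨0, hn⟩
    rwa [h, Submodule.mem_bot] at this
  have hmem : principalPart S.gen ((S.h - 1 : ℤ)) ≠ ⊥ := by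
    have := Nat.sSup_mem (s := {k : ℕ | principalPart S.gen (k : ℤ) ≠ ⊥})
      ⟨1, by simpa using h1⟩ B.bddAbove
    simpa [h, coxeterNumber] using this
  have hgt : (1 : ℤ) < S.h := B.lt_h_of_ne_bot h1
  set r : H := ⟨principalElement S.gen, principalElement_mem S.gen⟩ with hr
  have hroot : ∀ {χ : H → ℂ} {x : L}, x ∈ LieAlgebra.rootSpace H χ →
      ⁅principalElement S.gen, x⁆ = χ r • x := fun {χ x} hx =>
    IsKilling.lie_eq_smul_of_mem_rootSpace hx r
  -- The root space decomposition diagonalizes `ad ρ^∨` with eigenvalues `β(ρ^∨)`, so the top degree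
  -- `h - 1` is the height of some weight.
  obtain ⟨β, hβ⟩ : ∃ β : LieModule.Weight ℂ H L, β r = ((S.h - 1 : ℤ) : ℂ) := by
    have htop : ⨆ μ ∈ Set.range fun β : LieModule.Weight ℂ H L => β r,
        Module.End.eigenspace (LieAlgebra.ad ℂ L (principalElement S.gen)) μ = ⊤ := by
      have h2 := LieModule.iSup_genWeightSpace_eq_top' ℂ H L
      rw [← LieSubmodule.toSubmodule_inj, LieSubmodule.iSup_toSubmodule] at h2
      rw [eq_top_iff, ← LieSubmodule.top_toSubmodule (R := ℂ) (L := H) (M := L), ← h2]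
      refine iSup_le fun β x hx => ?_
      refine Submodule.mem_iSup_of_mem (β r) (Submodule.mem_iSup_of_mem ⟨β, rfl⟩ ?_)
      rw [Module.End.mem_eigenspace_iff]
      exact hroot hx
    exact (Module.End.eigenspaces_iSupIndep _).mem_of_biSup_eq_top htop hmem
  have hβ0 : β ∈ H.root := by
    simp only [LieSubalgebra.root, Finset.mem_filter, Finset.mem_univ, true_and]
    intro h0
    have h2 : β r = 0 := by
      have : (β : H → ℂ) = 0 := h0
      rw [this, Pi.zero_apply]
    rw [h2] at hβ
    have : (S.h - 1 : ℤ) = 0 := by exact_mod_cast hβ.symm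
    omega
  obtain ⟨c, hc⟩ := S.isHighestRoot.2 β hβ0
  have hα : ∀ i, S.gen.baseSupp i r = 1 := by
    intro i
    have h2 := S.gen.baseSupp_apply_smul_e i r
    have h3 : ⁅r, S.gen.e i⁆ = S.gen.e i := principalElement_lie_e S.gen i
    rw [h3] at h2
    have h4 : (S.gen.baseSupp i r - 1) • S.gen.e i = 0 := by rw [sub_smul, h2, one_smul, sub_self]
    exact sub_eq_zero.1 ((smul_eq_zero.1 h4).resolve_right (S.gen.sl2 i).e_ne_zero)
  -- Each simple root takes the value `1` at `ρ^∨`, so `θ` is higher than `β` by `∑ c_i`. As `E_θ ≠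
  -- 0`, the height of `θ` is below `h`, which forces `∑ c_i = 0`.
  have hθ : S.θ r = ((S.h - 1 + ∑ i, (c i : ℤ) : ℤ) : ℂ) := by
    have := congrFun hc r
    simp only [hβ, hα, mul_one] at this
    rw [this]; push_cast; rfl
  have hE : S.Eneg ∈ principalPart S.gen (-(S.h - 1 + ∑ i, (c i : ℤ))) := by
    rw [mem_principalPart, hroot S.Eneg_mem, Pi.neg_apply, hθ]
    push_cast; rfl
  have hE' : S.Epos ∈ principalPart S.gen (S.h - 1 + ∑ i, (c i : ℤ)) := by
    rw [mem_principalPart, hroot S.Epos_mem, hθ]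
  have hne : principalPart S.gen (S.h - 1 + ∑ i, (c i : ℤ)) ≠ ⊥ := by
    intro h
    rw [h, Submodule.mem_bot] at hE'
    have := S.form_Epos_Eneg
    rw [hE', map_zero, LinearMap.zero_apply] at this
    exact zero_ne_one this
  have hlt := B.lt_h_of_ne_bot hne
  have hnn : 0 ≤ ∑ i, (c i : ℤ) := Finset.sum_nonneg fun i _ => by positivity
  have h0 : ∑ i, (c i : ℤ) = 0 := by omega
  rw [h0] at hE
  convert hE using 1
  ring_nf

end Setup.HomogeneousBasis

end

/-! ### The centralizer of `I₊ + E_{-θ}` in `𝔤`. -/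

section

open LieAlgebra

variable {L : Type*} [LieRing L] [LieAlgebra ℂ L] [FiniteDimensional ℂ L]
  [LieAlgebra.IsSimple ℂ L] {H : LieSubalgebra ℂ L} [H.IsCartanSubalgebra] {n N : ℕ}

namespace Setup.HomogeneousBasis

variable {S : Setup H n} (B : S.HomogeneousBasis N)

lemma lie_proj_singleton {i : ℤ} {x : L} (hx : x ∈ principalPart S.gen i) (k : ℤ) (y : L) :
    ⁅x, B.proj {k} y⁆ = B.proj {k + i} ⁅x, y⁆ := by
  rw [B.lie_proj hx]
  congr 2
  ext e; simp; omega

/-- The homogeneous components of the equation `[I₊ + E_{-θ}, x] = 0`. -/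
lemma lie_proj_of_lie_cyclic (hn : 0 < n) {x : L} (hx : ⁅S.cyclic, x⁆ = 0) (k : ℤ) :
    ⁅principalNilpotent S.gen, B.proj {k} x⁆ = -⁅S.Eneg, B.proj {k + S.h} x⁆ := by
  rw [B.lie_proj_singleton S.principalNilpotent_mem, B.lie_proj_singleton (B.Eneg_mem hn)]
  rw [Setup.cyclic, add_lie, add_eq_zero_iff_eq_neg] at hx
  rw [hx, map_neg]
  congr 4; ring

lemma h_pos (S : Setup H n) : 0 < S.h := by simp [Setup.h, coxeterNumber]

/-- The right-hand side of `lie_proj_of_lie_cyclic` involves degree `k + h ≥ h`, which does not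
occur. -/
lemma lie_proj_of_nonneg (hn : 0 < n) {x : L} (hx : ⁅S.cyclic, x⁆ = 0) {k : ℤ} (hk : 0 ≤ k) :
    ⁅principalNilpotent S.gen, B.proj {k} x⁆ = 0 := by
  rw [B.lie_proj_of_lie_cyclic hn hx, B.proj_eq_zero_of_ge (by omega), lie_zero, neg_zero]

/-- The component of degree `k < 0` is determined by the one of degree `k + h`, as `ad I₊` is
injective in negative degrees. -/
lemma proj_eq_zero_of_lie_cyclic (hn : 0 < n) {x : L} (hx : ⁅S.cyclic, x⁆ = 0) {k : ℤ} (hk : k < 0)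
    (h : B.proj {k + S.h} x = 0) : B.proj {k} x = 0 := by
  refine S.eq_zero_of_lie_principalNilpotent hk (B.proj_mem _ _) ?_
  rw [B.lie_proj_of_lie_cyclic hn hx, h, lie_zero, neg_zero]

lemma eq_zero_of_lie_cyclic (hn : 0 < n) {x : L} (hx : ⁅S.cyclic, x⁆ = 0)
    (h : ∀ k : ℤ, 0 ≤ k → B.proj {k} x = 0) : x = 0 := by
  have hh := h_pos S
  have key : ∀ m : ℕ, ∀ k : ℤ, -(m : ℤ) ≤ k → B.proj {k} x = 0 := by
    intro m
    induction m with
    | zero => intro k hk; exact h k (by simpa using hk)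
    | succ m ih =>
      intro k hk
      rcases lt_or_ge k 0 with hk0 | hk0
      · exact B.proj_eq_zero_of_lie_cyclic hn hx hk0 (ih _ (by push_cast at hk; omega))
      · exact h k hk0
  refine B.eq_of_proj_eq fun k => ?_
  rw [map_zero, key k.natAbs k (by omega)]

/-- The operator `ad I₊` on the components of nonnegative degree, and the identity on the others. -/
def raise : L →ₗ[ℂ] L :=
  (LieAlgebra.ad ℂ L (principalNilpotent S.gen)) ∘ₗ B.proj {k | 0 ≤ k} + B.proj {k | k < 0}

lemma finrank_cartan (S : Setup H n) : Module.finrank ℂ H = n := by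
  simpa using Module.finrank_eq_card_basis (simpleCorootBasis S.gen)

/-- `raise` hits every element whose degree-zero component vanishes. Hence its corank, which equals
its nullity, is at most the dimension of the Cartan subalgebra. -/
lemma finrank_ker_raise_le : Module.finrank ℂ (LinearMap.ker B.raise) ≤ n := by
  classical
  have h1 : LinearMap.ker (B.proj {0}) ≤ LinearMap.range B.raise := by
    intro y hy
    rw [← B.sum_proj y]
    refine sum_mem fun k _ => ?_
    rcases lt_trichotomy k 0 with hk | hk | hk
    · refine ⟨B.proj {k} y, ?_⟩
      have h2 := B.proj_mem k y
      simp only [raise, LinearMap.add_apply, LinearMap.comp_apply]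
      rw [B.proj_of_mem h2, if_neg (by simpa using hk), B.proj_of_mem h2, if_pos (show k ∈ {k : ℤ | k < 0} from hk),
        map_zero, zero_add]
    · subst hk; rw [LinearMap.mem_ker.1 hy]; exact zero_mem _
    · obtain ⟨x, hx, hxy⟩ := B.exists_lie_principalNilpotent (d := k - 1) (by omega)
        (y := B.proj {k} y) (by simpa using B.proj_mem k y)
      refine ⟨x, ?_⟩
      simp only [raise, LinearMap.add_apply, LinearMap.comp_apply]
      rw [B.proj_of_mem hx, if_pos (show k - 1 ∈ {k : ℤ | 0 ≤ k} from show 0 ≤ k - 1 by omega), B.proj_of_mem hx,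
        if_neg (show k - 1 ∉ {k : ℤ | k < 0} from show ¬ (k - 1 < 0) by omega), add_zero]
      exact hxy
  have h2 : LinearMap.range (B.proj {0}) ≤ H.toSubmodule := by
    rintro _ ⟨y, rfl⟩
    exact B.mem_cartan_of_mem (B.proj_mem 0 y)
  have h3 := Submodule.finrank_mono h1
  have h4 : Module.finrank ℂ (LinearMap.range (B.proj {0})) ≤ n :=
    (Submodule.finrank_mono h2).trans (finrank_cartan S).le
  have h5 := (B.proj {0}).finrank_range_add_finrank_ker
  have h6 := B.raise.finrank_range_add_finrank_ker
  omega

lemma proj_of_forall {s : Set ℤ} {x y : L} (h : ∀ k ∈ s, B.proj {k} x = B.proj {k} y) :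
    B.proj s x = B.proj s y := by
  refine B.eq_of_proj_eq fun k => ?_
  rw [B.proj_proj, B.proj_proj]
  by_cases hk : k ∈ s
  · rw [Set.inter_eq_left.2 (by simpa using hk)]; exact h k hk
  · rw [Set.singleton_inter_eq_empty.2 hk, B.proj_empty, B.proj_empty]

-- An element of the centralizer is determined by its components of nonnegative degree, and these
-- commute with `I₊`. So the projection to nonnegative degrees embeds the centralizer in the kernel
-- of `raise`.
include B in
lemma finrank_ker_cyclic_le (hn : 0 < n) :
    Module.finrank ℂ (LinearMap.ker (LieAlgebra.ad ℂ L S.cyclic)) ≤ n := by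
  refine le_trans ?_ B.finrank_ker_raise_le
  have hmap : ∀ x ∈ LinearMap.ker (LieAlgebra.ad ℂ L S.cyclic),
      B.proj {k | 0 ≤ k} x ∈ LinearMap.ker B.raise := by
    intro x hx
    have hx' : ⁅S.cyclic, x⁆ = 0 := hx
    rw [LinearMap.mem_ker, raise, LinearMap.add_apply, LinearMap.comp_apply, B.proj_proj,
      B.proj_proj, Set.inter_self]
    have h1 : ({k | k < 0} ∩ {k | 0 ≤ k} : Set ℤ) = ∅ := by ext; simp
    rw [h1, B.proj_empty, add_zero, LieAlgebra.ad_apply, B.lie_proj S.principalNilpotent_mem]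
    rw [B.proj_of_forall (y := 0), map_zero]
    intro k hk
    rw [map_zero]
    have h2 := B.lie_proj_singleton S.principalNilpotent_mem (k - 1) x
    rw [sub_add_cancel] at h2
    rw [← h2]
    exact B.lie_proj_of_nonneg hn hx' hk
  refine LinearMap.finrank_le_finrank_of_injective
    (f := (B.proj {k | 0 ≤ k}).restrict hmap) ?_
  rw [← LinearMap.ker_eq_bot, LinearMap.ker_eq_bot']
  rintro ⟨x, hx⟩ h0
  have h1 : B.proj {k | 0 ≤ k} x = 0 := congrArg Subtype.val h0
  refine Subtype.ext (B.eq_zero_of_lie_cyclic hn hx fun k hk => ?_)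
  have h2 := B.proj_proj {k} {k | 0 ≤ k} x
  rwa [h1, map_zero, Set.inter_eq_left.2 (by simpa using hk), eq_comm] at h2

/-- The bracket of two elements of the centralizer of `I₊ + E_{-θ}` has smaller degree. -/
lemma proj_lie_eq_zero (hn : 0 < n) {x y : L} (hx : ⁅S.cyclic, x⁆ = 0) (hy : ⁅S.cyclic, y⁆ = 0)
    {r : ℤ} (hr : ∀ k, r ≤ k → B.proj {k} y = 0) (k : ℤ) (hrk : r ≤ k + 1) :
    B.proj {k} ⁅x, y⁆ = 0 := by
  classical
  have hyneg : ∀ q : ℤ, q < 0 → r ≤ q + S.h → B.proj {q} y = 0 := fun q hq hqr =>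
    B.proj_eq_zero_of_lie_cyclic hn hy hq (hr _ hqr)
  nth_rw 1 [← B.sum_proj x, ← B.sum_proj y]
  rw [sum_lie, map_sum]
  refine Finset.sum_eq_zero fun p _ => ?_
  rw [lie_sum, map_sum]
  refine Finset.sum_eq_zero fun q _ => ?_
  rw [B.proj_of_mem (lie_mem_principalPart (B.proj_mem p x) (B.proj_mem q y))]
  split_ifs with hpq
  · rw [Set.mem_singleton_iff] at hpq
    -- For `p + q = k`: if `p < 0` then `q > k`, so `q ≥ r`. If `q < 0` then `p < h` gives `q + h >
    -- k`, so `y_{q+h} = 0` and with it `y_q`. If both are nonnegative, the components lie in the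
    -- abelian centralizer of `I₊`.
    rcases le_or_gt (S.h : ℤ) p with hp' | hp'
    · rw [B.proj_eq_zero_of_ge hp', zero_lie]
    rcases lt_or_ge p 0 with hp | hp
    · rw [hr q (by omega), lie_zero]
    rcases lt_or_ge q 0 with hq | hq
    · rw [hyneg q hq (by omega), lie_zero]
    · exact B.lie_eq_zero_of_principalNilpotent (B.lie_proj_of_nonneg hn hx hp)
        (B.lie_proj_of_nonneg hn hy hq)
  · rfl

/-- The centralizer of `I₊ + E_{-θ}` as a subalgebra. -/
def centralizer (S : Setup H n) : LieSubalgebra ℂ L where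
  __ := LinearMap.ker (LieAlgebra.ad ℂ L S.cyclic)
  lie_mem' {x y} hx hy := by
    have hx' : ⁅S.cyclic, x⁆ = 0 := hx
    have hy' : ⁅S.cyclic, y⁆ = 0 := hy
    change ⁅S.cyclic, ⁅x, y⁆⁆ = 0
    rw [leibniz_lie, hx', hy', zero_lie, lie_zero, add_zero]

-- By `proj_lie_eq_zero`, each application of `ad x` lowers the bound on the nonnegative degrees by
-- one. They are exhausted after at most `h` steps, and Engel's theorem applies.
include B in
lemma isNilpotent_centralizer (hn : 0 < n) : LieRing.IsNilpotent (centralizer S) := by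
  rw [LieAlgebra.isNilpotent_iff_forall (R := ℂ)]
  intro x
  refine ⟨S.h + 1, LinearMap.ext fun y => ?_⟩
  have key : ∀ m : ℕ, ∀ k : ℤ, 0 ≤ k → (S.h : ℤ) ≤ k + m →
      B.proj {k} (((LieAlgebra.ad ℂ (centralizer S) x) ^ m) y : centralizer S) = 0 := by
    intro m
    induction m with
    | zero => intro k hk hk'; exact B.proj_eq_zero_of_ge (by simpa using hk') _
    | succ m ih =>
      intro k hk hk'
      rw [pow_succ', Module.End.mul_apply, LieAlgebra.ad_apply, LieSubalgebra.coe_bracket]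
      refine B.proj_lie_eq_zero hn x.2 (((LieAlgebra.ad ℂ (centralizer S) x) ^ m) y).2
        (r := max (S.h - m) 0) ?_ k ?_
      · intro l hl; exact ih l (by omega) (by omega)
      · push_cast at hk'; omega
  exact Subtype.ext (B.eq_zero_of_lie_cyclic hn
    (((LieAlgebra.ad ℂ (centralizer S) x) ^ (S.h + 1)) y).2 fun k hk =>
    key _ k hk (by push_cast; omega))

/-- The projection onto the centralizer of `I₊ + E_{-θ}`. -/
def kerProj (S : Setup H n) (l : Fin n → L) : L →ₗ[ℂ] L :=
  ∑ b, (S.h : ℂ)⁻¹ • (S.form.flip (l b)).smulRight (l b.rev)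

lemma kerProj_apply (l : Fin n → L) (v : L) :
    kerProj S l v = ∑ b, ((S.h : ℂ)⁻¹ * S.form v (l b)) • l b.rev := by
  simp [kerProj, smul_smul]

lemma eta_eq (S : Setup H n) (a b : Fin n) : S.eta a b = if b = a.rev then 1 else 0 := by
  simp only [Setup.eta]
  congr 1
  rw [Fin.ext_iff, Fin.val_rev, eq_iff_iff]
  omega

lemma h_ne_zero (S : Setup H n) : (S.h : ℂ) ≠ 0 := by
  exact_mod_cast (h_pos S).ne'

section Gram

variable {l : Fin n → L} (hl : ∀ a, ⁅S.cyclic, l a⁆ = 0)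
  (hg : ∀ a b, S.form (l a) (l b) = S.h * S.eta a b)

include hg in
lemma kerProj_gram (a : Fin n) : kerProj S l (l a) = l a := by
  rw [kerProj_apply, Finset.sum_eq_single a.rev]
  · rw [hg, eta_eq, if_pos rfl, mul_one, inv_mul_cancel₀ (h_ne_zero S), one_smul, Fin.rev_rev]
  · intro b _ hb
    rw [hg, eta_eq, if_neg hb]; simp
  · simp

-- The Gram matrix is invertible, so the `n` vectors `l a` are independent. The centralizer has
-- dimension at most `n`, hence they span it.
include B hl hg in
lemma kerProj_eq_self (hn : 0 < n) {x : L} (hx : ⁅S.cyclic, x⁆ = 0) : kerProj S l x = x := by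
  have hli : LinearIndependent ℂ l := by
    rw [Fintype.linearIndependent_iff]
    intro c hc a
    have h1 := congrArg (fun v => S.form v (l a.rev)) hc
    simp only [map_sum, map_smul, LinearMap.sum_apply, LinearMap.smul_apply, hg, map_zero,
      LinearMap.zero_apply, eta_eq, smul_eq_mul] at h1
    rw [Finset.sum_eq_single a] at h1
    · simpa [h_ne_zero S] using h1
    · intro b _ hb; rw [if_neg (by simpa [eq_comm] using hb)]; simp
    · simp
  have hspan : Submodule.span ℂ (Set.range l) = LinearMap.ker (LieAlgebra.ad ℂ L S.cyclic) := by
    refine Submodule.eq_of_le_of_finrank_le ?_ ?_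
    · rw [Submodule.span_le]
      rintro _ ⟨a, rfl⟩
      exact hl a
    · rw [finrank_span_eq_card hli, Fintype.card_fin]
      exact B.finrank_ker_cyclic_le hn
  have hx' : x ∈ Submodule.span ℂ (Set.range l) := by rw [hspan]; exact hx
  induction hx' using Submodule.span_induction with
  | mem x h => obtain ⟨a, rfl⟩ := h; exact kerProj_gram hg a
  | zero => simp
  | add x y hxs hys ihx ihy =>
    rw [hspan] at hxs hys
    rw [map_add, ihx hxs, ihy hys]
  | smul c x hxs ihx =>
    rw [hspan] at hxs
    rw [map_smul, ihx hxs]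

include B hl hg in
/-- The centralizer of `I₊ + E_{-θ}` is abelian. -/
lemma lie_eq_zero_of_lie_cyclic (hn : 0 < n) {x y : L} (hx : ⁅S.cyclic, x⁆ = 0)
    (hy : ⁅S.cyclic, y⁆ = 0) : ⁅x, y⁆ = 0 := by
  have := B.isNilpotent_centralizer hn
  have hab : IsLieAbelian (centralizer S) := by
    -- A nilpotent subalgebra on which the trace form of `𝔤` is nondegenerate is abelian.
    -- Nondegeneracy is read off from the Gram matrix.
    refine LieModule.isLieAbelian_of_ker_traceForm_eq_bot ℂ (centralizer S) L ?_
    rw [LinearMap.ker_eq_bot']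
    intro z hz
    refine Subtype.ext ?_
    rw [← B.kerProj_eq_self hl hg hn z.2, kerProj_apply]
    refine Finset.sum_eq_zero fun b _ => ?_
    have h1 : killingForm ℂ L z (l b) = 0 :=
      LinearMap.congr_fun hz (⟨l b, hl b⟩ : centralizer S)
    have h2 : S.form z (l b) = 0 := by
      simp only [Setup.form, normalizedForm, LinearMap.smul_apply]
      rw [h1, smul_zero]
    rw [h2, mul_zero, zero_smul]
  simpa using congrArg Subtype.val (hab.trivial (⟨x, hx⟩ : centralizer S) ⟨y, hy⟩)

lemma lie_kerProj (hl : ∀ a, ⁅S.cyclic, l a⁆ = 0) (v : L) : ⁅S.cyclic, kerProj S l v⁆ = 0 := by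
  rw [kerProj_apply, lie_sum]
  exact Finset.sum_eq_zero fun b _ => by rw [lie_smul, hl, smul_zero]

lemma kerProj_lie (hl : ∀ a, ⁅S.cyclic, l a⁆ = 0) (v : L) : kerProj S l ⁅S.cyclic, v⁆ = 0 := by
  rw [kerProj_apply]
  refine Finset.sum_eq_zero fun b _ => ?_
  rw [← lie_skew, map_neg, LinearMap.neg_apply, S.form_lie, hl, map_zero]
  simp

include B hl hg in
/-- A partial inverse of `ad (I₊ + E_{-θ})`. -/
lemma exists_partialInverse (hn : 0 < n) : ∃ ψ : L →ₗ[ℂ] L,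
    (∀ v, v = kerProj S l v + ⁅S.cyclic, ψ v⁆) ∧ (∀ v, v = kerProj S l v + ψ ⁅S.cyclic, v⁆) := by
  set a := LieAlgebra.ad ℂ L S.cyclic
  obtain ⟨g, hgs⟩ := a.rangeRestrict.exists_rightInverse_of_surjective a.range_rangeRestrict
  -- The difference is orthogonal to the kernel of the operator, hence lies in its range.
  have hr : ∀ v, v - kerProj S l v ∈ LinearMap.range a := by
    intro v
    obtain ⟨w, hw⟩ := S.exists_eq_lie S.cyclic (v - kerProj S l v) fun z hz => by
      rw [← B.kerProj_eq_self hl hg hn hz, kerProj_apply, kerProj_apply]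
      simp only [map_sub, LinearMap.sub_apply, map_sum, map_smul, LinearMap.sum_apply,
        LinearMap.smul_apply, smul_eq_mul, hg]
      refine Finset.sum_eq_zero fun c _ => ?_
      rw [Finset.sum_eq_single c.rev]
      · rw [eta_eq, if_pos (by simp)]
        have := h_ne_zero S
        field_simp
        ring
      · intro b _ hb
        rw [eta_eq, if_neg]
        · simp
        · rw [Fin.rev_rev]; rintro rfl; simp at hb
      · simp
    exact ⟨w, hw.symm⟩
  let q : L →ₗ[ℂ] LinearMap.range a := (LinearMap.id - kerProj S l).codRestrict _ hr
  -- `g` is a section of `ad (I₊ + E_{-θ})` over its range. Removing the kernel component on the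
  -- left makes `kerProj ∘ ψ = 0`, which turns the right inverse into a left inverse too.
  let ψ : L →ₗ[ℂ] L := (LinearMap.id - kerProj S l) ∘ₗ g ∘ₗ q
  have hψ : ∀ v, ⁅S.cyclic, ψ v⁆ = v - kerProj S l v := by
    intro v
    have h1 : a (g (q v)) = q v := congrArg Subtype.val (LinearMap.congr_fun hgs (q v))
    simp only [ψ, LinearMap.comp_apply, LinearMap.sub_apply, LinearMap.id_apply, lie_sub]
    rw [lie_kerProj hl, sub_zero]
    exact h1
  refine ⟨ψ, fun v => by rw [hψ]; abel, fun v => ?_⟩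
  have h1 : ⁅S.cyclic, ψ ⁅S.cyclic, v⁆ - v⁆ = 0 := by
    rw [lie_sub, hψ, kerProj_lie hl, sub_zero, sub_self]
  have h2 := B.kerProj_eq_self hl hg hn h1
  have h3 : ∀ w, kerProj S l (ψ w) = 0 := by
    intro w
    simp only [ψ, LinearMap.comp_apply, LinearMap.sub_apply, LinearMap.id_apply, map_sub]
    rw [B.kerProj_eq_self hl hg hn (lie_kerProj hl _), sub_self]
  rw [map_sub, h3, zero_sub, neg_eq_iff_eq_neg] at h2
  rw [h2]; abel

end Gram

end Setup.HomogeneousBasis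

end

/-! ### Exponentials and dressing in a complete filtered Lie algebra. -/

section

/-- A complete, separated and exhaustive decreasing filtration of a Lie algebra. -/
structure LieFiltration (M : Type*) [LieRing M] [LieAlgebra ℂ M] where
  fil : ℤ → Submodule ℂ M
  anti : Antitone fil
  lie_mem : ∀ {i j x y}, x ∈ fil i → y ∈ fil j → ⁅x, y⁆ ∈ fil (i + j)
  exhaust : ∀ x, ∃ i, x ∈ fil i
  separated : ∀ x, (∀ i, x ∈ fil i) → x = 0
  complete : ∀ (j : ℤ) (f : ℕ → M), (∀ k : ℕ, f k ∈ fil (j + k)) →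
    ∃ x, ∀ K : ℕ, x - ∑ k ∈ Finset.range K, f k ∈ fil (j + K)

section ExpTerm

variable {M : Type*} [LieRing M] [LieAlgebra ℂ M]

/-- The term `(ad U)^n / n!` of the exponential series. -/
def expTerm (U : M) (n : ℕ) : M →ₗ[ℂ] M := ((n.factorial : ℂ)⁻¹) • (LieAlgebra.ad ℂ M U) ^ n

lemma expTerm_apply (U : M) (n : ℕ) (x : M) :
    expTerm U n x = ((n.factorial : ℂ)⁻¹) • ((fun z => ⁅U, z⁆)^[n] x) := by
  rw [expTerm, LinearMap.smul_apply, Module.End.pow_apply]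
  rfl

@[simp] lemma expTerm_zero (U x : M) : expTerm U 0 x = x := by simp [expTerm]

@[simp] lemma expTerm_one (U x : M) : expTerm U 1 x = ⁅U, x⁆ := by simp [expTerm]

lemma lie_expTerm (U : M) (n : ℕ) (x : M) :
    ⁅U, expTerm U n x⁆ = ((n : ℂ) + 1) • expTerm U (n + 1) x := by
  have h : ((n : ℂ) + 1) ≠ 0 := by exact_mod_cast n.succ_ne_zero
  simp only [expTerm, LinearMap.smul_apply, lie_smul, pow_succ', Module.End.mul_apply,
    LieAlgebra.ad_apply, smul_smul, Nat.factorial_succ]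
  congr 1
  push_cast
  field_simp

/-- The Leibniz rule for `(ad U)^n`, with the binomial coefficients absorbed in the factorials. -/
lemma expTerm_lie (U : M) (n : ℕ) (x y : M) :
    expTerm U n ⁅x, y⁆ = ∑ p ∈ Finset.HasAntidiagonal.antidiagonal n,
      ⁅expTerm U p.1 x, expTerm U p.2 y⁆ := by
  have hL := LieDerivation.iterate_apply_lie (LieDerivation.ad ℂ M U) n x y
  have hit : ∀ (p : ℕ) (s : M), (LieDerivation.ad ℂ M U)^[p] s =
      (LieAlgebra.ad ℂ M U ^ p) s := by
    intro p s
    rw [Module.End.pow_apply]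
    exact congrFun (congrArg (fun g => g^[p]) (funext fun z => by simp)) s
  simp only [hit] at hL
  simp only [expTerm, LinearMap.smul_apply, hL, Finset.smul_sum, smul_lie, lie_smul, smul_smul]
  refine Finset.sum_congr rfl fun p hp => ?_
  rw [Finset.HasAntidiagonal.mem_antidiagonal] at hp
  rw [← Nat.cast_smul_eq_nsmul ℂ, smul_smul]
  congr 1
  subst hp
  have h1 := Nat.choose_mul_factorial_mul_factorial (Nat.le_add_right p.1 p.2)
  have h2 : (((p.1 + p.2).choose p.1 : ℂ)) * p.1.factorial * p.2.factorial =
      (p.1 + p.2).factorial := by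
    rw [Nat.add_sub_cancel_left] at h1
    exact_mod_cast h1
  have := Nat.factorial_ne_zero p.1
  have := Nat.factorial_ne_zero p.2
  have := Nat.factorial_ne_zero (p.1 + p.2)
  field_simp
  linear_combination h2

/-- The term of order `n` of `e^{-ad U} e^{ad U}`, that is, the binomial expansion of `(ad U - ad
U)^n / n!`. -/
lemma sum_expTerm_neg (U : M) (n : ℕ) (hn : 0 < n) (x : M) :
    ∑ k ∈ Finset.range (n + 1), expTerm (-U) (n - k) (expTerm U k x) = 0 := by
  have hc : Commute (-LieAlgebra.ad ℂ M U) (LieAlgebra.ad ℂ M U) := (Commute.refl _).neg_left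
  have h1 := hc.symm.add_pow n
  rw [add_neg_cancel, zero_pow hn.ne'] at h1
  have h2 := LinearMap.congr_fun h1 x
  rw [LinearMap.zero_apply, LinearMap.sum_apply] at h2
  have h3 := congrArg (fun z => (n.factorial : ℂ)⁻¹ • z) h2
  simp only [smul_zero, Finset.smul_sum] at h3
  rw [h3]
  refine Finset.sum_congr rfl fun k hk => ?_
  have hk' : k ≤ n := by simpa [Nat.lt_succ_iff] using hk
  have h4 := Nat.choose_mul_factorial_mul_factorial hk'
  have h5 : ((n.choose k : ℂ)) * k.factorial * (n - k).factorial = n.factorial := by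
    exact_mod_cast h4
  have hcc : Commute ((-LieAlgebra.ad ℂ M U) ^ (n - k)) ((LieAlgebra.ad ℂ M U) ^ k) := hc.pow_pow _ _
  rw [← hcc.eq, ← (Nat.cast_commute (n.choose k) _).eq]
  simp only [expTerm, map_neg, LinearMap.smul_apply, map_smul, smul_smul, Module.End.mul_apply]
  rw [Module.End.natCast_apply, ← Nat.cast_smul_eq_nsmul ℂ, smul_smul]
  congr 1
  have := Nat.factorial_ne_zero k
  have := Nat.factorial_ne_zero (n - k)
  have := Nat.factorial_ne_zero n
  field_simp
  linear_combination -h5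

/-- The commutator of a derivation with a term of the exponential series. -/
lemma derivation_expTerm (D : M →ₗ[ℂ] M) (hD : ∀ x y, D ⁅x, y⁆ = ⁅D x, y⁆ + ⁅x, D y⁆)
    (U : M) (n : ℕ) (x : M) :
    D (expTerm U (n + 1) x) = expTerm U (n + 1) (D x) +
      ∑ p ∈ Finset.HasAntidiagonal.antidiagonal n,
        ⁅((p.1 : ℂ) + 1)⁻¹ • expTerm U p.1 (D U), expTerm U p.2 x⁆ := by
  induction n with
  | zero => simp [hD, add_comm]
  | succ n ih =>
    have hn2 : ((n : ℂ) + 2) ≠ 0 := by exact_mod_cast (n + 1).succ_ne_zero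
    have h1 : ((n : ℂ) + 2) • D (expTerm U (n + 2) x) = D ⁅U, expTerm U (n + 1) x⁆ := by
      rw [lie_expTerm, map_smul]; push_cast; congr 1; ring
    have h2 : ((n : ℂ) + 2) • expTerm U (n + 2) (D x) = ⁅U, expTerm U (n + 1) (D x)⁆ := by
      rw [lie_expTerm]; push_cast; congr 1; ring
    refine smul_right_injective M hn2 ?_
    change ((n : ℂ) + 2) • D (expTerm U (n + 2) x) = ((n : ℂ) + 2) • (_ + _)
    rw [smul_add, h1, h2, hD, ih, lie_add, ← add_assoc, add_comm ⁅D U, _⁆, add_assoc]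
    congr 1
    -- These are the terms `(ad U)^p (D U) / (p+1)!` of the element `Y` with `D e^{ad U} - e^{ad U}
    -- D = ad_Y e^{ad U}`.
    set y : ℕ → M := fun p => ((p : ℂ) + 1)⁻¹ • expTerm U p (D U) with hy
    have hUy : ∀ p, ⁅U, y p⁆ = ((p : ℂ) + 2) • y (p + 1) := by
      intro p
      have hp1 : ((p : ℂ) + 1) ≠ 0 := by exact_mod_cast p.succ_ne_zero
      have hp2 : ((p : ℂ) + 1 + 1) ≠ 0 := by exact_mod_cast (p + 1).succ_ne_zero
      simp only [hy, lie_smul, lie_expTerm, smul_smul]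
      congr 1
      push_cast
      field_simp
      ring
    set f : ℕ → ℕ → M := fun p q => ⁅y p, expTerm U q x⁆ with hf
    have hUf : ∀ p q, ⁅U, f p q⁆ = ((p : ℂ) + 2) • f (p + 1) q + ((q : ℂ) + 1) • f p (q + 1) := by
      intro p q
      simp only [hf]
      rw [leibniz_lie, hUy, lie_expTerm, smul_lie, lie_smul]
    change ⁅D U, expTerm U (n + 1) x⁆ + ⁅U, ∑ p ∈ Finset.HasAntidiagonal.antidiagonal n, f p.1 p.2⁆ =
      ((n : ℂ) + 2) • ∑ p ∈ Finset.HasAntidiagonal.antidiagonal (n + 1), f p.1 p.2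
    have h3 : ⁅D U, expTerm U (n + 1) x⁆ = f 0 (n + 1) := by simp [hf, hy]
    have h4 : ∑ p ∈ Finset.HasAntidiagonal.antidiagonal (n + 1), ((p.1 : ℂ) + 1) • f p.1 p.2 =
        f 0 (n + 1) + ∑ p ∈ Finset.HasAntidiagonal.antidiagonal n,
          ((p.1 : ℂ) + 2) • f (p.1 + 1) p.2 := by
      rw [Finset.Nat.sum_antidiagonal_succ]
      simp only [Nat.cast_zero, zero_add, one_smul]
      congr 1
      refine Finset.sum_congr rfl fun p _ => ?_
      push_cast; congr 1; ring
    have h5 : ∑ p ∈ Finset.HasAntidiagonal.antidiagonal (n + 1), (p.2 : ℂ) • f p.1 p.2 =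
        ∑ p ∈ Finset.HasAntidiagonal.antidiagonal n, ((p.2 : ℂ) + 1) • f p.1 (p.2 + 1) := by
      rw [Finset.Nat.sum_antidiagonal_succ']
      simp
    -- On the antidiagonal `p + q = n + 1`, split the weight `n + 2` as `(p + 1) + q`.
    have h6 : ((n : ℂ) + 2) • ∑ p ∈ Finset.HasAntidiagonal.antidiagonal (n + 1), f p.1 p.2 =
        ∑ p ∈ Finset.HasAntidiagonal.antidiagonal (n + 1), ((p.1 : ℂ) + 1) • f p.1 p.2 +
        ∑ p ∈ Finset.HasAntidiagonal.antidiagonal (n + 1), (p.2 : ℂ) • f p.1 p.2 := by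
      rw [Finset.smul_sum, ← Finset.sum_add_distrib]
      refine Finset.sum_congr rfl fun p hp => ?_
      rw [Finset.HasAntidiagonal.mem_antidiagonal] at hp
      rw [← add_smul]
      congr 1
      have : (p.1 : ℂ) + p.2 = n + 1 := by exact_mod_cast hp
      linear_combination -this
    rw [h6, h4, h5, h3, lie_sum, add_assoc, ← Finset.sum_add_distrib]
    congr 1
    exact Finset.sum_congr rfl fun p _ => hUf _ _

end ExpTerm

namespace LieFiltration

variable {M : Type*} [LieRing M] [LieAlgebra ℂ M] (F : LieFiltration M)

/-- `x` is the sum of the `f k ∈ fil (j + k)`. -/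
def IsSum (j : ℤ) (f : ℕ → M) (x : M) : Prop :=
  (∀ k : ℕ, f k ∈ F.fil (j + k)) ∧ ∀ K : ℕ, x - ∑ k ∈ Finset.range K, f k ∈ F.fil (j + K)

lemma mem_of_le {i j : ℤ} (h : i ≤ j) {x : M} (hx : x ∈ F.fil j) : x ∈ F.fil i := F.anti h hx

lemma eq_of_sub_mem {x y : M} (j : ℤ) (h : ∀ K : ℕ, x - y ∈ F.fil (j + K)) : x = y := by
  rw [← sub_eq_zero]
  refine F.separated _ fun i => F.mem_of_le (j := j + (i - j).toNat) ?_ (h _)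
  omega

variable {F}

lemma IsSum.unique {j j' : ℤ} {f : ℕ → M} {x x' : M} (h : F.IsSum j f x) (h' : F.IsSum j' f x') :
    x = x' := by
  refine F.eq_of_sub_mem (min j j') fun K => ?_
  have h1 := F.mem_of_le (i := min j j' + K) (by omega) (h.2 K)
  have h2 := F.mem_of_le (i := min j j' + K) (by omega) (h'.2 K)
  simpa using sub_mem h1 h2

lemma IsSum.mem {j : ℤ} {f : ℕ → M} {x : M} (h : F.IsSum j f x) : x ∈ F.fil j := by
  simpa using h.2 0

/-- The Cauchy product: in the square of partial sums, the terms outside the triangle `p + q < K`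
already lie in `fil (i + j + K)`. -/
lemma IsSum.lie {i j : ℤ} {f g : ℕ → M} {x y : M} (hf : F.IsSum i f x) (hg : F.IsSum j g y) :
    F.IsSum (i + j)
      (fun n => ∑ p ∈ Finset.HasAntidiagonal.antidiagonal n, ⁅f p.1, g p.2⁆) ⁅x, y⁆ := by
  have hmem : ∀ p q : ℕ, ⁅f p, g q⁆ ∈ F.fil (i + j + (p + q : ℕ)) := fun p q =>
    F.mem_of_le (by push_cast; omega) (F.lie_mem (hf.1 p) (hg.1 q))
  refine ⟨fun n => sum_mem fun p hp => ?_, fun K => ?_⟩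
  · rw [← Finset.HasAntidiagonal.mem_antidiagonal.1 hp]
    exact hmem _ _
  · set sx := ∑ k ∈ Finset.range K, f k with hsx
    set sy := ∑ k ∈ Finset.range K, g k with hsy
    have h1 : ∑ n ∈ Finset.range K, ∑ p ∈ Finset.HasAntidiagonal.antidiagonal n, ⁅f p.1, g p.2⁆ =
        ∑ p ∈ Finset.range K, ∑ q ∈ Finset.range (K - p), ⁅f p, g q⁆ := by
      rw [← Finset.sum_range_diag_flip]
      refine Finset.sum_congr rfl fun n _ => ?_
      exact Finset.Nat.sum_antidiagonal_eq_sum_range_succ (fun p q => ⁅f p, g q⁆) n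
    have h2 : ⁅sx, sy⁆ = ∑ p ∈ Finset.range K, ∑ q ∈ Finset.range K, ⁅f p, g q⁆ := by
      rw [hsx, hsy, sum_lie]
      exact Finset.sum_congr rfl fun p _ => lie_sum _ _ _
    have h3 : ⁅x, y⁆ = ⁅x - sx, y⁆ + ⁅sx, y - sy⁆ + ⁅sx, sy⁆ := by
      rw [sub_lie, lie_sub]; abel
    rw [h3, add_sub_assoc]
    have hsxm : sx ∈ F.fil i := sum_mem fun k _ => F.mem_of_le (by omega) (hf.1 k)
    refine add_mem (add_mem ?_ ?_) ?_
    · exact F.mem_of_le (by omega) (F.lie_mem (hf.2 K) hg.mem)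
    · exact F.mem_of_le (by omega) (F.lie_mem hsxm (hg.2 K))
    · rw [h1, h2, ← Finset.sum_sub_distrib]
      refine sum_mem fun p _ => ?_
      rw [← Finset.sum_Ico_eq_sub _ (Nat.sub_le K p)]
      refine sum_mem fun q hq => F.mem_of_le ?_ (hmem p q)
      have := (Finset.mem_Ico.1 hq).1
      omega

variable (F)

lemma pow_mem {U : M} (hU : U ∈ F.fil 1) {j : ℤ} {x : M} (hx : x ∈ F.fil j) (k : ℕ) :
    ((LieAlgebra.ad ℂ M U) ^ k) x ∈ F.fil (j + k) := by
  induction k with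
  | zero => simpa using hx
  | succ k ih =>
    rw [pow_succ', Module.End.mul_apply, LieAlgebra.ad_apply]
    exact F.mem_of_le (by push_cast; omega) (F.lie_mem hU ih)

lemma expTerm_mem {U : M} (hU : U ∈ F.fil 1) {j : ℤ} {x : M} (hx : x ∈ F.fil j) (k : ℕ) :
    expTerm U k x ∈ F.fil (j + k) :=
  Submodule.smul_mem _ _ (F.pow_mem hU hx k)

lemma exists_exp {U : M} (hU : U ∈ F.fil 1) (x : M) :
    ∃ y, ∃ j, F.IsSum j (fun k => expTerm U k x) y := by
  obtain ⟨j, hj⟩ := F.exhaust x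
  obtain ⟨y, hy⟩ := F.complete j _ (F.expTerm_mem hU hj)
  exact ⟨y, j, F.expTerm_mem hU hj, hy⟩

/-- The exponential `e^{ad U} x`, for `U ∈ fil 1`. -/
def exp (U x : M) : M := Classical.epsilon fun y => ∃ j, F.IsSum j (fun k => expTerm U k x) y

variable {F}

lemma isSum_exp {U : M} (hU : U ∈ F.fil 1) {j : ℤ} {x : M} (hx : x ∈ F.fil j) :
    F.IsSum j (fun k => expTerm U k x) (F.exp U x) := by
  obtain ⟨j', h⟩ := Classical.epsilon_spec (F.exists_exp hU x)
  obtain ⟨y, hy⟩ := F.complete j _ (F.expTerm_mem hU hx)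
  have h2 : F.IsSum j (fun k => expTerm U k x) y := ⟨F.expTerm_mem hU hx, hy⟩
  have h3 : F.exp U x = y := h.unique h2
  rwa [h3]

lemma exp_mem {U : M} (hU : U ∈ F.fil 1) {j : ℤ} {x : M} (hx : x ∈ F.fil j) :
    F.exp U x ∈ F.fil j := (isSum_exp hU hx).mem

lemma exp_add {U : M} (hU : U ∈ F.fil 1) (x y : M) : F.exp U (x + y) = F.exp U x + F.exp U y := by
  obtain ⟨i, hi⟩ := F.exhaust x
  obtain ⟨j, hj⟩ := F.exhaust y
  have hx := F.mem_of_le (min_le_left i j) hi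
  have hy := F.mem_of_le (min_le_right i j) hj
  refine (isSum_exp hU (add_mem hx hy)).unique (j' := min i j)
    ⟨F.expTerm_mem hU (add_mem hx hy), fun K => ?_⟩
  have := add_mem ((isSum_exp hU hx).2 K) ((isSum_exp hU hy).2 K)
  simp only [map_add, Finset.sum_add_distrib]
  convert this using 1
  abel

lemma exp_zero {U : M} (hU : U ∈ F.fil 1) : F.exp U 0 = 0 := by
  simpa using F.exp_add hU 0 0

lemma exp_sub {U : M} (hU : U ∈ F.fil 1) (x y : M) : F.exp U (x - y) = F.exp U x - F.exp U y := by
  have := exp_add hU (x - y) y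
  rw [sub_add_cancel] at this
  rw [this, add_sub_cancel_right]

lemma exp_neg {U : M} (hU : U ∈ F.fil 1) (x : M) : F.exp U (-x) = -F.exp U x := by
  have := exp_sub hU 0 x
  rwa [zero_sub, exp_zero hU, zero_sub] at this

lemma exp_sum {U : M} (hU : U ∈ F.fil 1) (f : ℕ → M) (s : Finset ℕ) :
    F.exp U (∑ k ∈ s, f k) = ∑ k ∈ s, F.exp U (f k) := by
  classical
  induction s using Finset.induction_on with
  | empty => simp [exp_zero hU]
  | insert a s ha ih => rw [Finset.sum_insert ha, Finset.sum_insert ha, exp_add hU, ih]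

lemma exp_lie {U : M} (hU : U ∈ F.fil 1) (x y : M) :
    F.exp U ⁅x, y⁆ = ⁅F.exp U x, F.exp U y⁆ := by
  obtain ⟨i, hi⟩ := F.exhaust x
  obtain ⟨j, hj⟩ := F.exhaust y
  refine (isSum_exp hU (F.lie_mem hi hj)).unique (j' := i + j) ?_
  simp only [expTerm_lie]
  exact (isSum_exp hU hi).lie (isSum_exp hU hj)

/-- Modulo `fil (j + K)` the composition is a finite double sum over `p + q < K`, whose
positive-order parts vanish by `sum_expTerm_neg`. -/
lemma exp_neg_exp {U : M} (hU : U ∈ F.fil 1) (x : M) : F.exp (-U) (F.exp U x) = x := by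
  have hU' : -U ∈ F.fil 1 := neg_mem hU
  obtain ⟨j, hj⟩ := F.exhaust x
  refine F.eq_of_sub_mem j fun K => ?_
  rcases Nat.eq_zero_or_pos K with rfl | hK
  · simpa using sub_mem (exp_mem hU' (exp_mem hU hj)) hj
  have h1 : F.exp (-U) (F.exp U x) - ∑ q ∈ Finset.range K, F.exp (-U) (expTerm U q x) ∈
      F.fil (j + K) := by
    rw [← exp_sum hU', ← exp_sub hU']
    exact exp_mem hU' ((isSum_exp hU hj).2 K)
  have h2 : ∑ q ∈ Finset.range K, F.exp (-U) (expTerm U q x) -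
      ∑ q ∈ Finset.range K, ∑ p ∈ Finset.range (K - q), expTerm (-U) p (expTerm U q x) ∈
      F.fil (j + K) := by
    rw [← Finset.sum_sub_distrib]
    refine sum_mem fun q hq => F.mem_of_le ?_
      ((isSum_exp hU' (F.expTerm_mem hU hj q)).2 (K - q))
    have := Finset.mem_range.1 hq
    omega
  have h3 : ∑ q ∈ Finset.range K, ∑ p ∈ Finset.range (K - q), expTerm (-U) p (expTerm U q x) =
      x := by
    rw [← Finset.sum_range_diag_flip K (fun q p => expTerm (-U) p (expTerm U q x))]
    obtain ⟨K, rfl⟩ := Nat.exists_eq_succ_of_ne_zero hK.ne'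
    rw [Finset.sum_range_succ']
    simp only [zero_add, Finset.range_one, Finset.sum_singleton, Nat.sub_self, expTerm_zero]
    rw [Finset.sum_eq_zero, zero_add]
    intro n _
    exact sum_expTerm_neg U (n + 1) (by omega) x
  have := add_mem h1 h2
  rwa [h3, sub_add_sub_cancel] at this

lemma exp_exp_neg {U : M} (hU : U ∈ F.fil 1) (x : M) : F.exp U (F.exp (-U) x) = x := by
  have := exp_neg_exp (neg_mem hU) x
  rwa [neg_neg] at this

/-- The variation of the exponential in `U`. -/
lemma exp_add_sub_mem {U V : M} (hU : U ∈ F.fil 1) {k : ℕ} (hV : V ∈ F.fil (k + 1)) {j : ℤ} {x : M}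
    (hx : x ∈ F.fil j) : F.exp (U + V) x - F.exp U x - ⁅V, x⁆ ∈ F.fil (j + k + 2) := by
  have hUV : U + V ∈ F.fil 1 := add_mem hU (F.mem_of_le (by omega) hV)
  have hpow : ∀ n : ℕ, ((LieAlgebra.ad ℂ M (U + V)) ^ n) x - ((LieAlgebra.ad ℂ M U) ^ n) x ∈
      F.fil (j + k + n) := by
    intro n
    induction n with
    | zero => simp
    | succ n ih =>
      simp only [pow_succ', Module.End.mul_apply, LieAlgebra.ad_apply]
      have : ⁅U + V, ((LieAlgebra.ad ℂ M (U + V)) ^ n) x⁆ - ⁅U, ((LieAlgebra.ad ℂ M U) ^ n) x⁆ =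
          ⁅U + V, ((LieAlgebra.ad ℂ M (U + V)) ^ n) x - ((LieAlgebra.ad ℂ M U) ^ n) x⁆ +
          ⁅V, ((LieAlgebra.ad ℂ M U) ^ n) x⁆ := by
        rw [lie_sub, add_lie U V ((LieAlgebra.ad ℂ M U ^ n) x)]; abel
      rw [this]
      refine add_mem (F.mem_of_le ?_ (F.lie_mem hUV ih))
        (F.mem_of_le ?_ (F.lie_mem hV (F.pow_mem hU hx n))) <;> push_cast <;> omega
  have h1 := sub_mem ((isSum_exp hUV hx).2 (k + 2)) ((isSum_exp hU hx).2 (k + 2))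
  have h2 : ∑ n ∈ Finset.range (k + 2), (expTerm (U + V) n x - expTerm U n x) - ⁅V, x⁆ ∈
      F.fil (j + k + 2) := by
    rw [Finset.sum_range_succ', Finset.sum_range_succ']
    simp only [zero_add, expTerm_zero, expTerm_one, sub_self, add_zero, add_lie,
      add_sub_cancel_left, add_sub_cancel_right]
    refine sum_mem fun n _ => ?_
    rw [expTerm, expTerm, LinearMap.smul_apply, LinearMap.smul_apply, ← smul_sub]
    exact Submodule.smul_mem _ _ (F.mem_of_le (by push_cast; omega) (hpow (n + 1 + 1)))
  have h3 := add_mem (F.mem_of_le (i := j + k + 2) (by push_cast; omega) h1) h2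
  rw [Finset.sum_sub_distrib] at h3
  convert h3 using 1
  abel

lemma exp_add_sub_mem' {U V : M} (hU : U ∈ F.fil 1) {k : ℕ} (hV : V ∈ F.fil (k + 1)) {j : ℤ} {x : M}
    (hx : x ∈ F.fil j) : F.exp (U + V) x - F.exp U x ∈ F.fil (j + k + 1) := by
  have h1 := F.mem_of_le (i := j + k + 1) (by omega) (exp_add_sub_mem hU hV hx)
  have h2 := F.mem_of_le (i := j + k + 1) (by omega) (F.lie_mem hV hx)
  simpa using add_mem h1 h2

/-- The commutator of a derivation with `e^{ad U}`. -/
lemma exists_derivation_exp {U : M} (hU : U ∈ F.fil 1) (D : M →ₗ[ℂ] M)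
    (hD : ∀ x y, D ⁅x, y⁆ = ⁅D x, y⁆ + ⁅x, D y⁆) (hDF : ∀ i, ∀ x ∈ F.fil i, D x ∈ F.fil i) :
    ∃ Y ∈ F.fil 1, ∀ x, D (F.exp U x) = F.exp U (D x) + ⁅Y, F.exp U x⁆ := by
  -- `Y` is the sum of these terms. `derivation_expTerm` matches the partial sums of the two sides.
  set y : ℕ → M := fun p => ((p : ℂ) + 1)⁻¹ • expTerm U p (D U) with hy
  have hym : ∀ p : ℕ, y p ∈ F.fil (1 + p) := fun p =>
    Submodule.smul_mem _ _ (F.expTerm_mem hU (hDF _ _ hU) p)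
  obtain ⟨Y, hY⟩ := F.complete 1 y hym
  have hYs : F.IsSum 1 y Y := ⟨hym, hY⟩
  refine ⟨Y, hYs.mem, fun x => ?_⟩
  obtain ⟨j, hj⟩ := F.exhaust x
  have h1 := isSum_exp hU hj
  have h2 := isSum_exp hU (hDF _ _ hj)
  have h3 := hYs.lie h1
  refine F.eq_of_sub_mem j fun K => ?_
  have h4 := hDF _ _ (h1.2 (K + 1))
  have h5 := h2.2 (K + 1)
  have h6 := h3.2 K
  rw [map_sub, map_sum, Finset.sum_range_succ'] at h4
  simp only [derivation_expTerm D hD] at h4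
  rw [Finset.sum_range_succ'] at h5
  rw [Finset.sum_add_distrib] at h4
  have h7 := sub_mem (F.mem_of_le (i := j + K) (by push_cast; omega) h4)
    (add_mem (F.mem_of_le (i := j + K) (by push_cast; omega) h5)
    (F.mem_of_le (i := j + K) (by omega) h6))
  simp only [expTerm_zero] at h7
  convert h7 using 1
  abel

/-- Successive approximation of a dressing transformation. -/
lemma exists_dressing {Λ W : M} (hΛ : Λ ∈ F.fil (-1)) (hW : W - Λ ∈ F.fil 0)
    (K I : ℕ → Submodule ℂ M) (hK : ∀ k : ℕ, K k ≤ F.fil k) (hI : ∀ k : ℕ, I k ≤ F.fil (k + 1))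
    (hdec : ∀ (k : ℕ), ∀ z ∈ F.fil k, ∃ κ ∈ K k, ∃ y ∈ I k, z - κ - ⁅Λ, y⁆ ∈ F.fil (k + 1)) :
    ∃ U H : M, ∃ f g : ℕ → M, (∀ k, f k ∈ I k) ∧ F.IsSum 1 f U ∧ (∀ k, g k ∈ K k) ∧ F.IsSum 0 g H ∧
      F.exp (-U) W = Λ + H := by
  have hW1 : W ∈ F.fil (-1) := by
    simpa using add_mem (F.mem_of_le (by omega : (-1 : ℤ) ≤ 0) hW) hΛ
  let P (m : ℕ) := {s : M × M // s.1 ∈ F.fil 1 ∧ F.exp (-s.1) W - Λ - s.2 ∈ F.fil m}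
  have hstep : ∀ (m : ℕ) (s : P m), ∃ s' : P (m + 1),
      s'.1.1 - s.1.1 ∈ I m ∧ s'.1.2 - s.1.2 ∈ K m := by
    rintro m ⟨⟨U, H⟩, hU, hz⟩
    obtain ⟨κ, hκ, y, hy, hr⟩ := hdec m _ hz
    have hy' := hI m hy
    -- Replacing `U` by `U - y` changes `e^{-ad U} W` by `[y, W]`, hence by `-[Λ, y]`, modulo `fil
    -- (m + 1)`. With `κ` moved into `H`, this cancels the error of order `m`.
    refine ⟨⟨⟨U + -y, H + κ⟩, add_mem hU (neg_mem (F.mem_of_le (by omega) hy')), ?_⟩, ?_, ?_⟩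
    · have h1 := exp_add_sub_mem (neg_mem hU) hy' hW1
      have h2 : ⁅y, W - Λ⁆ ∈ F.fil (m + 1) := by
        simpa using F.lie_mem hy' hW
      have h3 := add_mem (add_mem (F.mem_of_le (i := ((m + 1 : ℕ) : ℤ)) (by push_cast; omega) h1)
        (F.mem_of_le (i := ((m + 1 : ℕ) : ℤ)) (by push_cast; omega) h2))
        (F.mem_of_le (i := ((m + 1 : ℕ) : ℤ)) (by push_cast; omega) hr)
      have h4 : -(U + -y) = -U + y := by abel
      simp only [h4]
      convert h3 using 1
      rw [lie_sub, ← lie_skew Λ y]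
      abel
    · simpa using neg_mem hy
    · simpa using hκ
  choose step hs1 hs2 using hstep
  let s0 : P 0 := ⟨(0, 0), zero_mem _, by
    have h0 : (-(0 : M)) ∈ F.fil 1 := by simp
    have h1 := (isSum_exp h0 hW1).2 1
    simp only [neg_zero, Finset.range_one, Finset.sum_singleton, expTerm_zero] at h1
    have h2 := add_mem (F.mem_of_le (i := 0) (by simp) h1) hW
    simpa using h2⟩
  let s : (m : ℕ) → P m := fun m => Nat.rec s0 step m
  have hs : ∀ m, s (m + 1) = step m (s m) := fun m => rfl
  set f : ℕ → M := fun m => (s (m + 1)).1.1 - (s m).1.1 with hf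
  set g : ℕ → M := fun m => (s (m + 1)).1.2 - (s m).1.2 with hg
  have hfI : ∀ k, f k ∈ I k := fun k => hs1 k (s k)
  have hgK : ∀ k, g k ∈ K k := fun k => hs2 k (s k)
  have hfm : ∀ k : ℕ, f k ∈ F.fil (1 + k) := fun k => by rw [add_comm]; exact hI k (hfI k)
  have hgm : ∀ k : ℕ, g k ∈ F.fil (0 + k) := fun k => by rw [zero_add]; exact hK k (hgK k)
  obtain ⟨U, hU⟩ := F.complete 1 f hfm
  obtain ⟨H, hH⟩ := F.complete 0 g hgm
  have hUs : F.IsSum 1 f U := ⟨hfm, hU⟩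
  have hHs : F.IsSum 0 g H := ⟨hgm, hH⟩
  refine ⟨U, H, f, g, hfI, hUs, hgK, hHs, F.eq_of_sub_mem 0 fun m => ?_⟩
  have hsumf : ∑ k ∈ Finset.range m, f k = (s m).1.1 := by
    rw [hf, Finset.sum_range_sub (fun m => (s m).1.1)]
    exact sub_zero _
  have hsumg : ∑ k ∈ Finset.range m, g k = (s m).1.2 := by
    rw [hg, Finset.sum_range_sub (fun m => (s m).1.2)]
    exact sub_zero _
  have h1 := hU m
  have h2 := hH m
  rw [hsumf] at h1
  rw [hsumg] at h2
  -- The tail `U - (s m).1.1` lies in `fil (m + 1)`, so the limit inherits the approximate equation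
  -- at every order.
  have h3 := exp_add_sub_mem' (neg_mem (s m).2.1) (k := m) (V := -(U - (s m).1.1))
    (neg_mem (by rwa [add_comm])) hW1
  have h4 : -(s m).1.1 + -(U - (s m).1.1) = -U := by abel
  rw [h4] at h3
  have h5 := (s m).2.2
  have h6 := sub_mem (add_mem (F.mem_of_le (i := 0 + (m : ℤ)) (by omega) h3)
    (F.mem_of_le (i := 0 + (m : ℤ)) (by omega) h5)) h2
  convert h6 using 1
  abel

/-- If `[Λ, [Z, Λ + H]] = 0` then `[Λ, Z] = 0`, when `ad Λ` has a partial inverse which raises the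
filtration. -/
lemma lie_eq_zero_of_lie_lie {Λ H Z : M} (hH : H ∈ F.fil 0) (hΛH : ⁅Λ, H⁆ = 0)
    (P Q : M → M) (hPQ : ∀ x, x = P x + Q ⁅Λ, x⁆) (hP : ∀ x, P ⁅Λ, x⁆ = 0)
    (hQ : ∀ i, ∀ x ∈ F.fil i, Q x ∈ F.fil (i + 1)) (hZ : ⁅Λ, ⁅Z, Λ + H⁆⁆ = 0) : ⁅Λ, Z⁆ = 0 := by
  -- By the Jacobi identity and `[Λ, H] = 0`. Then `V = [Λ, Z]` satisfies `V = Q [V, H]`; `Q` raises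
  -- the filtration and `ad H` does not lower it, so `V` lies in every `fil`.
  have h1 : ⁅Λ, ⁅Λ, Z⁆⁆ = ⁅⁅Λ, Z⁆, H⁆ := by
    rw [leibniz_lie, lie_add, lie_add, hΛH, lie_self, add_zero, lie_zero, add_zero,
      ← lie_skew _ Λ, neg_add_eq_zero] at hZ
    exact hZ
  have h2 : ⁅Λ, Z⁆ = Q ⁅⁅Λ, Z⁆, H⁆ := by
    have := hPQ ⁅Λ, Z⁆
    rwa [hP, zero_add, h1] at this
  obtain ⟨j, hj⟩ := F.exhaust ⁅Λ, Z⁆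
  have h3 : ∀ m : ℕ, ⁅Λ, Z⁆ ∈ F.fil (j + m) := by
    intro m
    induction m with
    | zero => simpa using hj
    | succ m ih =>
      rw [h2]
      exact F.mem_of_le (by push_cast; omega) (hQ _ _ (F.lie_mem ih hH))
  exact F.eq_of_sub_mem j fun m => by simpa using h3 m

end LieFiltration

end

/-! ### Laurent series in `λ⁻¹` and operators acting on their coefficients. -/

section

namespace Series

variable {A : Type*} [CommRing A] [Algebra ℂ A]

@[ext] lemma ext {s t : Series A} (h : ∀ i, coeff ℂ i s = coeff ℂ i t) : s = t :=
  HahnSeries.ext (funext h)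

/-- Every Laurent series in `λ⁻¹` has only finitely many positive powers of `λ`. -/
lemma exists_bound (s : Series A) : ∃ a : ℤ, ∀ i < a, coeff ℂ i s = 0 :=
  ⟨HahnSeries.order (s : HahnSeries ℤ A), fun _ hi => HahnSeries.coeff_eq_zero_of_lt_order hi⟩

/-- Turns the sum over the supports into one over an explicit interval, where different series can
be compared term by term. -/
lemma coeff_mul {s t : Series A} {a b : ℤ} (hs : ∀ i < a, coeff ℂ i s = 0)
    (ht : ∀ i < b, coeff ℂ i t = 0) (i : ℤ) :
    coeff ℂ i (s * t) = ∑ p ∈ Finset.Icc a (i - b), coeff ℂ p s * coeff ℂ (i - p) t := by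
  have h : coeff ℂ i (s * t) = ∑ ij ∈ Finset.antidiagonal
      (HahnSeries.isPWO_support (s : HahnSeries ℤ A)) (HahnSeries.isPWO_support (t : HahnSeries ℤ A))
      i, coeff ℂ ij.1 s * coeff ℂ ij.2 t := HahnSeries.coeff_mul
  rw [h]
  refine Finset.sum_of_injOn Prod.fst ?_ ?_ ?_ ?_
  · rintro ⟨p, q⟩ hp ⟨p', q'⟩ hp' hpp
    have h1 := (Finset.mem_antidiagonal.1 hp).2.2
    have h2 := (Finset.mem_antidiagonal.1 hp').2.2
    simp only at hpp h1 h2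
    ext <;> simp <;> omega
  · rintro ⟨p, q⟩ hp
    obtain ⟨h1, h2, h3⟩ := Finset.mem_antidiagonal.1 hp
    have h1' : coeff ℂ p s ≠ 0 := h1
    have h2' : coeff ℂ q t ≠ 0 := h2
    simp only [Finset.coe_Icc, Set.mem_Icc] at h3 ⊢
    constructor
    · by_contra hc; exact h1' (hs p (by omega))
    · by_contra hc; exact h2' (ht q (by omega))
  · intro p _ hp
    by_contra hne
    apply hp
    refine ⟨(p, i - p), Finset.mem_coe.2 (Finset.mem_antidiagonal.2 ⟨?_, ?_, by simp⟩), rfl⟩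
    · exact left_ne_zero_of_mul hne
    · exact right_ne_zero_of_mul hne
  · rintro ⟨p, q⟩ hp
    have h3 := (Finset.mem_antidiagonal.1 hp).2.2
    simp only at h3 ⊢
    rw [← h3, add_sub_cancel_left]

lemma exists_of_coeff_mul_ne_zero {s t : Series A} {i : ℤ} (h : coeff ℂ i (s * t) ≠ 0) :
    ∃ p q, p + q = i ∧ coeff ℂ p s ≠ 0 ∧ coeff ℂ q t ≠ 0 := by
  obtain ⟨a, ha⟩ := s.exists_bound
  obtain ⟨b, hb⟩ := t.exists_bound
  rw [coeff_mul ha hb] at h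
  obtain ⟨p, _, hp⟩ := Finset.exists_ne_zero_of_sum_ne_zero h
  exact ⟨p, i - p, by ring, left_ne_zero_of_mul hp, right_ne_zero_of_mul hp⟩

lemma coeff_lam (p i : ℤ) : coeff ℂ i (lam A p) = if i = -p then 1 else 0 := by
  change HahnSeries.coeff (HahnSeries.single (-p) (1 : A)) i = _
  rw [HahnSeries.coeff_single]
  split_ifs <;> rfl

lemma coeff_lam_mul (p i : ℤ) (s : Series A) : coeff ℂ i (lam A p * s) = coeff ℂ (i + p) s := by
  have : coeff ℂ i (lam A p * s) = 1 * coeff ℂ (i - -p) s := HahnSeries.coeff_single_mul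
  rw [this, one_mul, sub_neg_eq_add]

lemma lam_mul_lam (p q : ℤ) : lam A p * lam A q = lam A (p + q) := by
  ext i
  rw [coeff_lam_mul, coeff_lam, coeff_lam]
  congr 1
  rw [eq_iff_iff]; omega

@[simp] lemma lam_zero : lam A 0 = 1 := rfl

lemma coeff_one (i : ℤ) : coeff ℂ i (1 : Series A) = if i = 0 then 1 else 0 := by
  rw [← lam_zero, coeff_lam, neg_zero]

lemma coeff_C (a : A) (i : ℤ) : coeff ℂ i (C A a) = if i = 0 then a else 0 := by
  change HahnSeries.coeff (HahnSeries.single (0 : ℤ) a) i = _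
  rw [HahnSeries.coeff_single]
  split_ifs <;> rfl

lemma coeff_C_mul (a : A) (i : ℤ) (s : Series A) : coeff ℂ i (C A a * s) = a * coeff ℂ i s :=
  HahnSeries.coeff_single_zero_mul

lemma coeff_constSeries (i : ℤ) (s : Series ℂ) :
    coeff ℂ i (constSeries A s) = algebraMap ℂ A (coeff ℂ i s) := rfl

lemma constSeries_lam (p : ℤ) : constSeries A (lam ℂ p) = lam A p := by
  ext i
  rw [coeff_constSeries, coeff_lam, coeff_lam]
  split_ifs <;> simp

/-- The series with prescribed coefficients. -/
def mk (f : ℤ → A) (hf : ∃ a : ℤ, ∀ i < a, f i = 0) : Series A :=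
  HahnSeries.ofSuppBddBelow f <| by
    obtain ⟨a, ha⟩ := hf
    exact ⟨a, fun i hi => by by_contra h; exact hi (ha i (by omega))⟩

@[simp] lemma coeff_mk (f : ℤ → A) (hf) (i : ℤ) : coeff ℂ i (mk f hf) = f i := rfl

lemma coeff_ofCoeffs (f : ℕ → A) (i : ℤ) :
    coeff ℂ i (ofCoeffs f) = if 0 ≤ i then f i.toNat else 0 := by
  split_ifs with hi
  · lift i to ℕ using hi
    have : coeff ℂ i (ofCoeffs f) = PowerSeries.coeff i (PowerSeries.mk f) :=
      HahnSeries.ofPowerSeries_apply_coeff _ i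
    rw [this, PowerSeries.coeff_mk, Int.toNat_natCast]
  · change HahnSeries.coeff (HahnSeries.ofPowerSeries ℤ A (PowerSeries.mk f)) i = 0
    rw [HahnSeries.ofPowerSeries_apply]
    apply HahnSeries.embDomain_of_notMem_range
    rintro ⟨m, rfl⟩
    simp at hi

/-- A family of operators on the coefficients acting on series. -/
def mapCoeff (δ : ℤ → A →ₗ[ℂ] A) : Series A →ₗ[ℂ] Series A where
  toFun s := mk (fun i => δ i (coeff ℂ i s)) <| by
    obtain ⟨a, ha⟩ := s.exists_bound
    exact ⟨a, fun i hi => by rw [ha i hi, map_zero]⟩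
  map_add' s t := by ext i; simp
  map_smul' c s := by ext i; simp

@[simp] lemma coeff_mapCoeff (δ : ℤ → A →ₗ[ℂ] A) (s : Series A) (i : ℤ) :
    coeff ℂ i (mapCoeff δ s) = δ i (coeff ℂ i s) := rfl

/-- The condition on `δ` covers both a derivation applied to all coefficients (constant family) and
the Euler operator `λ d/dλ` (`δ i = -i`). -/
lemma mapCoeff_mul (δ : ℤ → A →ₗ[ℂ] A)
    (hδ : ∀ i j x y, δ (i + j) (x * y) = δ i x * y + x * δ j y) (s t : Series A) :
    mapCoeff δ (s * t) = mapCoeff δ s * t + s * mapCoeff δ t := by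
  obtain ⟨a, ha⟩ := s.exists_bound
  obtain ⟨b, hb⟩ := t.exists_bound
  have ha' : ∀ i < a, coeff ℂ i (mapCoeff δ s) = 0 := fun i hi => by simp [ha i hi]
  have hb' : ∀ i < b, coeff ℂ i (mapCoeff δ t) = 0 := fun i hi => by simp [hb i hi]
  ext i
  rw [map_add, coeff_mapCoeff, coeff_mul ha hb, coeff_mul ha' hb, coeff_mul ha hb', map_sum,
    ← Finset.sum_add_distrib]
  refine Finset.sum_congr rfl fun p _ => ?_
  have := hδ p (i - p) (coeff ℂ p s) (coeff ℂ (i - p) t)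
  rw [add_sub_cancel] at this
  simpa using this

end Series

/-! ### Invariant forms and derivations on the loop algebra. -/

section LoopBasic

variable {A L : Type*} [CommRing A] [Algebra ℂ A] [LieRing L] [LieAlgebra ℂ L]

/-- A bilinear form extended to the loop algebra. -/
abbrev loopForm (A : Type*) [CommRing A] [Algebra ℂ A] (β : LinearMap.BilinForm ℂ L) :
    LinearMap.BilinForm (Series A) (Loop A L) := β.baseChange (Series A)

lemma loopForm_tmul (β : LinearMap.BilinForm ℂ L) (s t : Series A) (v w : L) :
    loopForm A β (s ⊗ₜ v) (t ⊗ₜ w) = β v w • (s * t) :=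
  LinearMap.BilinForm.baseChange_tmul β s v t w

lemma baseChange_comm {R : Type*} [CommRing R] [Algebra ℂ R] {β : LinearMap.BilinForm ℂ L}
    (hβ : ∀ v w, β v w = β w v) (x y : R ⊗[ℂ] L) :
    β.baseChange R x y = β.baseChange R y x := by
  induction x using TensorProduct.induction_on with
  | zero => simp
  | add a b ha hb => simp only [map_add, LinearMap.add_apply, ha, hb]
  | tmul s v =>
    induction y using TensorProduct.induction_on with
    | zero => simp
    | add a b ha hb => simp only [map_add, LinearMap.add_apply, ha, hb]
    | tmul t w =>
      rw [LinearMap.BilinForm.baseChange_tmul, LinearMap.BilinForm.baseChange_tmul, hβ, mul_comm]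

lemma baseChange_lie {R : Type*} [CommRing R] [Algebra ℂ R] {β : LinearMap.BilinForm ℂ L}
    (hβ : ∀ u v w, β ⁅u, v⁆ w = β u ⁅v, w⁆) (x y z : R ⊗[ℂ] L) :
    β.baseChange R ⁅x, y⁆ z = β.baseChange R x ⁅y, z⁆ := by
  induction x using TensorProduct.induction_on with
  | zero => simp
  | add a b ha hb => simp only [add_lie, map_add, LinearMap.add_apply, ha, hb]
  | tmul s v =>
    induction y using TensorProduct.induction_on with
    | zero => simp
    | add a b ha hb => simp only [lie_add, add_lie, map_add, LinearMap.add_apply, ha, hb]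
    | tmul t w =>
      induction z using TensorProduct.induction_on with
      | zero => simp
      | add a b ha hb => simp only [lie_add, map_add, ha, hb]
      | tmul r u =>
        rw [LieAlgebra.ExtendScalars.bracket_tmul, LieAlgebra.ExtendScalars.bracket_tmul,
          LinearMap.BilinForm.baseChange_tmul, LinearMap.BilinForm.baseChange_tmul, hβ, mul_assoc]

lemma loopForm_comm {β : LinearMap.BilinForm ℂ L} (hβ : ∀ v w, β v w = β w v) (x y : Loop A L) :
    loopForm A β x y = loopForm A β y x := baseChange_comm hβ x y

lemma loopForm_lie {β : LinearMap.BilinForm ℂ L} (hβ : ∀ u v w, β ⁅u, v⁆ w = β u ⁅v, w⁆)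
    (x y z : Loop A L) : loopForm A β ⁅x, y⁆ z = loopForm A β x ⁅y, z⁆ := baseChange_lie hβ x y z

/-- A derivation of the coefficients acting on the loop algebra. -/
def loopMap (δ : Series A →ₗ[ℂ] Series A) : Loop A L →ₗ[ℂ] Loop A L := LinearMap.rTensor L δ

@[simp] lemma loopMap_tmul (δ : Series A →ₗ[ℂ] Series A) (s : Series A) (v : L) :
    loopMap δ (s ⊗ₜ[ℂ] v) = δ s ⊗ₜ v := rfl

lemma loopMap_lie {δ : Series A →ₗ[ℂ] Series A} (hδ : ∀ s t, δ (s * t) = δ s * t + s * δ t)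
    (x y : Loop A L) : loopMap δ ⁅x, y⁆ = ⁅loopMap δ x, y⁆ + ⁅x, loopMap δ y⁆ := by
  induction x using TensorProduct.induction_on with
  | zero => simp
  | add a b ha hb => simp only [map_add, add_lie, ha, hb]; abel
  | tmul s v =>
    induction y using TensorProduct.induction_on with
    | zero => simp
    | add a b ha hb => simp only [map_add, lie_add, ha, hb]; abel
    | tmul t w =>
      simp only [LieAlgebra.ExtendScalars.bracket_tmul, loopMap_tmul, hδ, TensorProduct.add_tmul]

lemma loopMap_form {δ : Series A →ₗ[ℂ] Series A} (hδ : ∀ s t, δ (s * t) = δ s * t + s * δ t)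
    (β : LinearMap.BilinForm ℂ L) (x y : Loop A L) :
    δ (loopForm A β x y) = loopForm A β (loopMap δ x) y + loopForm A β x (loopMap δ y) := by
  induction x using TensorProduct.induction_on with
  | zero => simp
  | add a b ha hb => simp only [map_add, LinearMap.add_apply, ha, hb]; abel
  | tmul s v =>
    induction y using TensorProduct.induction_on with
    | zero => simp
    | add a b ha hb => simp only [map_add, ha, hb]; abel
    | tmul t w =>
      simp only [loopForm_tmul, loopMap_tmul, map_smul, hδ, smul_add]

lemma lie_smul_loop (s : Series A) (x y : Loop A L) : ⁅x, s • y⁆ = s • ⁅x, y⁆ := lie_smul s x y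

lemma smul_lie_loop (s : Series A) (x y : Loop A L) : ⁅s • x, y⁆ = s • ⁅x, y⁆ := smul_lie s x y

lemma constLoop_tmul (s : Series ℂ) (v : L) :
    constLoop A (s ⊗ₜ[ℂ] v) = constSeries A s ⊗ₜ v := rfl

lemma constSeries_mul (s t : Series ℂ) :
    constSeries A (s * t) = constSeries A s * constSeries A t :=
  HahnSeries.map_mul ((algebraMap ℂ A : ℂ →+* A) : ℂ →ₙ+* A)

lemma constLoop_lie (x y : Loop ℂ L) : constLoop A ⁅x, y⁆ = ⁅constLoop A x, constLoop A y⁆ := by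
  induction x using TensorProduct.induction_on with
  | zero => simp
  | add a b ha hb => simp only [map_add, add_lie, ha, hb]
  | tmul s v =>
    induction y using TensorProduct.induction_on with
    | zero => simp
    | add a b ha hb => simp only [map_add, lie_add, ha, hb]
    | tmul t w =>
      simp only [LieAlgebra.ExtendScalars.bracket_tmul, constLoop_tmul, constSeries_mul]

lemma coeffAt_tmul (i : ℤ) (s : Series A) (v : L) :
    coeffAt i (s ⊗ₜ[ℂ] v) = Series.coeff ℂ i s ⊗ₜ v := rfl

end LoopBasic

/-! ### Coordinates on the loop algebra and its filtration. -/

namespace Setup.HomogeneousBasis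

variable {L : Type*} [LieRing L] [LieAlgebra ℂ L] [FiniteDimensional ℂ L]
  [LieAlgebra.IsSimple ℂ L] {H : LieSubalgebra ℂ L} [H.IsCartanSubalgebra] {n N : ℕ}
  {S : Setup H n} (B : S.HomogeneousBasis N) {A : Type*} [CommRing A] [Algebra ℂ A]

/-- The coordinates of an element of the loop algebra. -/
def coord (j : Fin N) : Loop A L →ₗ[Series A] Series A := (B.e.baseChange (Series A)).coord j

lemma coord_tmul (j : Fin N) (s : Series A) (v : L) :
    B.coord j (s ⊗ₜ[ℂ] v) = B.e.repr v j • s :=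
  Module.Basis.baseChange_repr_tmul (Series A) B.e s v j

lemma sum_coord (x : Loop A L) : ∑ j, B.coord j x ⊗ₜ[ℂ] B.e j = x := by
  have := (B.e.baseChange (Series A)).sum_repr x
  refine Eq.trans (Finset.sum_congr rfl fun j _ => ?_) this
  rw [Module.Basis.baseChange_apply, TensorProduct.smul_tmul', smul_eq_mul, mul_one]
  rfl

/-- The coefficient of `λ^{-i} e_j`. -/
def cf (j : Fin N) (i : ℤ) : Loop A L →ₗ[ℂ] A :=
  Series.coeff ℂ i ∘ₗ (B.coord j).restrictScalars ℂ

lemma cf_eq (j : Fin N) (i : ℤ) (x : Loop A L) : B.cf j i x = Series.coeff ℂ i (B.coord j x) := rfl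

lemma cf_tmul (j : Fin N) (i : ℤ) (s : Series A) (v : L) :
    B.cf j i (s ⊗ₜ[ℂ] v) = B.e.repr v j • Series.coeff ℂ i s := by
  rw [cf_eq, coord_tmul, map_smul]

lemma loop_ext {x y : Loop A L} (h : ∀ j i, B.cf j i x = B.cf j i y) : x = y := by
  rw [← B.sum_coord x, ← B.sum_coord y]
  refine Finset.sum_congr rfl fun j _ => ?_
  congr 1
  ext i
  exact h j i

lemma coeffAt_eq_sum (i : ℤ) (x : Loop A L) : coeffAt i x = ∑ j, B.cf j i x ⊗ₜ[ℂ] B.e j := by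
  nth_rw 1 [← B.sum_coord x]
  rw [map_sum]
  rfl

lemma cf_of_coeffAt (j : Fin N) (i : ℤ) (x : Loop A L) :
    B.cf j i x = (B.e.baseChange A).repr (coeffAt i x) j := by
  rw [B.coeffAt_eq_sum, map_sum, Finsupp.coe_finsetSum, Finset.sum_apply, Finset.sum_eq_single j]
  · rw [Module.Basis.baseChange_repr_tmul]; simp
  · intro k _ hk
    rw [Module.Basis.baseChange_repr_tmul]; simp [hk]
  · simp

lemma coeffAt_eq_iff (i : ℤ) (x y : Loop A L) :
    coeffAt i x = coeffAt i y ↔ ∀ j, B.cf j i x = B.cf j i y := by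
  constructor
  · intro h j; rw [cf_of_coeffAt, h, ← cf_of_coeffAt]
  · intro h; rw [B.coeffAt_eq_sum, B.coeffAt_eq_sum]; simp only [h]

lemma exists_of_cf_smul_ne_zero {s : Series A} {x : Loop A L} {j : Fin N} {i : ℤ}
    (h : B.cf j i (s • x) ≠ 0) :
    ∃ p q, p + q = i ∧ Series.coeff ℂ p s ≠ 0 ∧ B.cf j q x ≠ 0 := by
  rw [cf_eq, map_smul, smul_eq_mul] at h
  exact Series.exists_of_coeff_mul_ne_zero h

lemma cf_lam_smul (p : ℤ) (x : Loop A L) (j : Fin N) (i : ℤ) :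
    B.cf j i (lam A p • x) = B.cf j (i + p) x := by
  rw [cf_eq, map_smul, smul_eq_mul, Series.coeff_lam_mul, cf_eq]

lemma lie_eq_sum (x y : Loop A L) :
    ⁅x, y⁆ = ∑ p, ∑ q, (B.coord p x * B.coord q y) ⊗ₜ[ℂ] ⁅B.e p, B.e q⁆ := by
  nth_rw 1 [← B.sum_coord x, ← B.sum_coord y]
  rw [sum_lie]
  refine Finset.sum_congr rfl fun p _ => ?_
  rw [lie_sum]
  rfl

/-- Powers of `λ` and principal degrees both add under brackets. Degree and truncation estimates for
brackets pass through this form. -/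
lemma exists_of_cf_lie_ne_zero {x y : Loop A L} {j : Fin N} {i : ℤ} (h : B.cf j i ⁅x, y⁆ ≠ 0) :
    ∃ p i₁ q i₂, i₁ + i₂ = i ∧ B.d p + B.d q = B.d j ∧ B.cf p i₁ x ≠ 0 ∧ B.cf q i₂ y ≠ 0 := by
  rw [B.lie_eq_sum, map_sum] at h
  obtain ⟨p, _, hp⟩ := Finset.exists_ne_zero_of_sum_ne_zero h
  rw [map_sum] at hp
  obtain ⟨q, _, hq⟩ := Finset.exists_ne_zero_of_sum_ne_zero hp
  rw [cf_tmul] at hq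
  obtain ⟨h1, h2⟩ := smul_ne_zero_iff.1 hq
  obtain ⟨i₁, i₂, hi, hx, hy⟩ := Series.exists_of_coeff_mul_ne_zero h2
  refine ⟨p, i₁, q, i₂, hi, ?_, hx, hy⟩
  by_contra hne
  exact h1 (B.repr_eq_zero (lie_mem_principalPart (B.mem p) (B.mem q)) (Ne.symm hne))

lemma loopForm_eq_sum (x y : Loop A L) :
    loopForm A S.form x y = ∑ p, ∑ q, S.form (B.e p) (B.e q) • (B.coord p x * B.coord q y) := by
  nth_rw 1 [← B.sum_coord x, ← B.sum_coord y]
  simp only [map_sum, LinearMap.sum_apply]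
  rw [Finset.sum_comm]
  simp only [loopForm_tmul]

lemma exists_of_coeff_form_ne_zero {x y : Loop A L} {i : ℤ}
    (h : Series.coeff ℂ i (loopForm A S.form x y) ≠ 0) :
    ∃ p i₁ q i₂, i₁ + i₂ = i ∧ B.d p + B.d q = 0 ∧ B.cf p i₁ x ≠ 0 ∧ B.cf q i₂ y ≠ 0 := by
  rw [B.loopForm_eq_sum, map_sum] at h
  obtain ⟨p, _, hp⟩ := Finset.exists_ne_zero_of_sum_ne_zero h
  rw [map_sum] at hp
  obtain ⟨q, _, hq⟩ := Finset.exists_ne_zero_of_sum_ne_zero hp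
  rw [map_smul] at hq
  obtain ⟨h1, h2⟩ := smul_ne_zero_iff.1 hq
  obtain ⟨i₁, i₂, hi, hx, hy⟩ := Series.exists_of_coeff_mul_ne_zero h2
  refine ⟨p, i₁, q, i₂, hi, ?_, hx, hy⟩
  by_contra hne
  exact h1 (S.form_eq_zero_of_degree (B.mem p) (B.mem q) hne)

lemma exists_bound (x : Loop A L) : ∃ a : ℤ, ∀ j, ∀ i < a, B.cf j i x = 0 := by
  choose a ha using fun j => (B.coord j x).exists_bound
  obtain ⟨b, hb⟩ := (Set.finite_range a).bddBelow
  exact ⟨b, fun j i hi => ha j i (hi.trans_le (hb ⟨j, rfl⟩))⟩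

/-- The coefficients of the form. -/
lemma coeff_form {x y : Loop A L} {a b : ℤ} (hx : ∀ j, ∀ i < a, B.cf j i x = 0)
    (hy : ∀ j, ∀ i < b, B.cf j i y = 0) (i : ℤ) :
    Series.coeff ℂ i (loopForm A S.form x y) = ∑ p ∈ Finset.Icc a (i - b),
      S.form.baseChange A (coeffAt p x) (coeffAt (i - p) y) := by
  rw [B.loopForm_eq_sum, map_sum]
  have : ∀ p, S.form.baseChange A (coeffAt p x) (coeffAt (i - p) y) =
      ∑ k, ∑ l, S.form (B.e k) (B.e l) • (B.cf k p x * B.cf l (i - p) y) := by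
    intro p
    rw [B.coeffAt_eq_sum, B.coeffAt_eq_sum]
    simp only [map_sum, LinearMap.sum_apply]
    rw [Finset.sum_comm]
    simp only [LinearMap.BilinForm.baseChange_tmul]
  simp only [this]
  rw [Finset.sum_comm]
  refine Finset.sum_congr rfl fun k _ => ?_
  rw [Finset.sum_comm, map_sum]
  refine Finset.sum_congr rfl fun l _ => ?_
  rw [map_smul, Series.coeff_mul (s := B.coord k x) (t := B.coord l y) (hx k) (hy l), Finset.smul_sum]
  rfl

/-! ### The filtration by the total degree -/

/-- The elements of total degree at most `-k`. -/
def fil (A : Type*) [CommRing A] [Algebra ℂ A] (k : ℤ) : Submodule ℂ (Loop A L) where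
  carrier := {x | ∀ j i, B.cf j i x ≠ 0 → k ≤ S.h * i - B.d j}
  add_mem' {x y} hx hy j i h := by
    rw [map_add] at h
    by_cases hx0 : B.cf j i x = 0
    · rw [hx0, zero_add] at h; exact hy j i h
    · exact hx j i hx0
  zero_mem' j i h := by simp at h
  smul_mem' c x hx j i h := by
    rw [map_smul] at h
    exact hx j i (smul_ne_zero_iff.1 h).2

/-- The coefficient of `λ^{-i} e_p` has degree `d_p - h i`, so only finitely many `f k` contribute
to it and the sum is formed coefficientwise. -/
lemma fil_complete (j : ℤ) (f : ℕ → Loop A L) (hf : ∀ k : ℕ, f k ∈ B.fil A (j + k)) :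
    ∃ x, ∀ K : ℕ, x - ∑ k ∈ Finset.range K, f k ∈ B.fil A (j + K) := by
  set T : Fin N → ℤ → ℕ := fun p i => (S.h * i - B.d p - j + 1).toNat with hT
  have hh := h_pos S
  have hz : ∀ p i (k : ℕ), T p i ≤ k → B.cf p i (f k) = 0 := by
    intro p i k hk
    by_contra hne
    have h1 := hf k p i hne
    have h2 : S.h * i - B.d p - j + 1 ≤ (T p i : ℤ) := Int.self_le_toNat _
    omega
  have hbound : ∀ p, ∃ a : ℤ, ∀ i < a, ∑ k ∈ Finset.range (T p i), B.cf p i (f k) = 0 := by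
    intro p
    -- A contribution from `f k` requires `h i ≥ d_p + j + k ≥ -|d_p + j|`. This fails below the
    -- bound, where `h i ≤ i`.
    refine ⟨-|B.d p + j|, fun i hi => Finset.sum_eq_zero fun k hk => ?_⟩
    by_contra hne
    have h1 := hf k p i hne
    have h2 := abs_nonneg (B.d p + j)
    have h3 := neg_abs_le (B.d p + j)
    nlinarith [mul_nonneg (show (0 : ℤ) ≤ S.h - 1 by omega) (show 0 ≤ -i by omega)]
  refine ⟨∑ p, Series.mk _ (hbound p) ⊗ₜ[ℂ] B.e p, fun K p i hne => ?_⟩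
  have hcf : B.cf p i (∑ p, Series.mk _ (hbound p) ⊗ₜ[ℂ] B.e p) =
      ∑ k ∈ Finset.range (T p i), B.cf p i (f k) := by
    rw [map_sum, Finset.sum_eq_single p]
    · rw [cf_tmul]; simp
    · intro q _ hq; rw [cf_tmul]; simp [hq]
    · simp
  rw [map_sub, hcf, map_sum] at hne
  by_contra hc
  apply hne
  have hTK : T p i ≤ K := by
    simp only [hT]; omega
  rw [← Finset.sum_range_add_sum_Ico _ hTK, Finset.sum_eq_zero (s := Finset.Ico _ _), add_zero,
    sub_self]
  intro k hk
  exact hz p i k (Finset.mem_Ico.1 hk).1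

/-- The loop algebra is complete for the filtration by the total degree. -/
def filtration (A : Type*) [CommRing A] [Algebra ℂ A] : LieFiltration (Loop A L) where
  fil := B.fil A
  anti i j hij x hx p q h := hij.trans (hx p q h)
  lie_mem {i j x y} hx hy p q h := by
    obtain ⟨k, i₁, l, i₂, h1, h2, h3, h4⟩ := B.exists_of_cf_lie_ne_zero h
    have h5 := hx k i₁ h3
    have h6 := hy l i₂ h4
    rw [← h1, mul_add]
    omega
  exhaust x := by
    obtain ⟨a, ha⟩ := B.exists_bound x
    refine ⟨S.h * a - S.h, fun j i h => ?_⟩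
    have h1 : a ≤ i := by by_contra hc; exact h (ha j i (by omega))
    have h2 := B.d_lt j
    have h3 : (S.h : ℤ) * a ≤ S.h * i := mul_le_mul_of_nonneg_left h1 (by omega)
    omega
  separated x hx := by
    refine B.loop_ext fun j i => ?_
    rw [map_zero]
    by_contra h
    have := hx (S.h * i - B.d j + 1) j i h
    omega
  complete := B.fil_complete

@[simp] lemma filtration_fil (k : ℤ) : (B.filtration A).fil k = B.fil A k := rfl

lemma hasFormalSum_of_isSum {j : ℤ} {f : ℕ → Loop A L} {x : Loop A L}
    (h : (B.filtration A).IsSum j f x) : HasFormalSum f x := by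
  intro i
  filter_upwards [Filter.eventually_ge_atTop (S.h * i + S.h - j).toNat] with K hK
  rw [B.coeffAt_eq_iff]
  intro p
  by_contra hne
  have h1 := h.2 K p i (by rw [map_sub, sub_ne_zero]; exact Ne.symm hne)
  have h2 := B.neg_lt_d p
  have h3 := Int.self_le_toNat (S.h * i + S.h - j)
  omega

/-- A coefficient of the remainder after `K` terms equals that of a finite sum of later terms, all
of which lie in `fil (j + K)`. -/
lemma isSum_of_hasFormalSum {j : ℤ} {f : ℕ → Loop A L} {x : Loop A L}
    (hf : ∀ k : ℕ, f k ∈ B.fil A (j + k)) (h : HasFormalSum f x) :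
    (B.filtration A).IsSum j f x := by
  refine ⟨hf, fun K p i hne => ?_⟩
  obtain ⟨K', hK'⟩ := Filter.eventually_atTop.1 (h i)
  have h1 := (B.coeffAt_eq_iff i _ _).1 (hK' (max K K') (le_max_right _ _)) p
  rw [map_sub, ← h1, ← map_sub, ← Finset.sum_Ico_eq_sub _ (le_max_left K K')] at hne
  refine Submodule.sum_mem (B.fil A (j + K)) (fun k hk => ?_) p i hne
  exact (B.filtration A).mem_of_le (by have := (Finset.mem_Ico.1 hk).1; omega) (hf k)

lemma isExpAd_iff {U : Loop A L} (hU : U ∈ B.fil A 1) (x y : Loop A L) :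
    IsExpAd U x y ↔ y = (B.filtration A).exp U x := by
  obtain ⟨j, hj⟩ := (B.filtration A).exhaust x
  have h := LieFiltration.isSum_exp (F := B.filtration A) hU hj
  rw [IsExpAd]
  simp only [← expTerm_apply]
  constructor
  · intro hy
    exact (B.isSum_of_hasFormalSum h.1 hy).unique h
  · rintro rfl
    exact B.hasFormalSum_of_isSum h

lemma expAd_eq {U : Loop A L} (hU : U ∈ B.fil A 1) (x : Loop A L) :
    expAd U x = (B.filtration A).exp U x :=
  (B.isExpAd_iff hU x _).1 (Classical.epsilon_spec (p := IsExpAd U x)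
    ⟨_, (B.isExpAd_iff hU x _).2 rfl⟩)

lemma coeff_form_eq_zero {x y : Loop A L} {i j : ℤ} (hx : x ∈ B.fil A i) (hy : y ∈ B.fil A j)
    {k : ℤ} (hk : S.h * k < i + j) : Series.coeff ℂ k (loopForm A S.form x y) = 0 := by
  by_contra h
  obtain ⟨p, i₁, q, i₂, h1, h2, h3, h4⟩ := B.exists_of_coeff_form_ne_zero h
  have h5 := hx p i₁ h3
  have h6 := hy q i₂ h4
  rw [← h1, mul_add] at hk
  omega

lemma form_expTerm (U : Loop A L) (k : ℕ) (x y : Loop A L) :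
    loopForm A S.form (expTerm U k x) y = loopForm A S.form x (expTerm (-U) k y) := by
  have hp : ∀ x y, loopForm A S.form ((LieAlgebra.ad ℂ (Loop A L) U ^ k) x) y =
      loopForm A S.form x ((LieAlgebra.ad ℂ (Loop A L) (-U) ^ k) y) := by
    induction k with
    | zero => simp
    | succ k ih =>
      intro x y
      rw [pow_succ, pow_succ', Module.End.mul_apply, Module.End.mul_apply, ih, LieAlgebra.ad_apply,
        LieAlgebra.ad_apply, ← lie_skew, neg_lie, map_neg, map_neg, LinearMap.neg_apply,
        loopForm_lie S.form_lie, map_neg]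
  simp only [expTerm, LinearMap.smul_apply]
  rw [← algebraMap_smul (Series A) ((k.factorial : ℂ)⁻¹),
    ← algebraMap_smul (Series A) ((k.factorial : ℂ)⁻¹), map_smul, map_smul, LinearMap.smul_apply, hp]

/-- Term by term this is invariance of the form. A fixed coefficient of the pairing sees only
finitely many terms of each exponential, by `coeff_form_eq_zero`. -/
lemma form_exp {U : Loop A L} (hU : U ∈ B.fil A 1) (x y : Loop A L) :
    loopForm A S.form ((B.filtration A).exp U x) y =
      loopForm A S.form x ((B.filtration A).exp (-U) y) := by
  obtain ⟨i, hi⟩ := (B.filtration A).exhaust x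
  obtain ⟨j, hj⟩ := (B.filtration A).exhaust y
  have hx := LieFiltration.isSum_exp (F := B.filtration A) hU hi
  have hy := LieFiltration.isSum_exp (F := B.filtration A) (neg_mem hU) hj
  ext k
  rw [← sub_eq_zero, ← map_sub]
  set K := (S.h * k - i - j + 1).toNat with hK
  have hK' : S.h * k - i - j + 1 ≤ K := Int.self_le_toNat _
  have h1 := B.coeff_form_eq_zero (hx.2 K) hj (k := k) (by omega)
  have h2 := B.coeff_form_eq_zero hi (hy.2 K) (k := k) (by omega)
  have h3 : loopForm A S.form (∑ q ∈ Finset.range K, expTerm U q x) y =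
      loopForm A S.form x (∑ q ∈ Finset.range K, expTerm (-U) q y) := by
    rw [map_sum, map_sum, LinearMap.sum_apply]
    exact Finset.sum_congr rfl fun q _ => form_expTerm U q x y
  have h4 : loopForm A S.form ((B.filtration A).exp U x) y -
      loopForm A S.form x ((B.filtration A).exp (-U) y) =
      loopForm A S.form ((B.filtration A).exp U x - ∑ q ∈ Finset.range K, expTerm U q x) y -
      loopForm A S.form x ((B.filtration A).exp (-U) y - ∑ q ∈ Finset.range K, expTerm (-U) q y) := by
    rw [map_sub, map_sub, LinearMap.sub_apply, h3]; abel
  rw [h4, map_sub, h1, h2, sub_zero]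

lemma form_exp_exp {U : Loop A L} (hU : U ∈ B.fil A 1) (x y : Loop A L) :
    loopForm A S.form ((B.filtration A).exp U x) ((B.filtration A).exp U y) =
      loopForm A S.form x y := by
  rw [B.form_exp hU, LieFiltration.exp_neg_exp (F := B.filtration A) hU]

end Setup.HomogeneousBasis

end

/-! ### Homogeneous loops and their values at `λ = 1`. -/

section

namespace Setup.HomogeneousBasis

variable {L : Type*} [LieRing L] [LieAlgebra ℂ L] [FiniteDimensional ℂ L]
  [LieAlgebra.IsSimple ℂ L] {H : LieSubalgebra ℂ L} [H.IsCartanSubalgebra] {n N : ℕ}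
  {S : Setup H n} (B : S.HomogeneousBasis N) {A : Type*} [CommRing A] [Algebra ℂ A]

/-- The elements of `𝔤` whose components have degrees congruent to `m` modulo `h`. -/
def Cls (m : ℤ) : Submodule ℂ L where
  carrier := {v | ∀ j, B.e.repr v j ≠ 0 → (S.h : ℤ) ∣ m - B.d j}
  add_mem' {v w} hv hw j h := by
    by_cases hv0 : B.e.repr v j = 0
    · exact hw j (by simpa [hv0] using h)
    · exact hv j hv0
  zero_mem' j h := by simp at h
  smul_mem' c v hv j h := hv j fun h0 => h (by simp [h0])

lemma mem_Cls_of_dvd {m d : ℤ} {v : L} (hv : v ∈ principalPart S.gen d) (h : (S.h : ℤ) ∣ m - d) :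
    v ∈ B.Cls m := by
  intro j hj
  by_cases hd : B.d j = d
  · rwa [hd]
  · exact absurd (B.repr_eq_zero hv hd) hj

lemma Cls_induction {m : ℤ} {p : L → Prop} (h0 : p 0) (hadd : ∀ v w, p v → p w → p (v + w))
    (hsmul : ∀ (c : ℂ) j, (S.h : ℤ) ∣ m - B.d j → p (c • B.e j)) {v : L} (hv : v ∈ B.Cls m) :
    p v := by
  classical
  rw [← B.e.sum_repr v]
  have : ∀ s : Finset (Fin N), p (∑ j ∈ s, B.e.repr v j • B.e j) := by
    intro s
    induction s using Finset.induction_on with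
    | empty => simpa using h0
    | insert j s hj ih =>
      rw [Finset.sum_insert hj]
      refine hadd _ _ ?_ ih
      by_cases hc : B.e.repr v j = 0
      · rw [hc, zero_smul]; exact h0
      · exact hsmul _ j (hv j hc)
  exact this _

/-- The homogeneous element of degree `m` of the loop algebra with value `v` at `λ = 1`, when
`v` has the right class. -/
def tau (A : Type*) [CommRing A] [Algebra ℂ A] (m : ℤ) : L →ₗ[ℂ] Loop A L :=
  B.e.constr ℂ fun j =>
    if (S.h : ℤ) ∣ m - B.d j then lam A ((m - B.d j) / S.h) ⊗ₜ[ℂ] B.e j else 0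

lemma tau_basis (m : ℤ) (j : Fin N) : B.tau A m (B.e j) =
    if (S.h : ℤ) ∣ m - B.d j then lam A ((m - B.d j) / S.h) ⊗ₜ[ℂ] B.e j else 0 :=
  B.e.constr_basis ℂ _ j

lemma tau_of_mem {m d : ℤ} {v : L} (hv : v ∈ principalPart S.gen d) : B.tau A m v =
    if (S.h : ℤ) ∣ m - d then lam A ((m - d) / S.h) ⊗ₜ[ℂ] v else 0 := by
  have h : ∀ j, B.e.repr v j • B.tau A m (B.e j) = if (S.h : ℤ) ∣ m - d then
      lam A ((m - d) / S.h) ⊗ₜ[ℂ] (B.e.repr v j • B.e j) else 0 := by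
    intro j
    by_cases hd : B.d j = d
    · rw [tau_basis, hd]
      split_ifs
      · rw [TensorProduct.tmul_smul]
      · rw [smul_zero]
    · rw [B.repr_eq_zero hv hd]; simp
  nth_rw 1 [← B.e.sum_repr v]
  simp only [map_sum, map_smul, h]
  split_ifs
  · rw [← TensorProduct.tmul_sum, B.e.sum_repr]
  · simp

lemma tau_self {d : ℤ} {v : L} (hv : v ∈ principalPart S.gen d) :
    B.tau A d v = (1 : Series A) ⊗ₜ[ℂ] v := by
  rw [B.tau_of_mem hv, sub_self, if_pos (dvd_zero _), Int.zero_ediv, Series.lam_zero]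

lemma cf_tau (m : ℤ) (v : L) (j : Fin N) (i : ℤ) :
    B.cf j i (B.tau A m v) = if B.d j = m + S.h * i then algebraMap ℂ A (B.e.repr v j) else 0 := by
  have hh := h_pos S
  nth_rw 1 [← B.e.sum_repr v]
  rw [map_sum, map_sum, Finset.sum_eq_single j]
  · rw [map_smul, map_smul, tau_basis]
    by_cases hd : (S.h : ℤ) ∣ m - B.d j
    · obtain ⟨p, hp⟩ := hd
      rw [if_pos ⟨p, hp⟩, hp, Int.mul_ediv_cancel_left _ (by omega), cf_tmul, Series.coeff_lam]
      have : i = -p ↔ B.d j = m + S.h * i := by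
        constructor
        · rintro rfl; rw [mul_neg]; omega
        · intro h
          have h1 : (S.h : ℤ) * (i + p) = 0 := by rw [mul_add]; omega
          rcases mul_eq_zero.1 h1 with h2 | h2 <;> omega
      rw [if_congr this rfl rfl]
      split_ifs <;> simp [Algebra.smul_def]
    · rw [if_neg hd, if_neg, map_zero, smul_zero]
      rintro h
      exact hd ⟨-i, by rw [h, mul_neg]; ring⟩
  · intro k _ hk
    rw [map_smul, map_smul, tau_basis]
    split_ifs
    · rw [cf_tmul]; simp [hk]
    · simp
  · simp

lemma eq_zero_of_tau [Nontrivial A] {m : ℤ} {v : L} (hv : v ∈ B.Cls m) (h : B.tau A m v = 0) :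
    v = 0 := by
  refine B.e.ext_elem fun j => ?_
  rw [map_zero, Finsupp.coe_zero, Pi.zero_apply]
  by_contra hne
  obtain ⟨p, hp⟩ := hv j hne
  have h1 := B.cf_tau (A := A) m v j (-p)
  rw [h, map_zero, if_pos (by rw [mul_neg]; omega)] at h1
  exact hne ((map_eq_zero _).1 h1.symm)

/-- `tau` inverts the evaluation at `λ = 1`. Since it respects brackets, identities for homogeneous
loops can be checked in `𝔤`. A class condition on `v` is enough: `tau` kills the components of `w`
of the wrong class, and those of `[v, w]` correspondingly. -/
lemma tau_lie {m : ℤ} {v : L} (hv : v ∈ B.Cls m) (l : ℤ) (w : L) :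
    ⁅B.tau A m v, B.tau A l w⁆ = B.tau A (m + l) ⁅v, w⁆ := by
  have hh := h_pos S
  refine B.Cls_induction (p := fun v => ⁅B.tau A m v, B.tau A l w⁆ = B.tau A (m + l) ⁅v, w⁆)
    (by simp) (fun v v' h h' => by simp only [map_add, add_lie, h, h']) (fun c j hj => ?_) hv
  rw [map_smul, smul_lie, smul_lie, map_smul]
  congr 1
  rw [← B.e.sum_repr w]
  simp only [map_sum, lie_sum, map_smul, lie_smul]
  refine Finset.sum_congr rfl fun k _ => ?_
  congr 1
  rw [B.tau_of_mem (lie_mem_principalPart (B.mem j) (B.mem k)), tau_basis, tau_basis, if_pos hj]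
  obtain ⟨p, hp⟩ := hj
  have h1 : m + l - (B.d j + B.d k) = S.h * p + (l - B.d k) := by omega
  rw [h1, if_congr (dvd_add_right (dvd_mul_right _ _)) rfl rfl]
  split_ifs with hk
  · obtain ⟨q, hq⟩ := hk
    rw [LieAlgebra.ExtendScalars.bracket_tmul, Series.lam_mul_lam, hp, hq, ← mul_add,
      Int.mul_ediv_cancel_left _ (by omega), Int.mul_ediv_cancel_left _ (by omega),
      Int.mul_ediv_cancel_left _ (by omega)]
  · rw [lie_zero]

lemma lie_mem_Cls {m l : ℤ} {v w : L} (hv : v ∈ B.Cls m) (hw : w ∈ B.Cls l) :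
    ⁅v, w⁆ ∈ B.Cls (m + l) := by
  refine B.Cls_induction (p := fun v => ⁅v, w⁆ ∈ B.Cls (m + l))
    (by simp) (fun v v' h h' => by simpa only [add_lie] using add_mem h h') (fun c j hj => ?_) hv
  refine B.Cls_induction (p := fun w => ⁅c • B.e j, w⁆ ∈ B.Cls (m + l))
    (by simp) (fun v v' h h' => by simpa only [lie_add] using add_mem h h') (fun c' k hk => ?_) hw
  rw [smul_lie, lie_smul]
  refine Submodule.smul_mem _ _ (Submodule.smul_mem _ _
    (B.mem_Cls_of_dvd (lie_mem_principalPart (B.mem j) (B.mem k)) ?_))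
  rw [show m + l - (B.d j + B.d k) = (m - B.d j) + (l - B.d k) by ring]
  exact dvd_add hj hk

lemma tau_form {m l : ℤ} {v w : L} (hv : v ∈ B.Cls m) (hw : w ∈ B.Cls l) :
    loopForm A S.form (B.tau A m v) (B.tau A l w) = S.form v w • lam A ((m + l) / S.h) := by
  have hh := h_pos S
  refine B.Cls_induction (p := fun v => loopForm A S.form (B.tau A m v) (B.tau A l w) =
    S.form v w • lam A ((m + l) / S.h))
    (by simp) (fun v v' h h' => by simp only [map_add, LinearMap.add_apply, add_smul, h, h'])
    (fun c j hj => ?_) hv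
  refine B.Cls_induction (p := fun w => loopForm A S.form (B.tau A m (c • B.e j)) (B.tau A l w) =
    S.form (c • B.e j) w • lam A ((m + l) / S.h))
    (by simp) (fun v v' h h' => by simp only [map_add, add_smul, h, h'])
    (fun c' k hk => ?_) hw
  rw [map_smul (B.tau A m), map_smul (B.tau A l), tau_basis, tau_basis, if_pos hj, if_pos hk, ← TensorProduct.tmul_smul,
    ← TensorProduct.tmul_smul, loopForm_tmul, Series.lam_mul_lam]
  by_cases hd : B.d j + B.d k = 0
  · obtain ⟨p, hp⟩ := hj
    obtain ⟨q, hq⟩ := hk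
    have h1 : m + l = S.h * (p + q) := by rw [mul_add]; omega
    rw [h1, hp, hq, Int.mul_ediv_cancel_left _ (by omega), Int.mul_ediv_cancel_left _ (by omega),
      Int.mul_ediv_cancel_left _ (by omega)]
  · have : S.form (c • B.e j) (c' • B.e k) = 0 := by
      rw [map_smul, map_smul, LinearMap.smul_apply, S.form_eq_zero_of_degree (B.mem j) (B.mem k) hd]
      simp
    rw [this, zero_smul, zero_smul]

lemma form_eq_zero_of_Cls {m l : ℤ} {v w : L} (hv : v ∈ B.Cls m) (hw : w ∈ B.Cls l)
    (h : ¬ (S.h : ℤ) ∣ m + l) : S.form v w = 0 := by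
  refine B.Cls_induction (p := fun v => S.form v w = 0)
    (by simp) (fun v v' h h' => by simp only [map_add, LinearMap.add_apply, h, h', add_zero])
    (fun c j hj => ?_) hv
  refine B.Cls_induction (p := fun w => S.form (c • B.e j) w = 0)
    (by simp) (fun v v' h h' => by simp only [map_add, h, h', add_zero])
    (fun c' k hk => ?_) hw
  have hd : B.d j + B.d k ≠ 0 := by
    intro hd
    apply h
    have := dvd_add hj hk
    rwa [show m - B.d j + (l - B.d k) = m + l by omega] at this
  rw [map_smul, map_smul, LinearMap.smul_apply, S.form_eq_zero_of_degree (B.mem j) (B.mem k) hd]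
  simp

lemma lam_smul_tau (p m : ℤ) (v : L) : lam A p • B.tau A m v = B.tau A (m + S.h * p) v := by
  refine B.loop_ext fun j i => ?_
  rw [cf_lam_smul, cf_tau, cf_tau]
  congr 1
  rw [mul_add, eq_iff_iff]; omega

lemma constLoop_tau (m : ℤ) (v : L) : constLoop A (B.tau ℂ m v) = B.tau A m v := by
  rw [← B.e.sum_repr v]
  simp only [map_sum, map_smul]
  refine Finset.sum_congr rfl fun j _ => ?_
  rw [tau_basis, tau_basis]
  split_ifs
  · rw [constLoop_tmul, Series.constSeries_lam]
  · rw [map_zero]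

lemma tau_mem_fil (m : ℤ) (v : L) : B.tau A m v ∈ B.fil A (-m) := by
  intro j i hj
  rw [cf_tau] at hj
  split_ifs at hj with h
  · omega
  · exact absurd rfl hj

lemma mem_homogeneous_iff {m : ℤ} {x : Loop ℂ L} :
    x ∈ S.homogeneous m ↔ ∀ j i, B.cf j i x ≠ 0 → B.d j = m + S.h * i := by
  rw [Setup.homogeneous, Submodule.mem_iInf]
  refine ⟨fun h j i hj => ?_, fun h i => ?_⟩
  · by_contra hd
    apply hj
    rw [cf_of_coeffAt]
    have h1 : ∀ y ∈ (principalPart S.gen (m + S.h * i)).baseChange ℂ,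
        (B.e.baseChange ℂ).repr y j = 0 := by
      intro y hy
      rw [Submodule.baseChange_eq_span] at hy
      induction hy using Submodule.span_induction with
      | mem y hy =>
        obtain ⟨v, hv, rfl⟩ := hy
        rw [TensorProduct.mk_apply, Module.Basis.baseChange_repr_tmul, B.repr_eq_zero hv hd,
          zero_smul]
      | zero => simp
      | add y z _ _ hy hz => simp [hy, hz]
      | smul c y _ hy => simp [hy]
    exact h1 _ (h i)
  · rw [Submodule.mem_comap, B.coeffAt_eq_sum]
    refine Submodule.sum_mem _ fun j _ => ?_
    by_cases hj : B.cf j i x = 0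
    · rw [hj, TensorProduct.zero_tmul]; exact zero_mem _
    · refine Submodule.tmul_mem_baseChange_of_mem _ ?_
      rw [← h j i hj]
      exact B.mem j

lemma tau_mem_homogeneous (m : ℤ) (v : L) : B.tau ℂ m v ∈ S.homogeneous m := by
  rw [B.mem_homogeneous_iff]
  intro j i hj
  rw [cf_tau] at hj
  by_contra h
  exact hj (if_neg h)

/-- In a homogeneous loop of degree `m`, `e_j` can occur only with the power `λ^{-(d_j - m)/h}`, so
each coordinate reduces to one number. -/
lemma exists_tau {m : ℤ} {x : Loop ℂ L} (hx : x ∈ S.homogeneous m) :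
    ∃ v ∈ B.Cls m, B.tau ℂ m v = x := by
  rw [B.mem_homogeneous_iff] at hx
  have hh := h_pos S
  set v : L := ∑ j, B.cf j ((B.d j - m) / S.h) x • B.e j with hv
  have hr : ∀ j, B.e.repr v j = B.cf j ((B.d j - m) / S.h) x := by
    intro j
    rw [hv, map_sum, Finsupp.coe_finsetSum, Finset.sum_apply, Finset.sum_eq_single j]
    · simp
    · intro k _ hk; simp [hk]
    · simp
  refine ⟨v, fun j hj => ?_, B.loop_ext fun j i => ?_⟩
  · rw [hr] at hj
    exact ⟨-((B.d j - m) / S.h), by rw [mul_neg]; have := hx j _ hj; omega⟩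
  · rw [cf_tau, hr]
    split_ifs with h
    · rw [h, add_sub_cancel_left, Int.mul_ediv_cancel_left _ (by omega)]
      rfl
    · by_contra hne
      exact h (hx j i (Ne.symm hne))

lemma cyclic_mem_Cls (hn : 0 < n) : S.cyclic ∈ B.Cls 1 := by
  refine add_mem (B.mem_Cls_of_dvd S.principalNilpotent_mem (by simp))
    (B.mem_Cls_of_dvd (B.Eneg_mem hn) ⟨1, by ring⟩)

lemma tau_cyclic_complex (hn : 0 < n) : B.tau ℂ 1 S.cyclic = S.cyclicElement := by
  have hh := h_pos S
  rw [Setup.cyclic, Setup.cyclicElement, map_add, B.tau_self S.principalNilpotent_mem,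
    B.tau_of_mem (B.Eneg_mem hn), if_pos ⟨1, by ring⟩, sub_sub_cancel, Int.ediv_self (by omega)]

lemma tau_cyclic (hn : 0 < n) : B.tau A 1 S.cyclic = constLoop A S.cyclicElement := by
  rw [← B.constLoop_tau, B.tau_cyclic_complex hn]

lemma principalElement_mem_gr (S : Setup H n) :
    principalElement S.gen ∈ principalPart S.gen 0 := by
  rw [mem_principalPart, lie_self]; simp

lemma principalElement_mem_Cls : principalElement S.gen ∈ B.Cls 0 :=
  B.mem_Cls_of_dvd (principalElement_mem_gr S) (by simp)

end Setup.HomogeneousBasis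

end

/-! ### The kernel and image of `ad_Λ`, and existence of the dressing pair. -/

section

namespace Setup.HomogeneousBasis

variable {L : Type*} [LieRing L] [LieAlgebra ℂ L] [FiniteDimensional ℂ L]
  [LieAlgebra.IsSimple ℂ L] {H : LieSubalgebra ℂ L} [H.IsCartanSubalgebra] {n N : ℕ}
  {S : Setup H n} (B : S.HomogeneousBasis N) (Λ : S.KernelBasis)
  {A : Type*} [CommRing A] [Algebra ℂ A]

/-- The value of `Λ_{m_a}(λ)` at `λ = 1`. -/
def ell (a : Fin n) : L := (B.exists_tau (Λ.mem_homogeneous a)).choose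

lemma ell_mem (a : Fin n) : B.ell Λ a ∈ B.Cls (exponent S.gen a) :=
  (B.exists_tau (Λ.mem_homogeneous a)).choose_spec.1

lemma tau_ell_complex (a : Fin n) : B.tau ℂ (exponent S.gen a) (B.ell Λ a) = Λ.Λ a :=
  (B.exists_tau (Λ.mem_homogeneous a)).choose_spec.2

lemma tau_ell (a : Fin n) : B.tau A (exponent S.gen a) (B.ell Λ a) = constLoop A (Λ.Λ a) := by
  rw [← B.constLoop_tau, tau_ell_complex]

lemma lie_ell (a : Fin n) : ⁅S.cyclic, B.ell Λ a⁆ = 0 := by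
  have hn : 0 < n := a.pos
  refine B.eq_zero_of_tau (A := ℂ) (B.lie_mem_Cls (B.cyclic_mem_Cls hn) (B.ell_mem Λ a)) ?_
  rw [← B.tau_lie (B.cyclic_mem_Cls hn), B.tau_cyclic_complex hn, tau_ell_complex]
  exact Λ.mem_ker a

lemma form_ell_eq (a b : Fin n) : S.form (B.ell Λ a) (B.ell Λ b) •
    lam ℂ ((exponent S.gen a + exponent S.gen b : ℤ) / S.h) = (S.h * S.eta a b) • lam ℂ 1 := by
  rw [← B.tau_form (B.ell_mem Λ a) (B.ell_mem Λ b), tau_ell_complex, tau_ell_complex]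
  exact Λ.form_eq a b

/-- The two sides of `form_ell_eq` could differ only in the power of `λ`. Comparing one suitable
coefficient gives the value at `λ = 1`. -/
lemma form_ell (a b : Fin n) : S.form (B.ell Λ a) (B.ell Λ b) = S.h * S.eta a b := by
  have h := B.form_ell_eq Λ a b
  by_cases hab : S.eta a b = 0
  · rw [hab, mul_zero, zero_smul] at h
    have h1 := congrArg (Series.coeff ℂ (-((exponent S.gen a + exponent S.gen b : ℤ) / S.h))) h
    rw [map_smul, Series.coeff_lam, if_pos rfl, map_zero, smul_eq_mul, mul_one] at h1
    rw [h1, hab, mul_zero]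
  · have h1 := congrArg (Series.coeff ℂ (-1)) h
    rw [map_smul, map_smul, Series.coeff_lam, Series.coeff_lam, if_pos rfl, smul_eq_mul,
      smul_eq_mul, mul_one] at h1
    split_ifs at h1
    · rw [← h1, mul_one]
    · rw [mul_zero] at h1
      exact absurd h1.symm (mul_ne_zero (h_ne_zero S) hab)

-- Forced by the normalization: `(Λ_{m_a}|Λ_{m_b})` has degree `m_a + m_b` and is a nonzero multiple
-- of `λ`, which has degree `h`.
include B Λ in
lemma exponent_add (a b : Fin n) (hab : S.eta a b ≠ 0) :
    (exponent S.gen a + exponent S.gen b : ℤ) = S.h := by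
  have hh := h_pos S
  have h0 : (S.h : ℂ) * S.eta a b ≠ 0 := mul_ne_zero (h_ne_zero S) hab
  have h := B.form_ell_eq Λ a b
  have hd : (S.h : ℤ) ∣ exponent S.gen a + exponent S.gen b := by
    by_contra hd
    exact h0 (by rw [← B.form_ell Λ, B.form_eq_zero_of_Cls (B.ell_mem Λ a) (B.ell_mem Λ b) hd])
  have h1 := congrArg (Series.coeff ℂ (-1)) h
  rw [map_smul, map_smul, Series.coeff_lam, Series.coeff_lam, if_pos rfl, smul_eq_mul,
    smul_eq_mul, mul_one] at h1
  split_ifs at h1 with h2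
  · obtain ⟨p, hp⟩ := hd
    rw [hp, Int.mul_ediv_cancel_left _ (by omega)] at h2
    rw [hp, show p = 1 by omega, mul_one]
  · rw [mul_zero] at h1
    exact absurd h1.symm h0

include B Λ in
lemma exponent_add_rev (a : Fin n) : (exponent S.gen a + exponent S.gen a.rev : ℤ) = S.h :=
  B.exponent_add Λ a _ (by simp [eta_eq])

include B in
lemma form_const (a b : Fin n) :
    loopForm A S.form (constLoop A (Λ.Λ a)) (constLoop A (Λ.Λ b)) =
      ((S.h : ℂ) * S.eta a b) • lam A 1 := by
  have hh := h_pos S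
  rw [← B.tau_ell, ← B.tau_ell, B.tau_form (B.ell_mem Λ a) (B.ell_mem Λ b), B.form_ell]
  by_cases hab : S.eta a b = 0
  · rw [hab, mul_zero, zero_smul, zero_smul]
  · rw [B.exponent_add Λ a b hab, Int.ediv_self (by omega)]

include B in
lemma lie_const (a b : Fin n) : ⁅constLoop A (Λ.Λ a), constLoop A (Λ.Λ b)⁆ = 0 := by
  rw [← B.tau_ell, ← B.tau_ell, B.tau_lie (B.ell_mem Λ a),
    B.lie_eq_zero_of_lie_cyclic (B.lie_ell Λ) (B.form_ell Λ) a.pos (B.lie_ell Λ a) (B.lie_ell Λ b),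
    map_zero]

lemma cyclic_lie_const (a : Fin n) :
    ⁅constLoop A S.cyclicElement, constLoop A (Λ.Λ a)⁆ = 0 := by
  rw [← constLoop_lie, show ⁅S.cyclicElement, Λ.Λ a⁆ = 0 from Λ.mem_ker a, map_zero]

lemma const_mem_fil (a : Fin n) : constLoop A (Λ.Λ a) ∈ B.fil A (-exponent S.gen a) := by
  rw [← B.tau_ell]; exact B.tau_mem_fil _ _

/-- The projection onto the kernel of `ad Λ` along its image. -/
def loopKerProj (A : Type*) [CommRing A] [Algebra ℂ A] (Λ : S.KernelBasis) :
    Loop A L →ₗ[Series A] Loop A L :=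
  ∑ b, ((algebraMap ℂ (Series A) (S.h : ℂ)⁻¹ * lam A (-1)) •
    (loopForm A S.form).flip (constLoop A (Λ.Λ b))).smulRight (constLoop A (Λ.Λ b.rev))

lemma loopKerProj_apply (x : Loop A L) : loopKerProj A Λ x =
    ∑ b, ((algebraMap ℂ (Series A) (S.h : ℂ)⁻¹ * lam A (-1)) *
      loopForm A S.form x (constLoop A (Λ.Λ b))) • constLoop A (Λ.Λ b.rev) := by
  simp [loopKerProj]

lemma loopKerProj_lie (x : Loop A L) :
    loopKerProj A Λ ⁅constLoop A S.cyclicElement, x⁆ = 0 := by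
  rw [loopKerProj_apply]
  refine Finset.sum_eq_zero fun b _ => ?_
  rw [← lie_skew, map_neg, LinearMap.neg_apply, loopForm_lie S.form_lie, cyclic_lie_const,
    map_zero, neg_zero, mul_zero, zero_smul]

lemma loopKerProj_tau {m : ℤ} {v : L} (hv : v ∈ B.Cls m) :
    loopKerProj A Λ (B.tau A m v) = B.tau A m (kerProj S (B.ell Λ) v) := by
  have hh := h_pos S
  rw [loopKerProj_apply, kerProj_apply, map_sum]
  refine Finset.sum_congr rfl fun b _ => ?_
  rw [map_smul, ← B.tau_ell, ← B.tau_ell, B.tau_form hv (B.ell_mem Λ b)]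
  by_cases hd : (S.h : ℤ) ∣ m + exponent S.gen b
  · obtain ⟨p, hp⟩ := hd
    have h1 : algebraMap ℂ (Series A) (S.h : ℂ)⁻¹ * lam A (-1) *
        (S.form v (B.ell Λ b) • lam A p) = ((S.h : ℂ)⁻¹ * S.form v (B.ell Λ b)) • lam A (-1 + p) := by
      rw [mul_smul_comm, mul_assoc, Series.lam_mul_lam, ← Algebra.smul_def, smul_smul,
        mul_comm (S.form v (B.ell Λ b))]
    have h2 : (exponent S.gen b.rev : ℤ) + S.h * (-1 + p) = m := by
      have := B.exponent_add_rev Λ b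
      rw [mul_add]
      omega
    rw [hp, Int.mul_ediv_cancel_left _ (by omega), h1, smul_assoc, lam_smul_tau, h2]
  · rw [B.form_eq_zero_of_Cls hv (B.ell_mem Λ b) hd]
    simp

/-- The series-linear extension of a map `ψ` of degree `-1` on `𝔤`. -/
def loopExtend (A : Type*) [CommRing A] [Algebra ℂ A] (ψ : L →ₗ[ℂ] L) :
    Loop A L →ₗ[Series A] Loop A L :=
  (B.e.baseChange (Series A)).constr ℂ fun j => B.tau A (B.d j - 1) (ψ (B.e j))

lemma tmul_e (s : Series A) (j : Fin N) :
    s ⊗ₜ[ℂ] B.e j = s • (B.e.baseChange (Series A)) j := by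
  rw [Module.Basis.baseChange_apply, TensorProduct.smul_tmul', smul_eq_mul, mul_one]

lemma loopExtend_tmul (ψ : L →ₗ[ℂ] L) (s : Series A) (j : Fin N) :
    B.loopExtend A ψ (s ⊗ₜ B.e j) = s • B.tau A (B.d j - 1) (ψ (B.e j)) := by
  rw [tmul_e, map_smul, loopExtend, Module.Basis.constr_basis]

lemma loopExtend_tau (ψ : L →ₗ[ℂ] L) {m : ℤ} {w : L} (hw : w ∈ B.Cls m) :
    B.loopExtend A ψ (B.tau A m w) = B.tau A (m - 1) (ψ w) := by
  have hh := h_pos S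
  refine B.Cls_induction (p := fun w => B.loopExtend A ψ (B.tau A m w) = B.tau A (m - 1) (ψ w))
    (by simp) (fun v v' h h' => by simp only [map_add, h, h']) (fun c j hj => ?_) hw
  obtain ⟨p, hp⟩ := hj
  rw [map_smul (B.tau A m), map_smul ψ, map_smul (B.tau A (m - 1)), tau_basis, if_pos ⟨p, hp⟩,
    TensorProduct.smul_tmul', loopExtend_tmul, hp, Int.mul_ediv_cancel_left _ (by omega),
    smul_assoc, lam_smul_tau, show B.d j - 1 + S.h * p = m - 1 by omega]

/-- Reduces series-linear identities to the homogeneous elements `tau`, hence to identities in `𝔤`.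
-/
lemma linearMap_ext {f g : Loop A L →ₗ[Series A] Loop A L}
    (h : ∀ j, f (B.tau A (B.d j) (B.e j)) = g (B.tau A (B.d j) (B.e j))) : f = g := by
  refine (B.e.baseChange (Series A)).ext fun j => ?_
  have := h j
  rwa [B.tau_self (B.mem j), tmul_e, one_smul] at this

lemma basis_mem_Cls (j : Fin N) : B.e j ∈ B.Cls (B.d j) := B.mem_Cls_of_dvd (B.mem j) (by simp)

lemma loopExtend_right (hn : 0 < n) {ψ : L →ₗ[ℂ] L}
    (h : ∀ v, v = kerProj S (B.ell Λ) v + ⁅S.cyclic, ψ v⁆) (x : Loop A L) :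
    x = loopKerProj A Λ x + ⁅constLoop A S.cyclicElement, B.loopExtend A ψ x⁆ := by
  have : LinearMap.id = loopKerProj A Λ +
      (LieAlgebra.ad (Series A) (Loop A L) (constLoop A S.cyclicElement)) ∘ₗ B.loopExtend A ψ := by
    refine B.linearMap_ext fun j => ?_
    rw [LinearMap.add_apply, LinearMap.comp_apply, B.loopExtend_tau ψ (B.basis_mem_Cls j),
      LieAlgebra.ad_apply, B.loopKerProj_tau Λ (B.basis_mem_Cls j), ← B.tau_cyclic hn,
      B.tau_lie (B.cyclic_mem_Cls hn), add_sub_cancel, ← map_add, ← h, LinearMap.id_apply]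
  exact LinearMap.congr_fun this x

lemma loopExtend_left (hn : 0 < n) {ψ : L →ₗ[ℂ] L}
    (h : ∀ v, v = kerProj S (B.ell Λ) v + ψ ⁅S.cyclic, v⁆) (x : Loop A L) :
    x = loopKerProj A Λ x + B.loopExtend A ψ ⁅constLoop A S.cyclicElement, x⁆ := by
  have : LinearMap.id = loopKerProj A Λ + B.loopExtend A ψ ∘ₗ
      (LieAlgebra.ad (Series A) (Loop A L) (constLoop A S.cyclicElement)) := by
    refine B.linearMap_ext fun j => ?_
    rw [LinearMap.add_apply, LinearMap.comp_apply, LieAlgebra.ad_apply,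
      B.loopKerProj_tau Λ (B.basis_mem_Cls j), ← B.tau_cyclic hn,
      B.tau_lie (B.cyclic_mem_Cls hn),
      B.loopExtend_tau ψ (B.lie_mem_Cls (B.cyclic_mem_Cls hn) (B.basis_mem_Cls j)),
      add_sub_cancel_left, ← map_add, ← h, LinearMap.id_apply]
  exact LinearMap.congr_fun this x

/-- Inverting `ad_Λ`, which has degree `1`, lowers the total degree by one. -/
lemma loopExtend_mem (ψ : L →ₗ[ℂ] L) {k : ℤ} {x : Loop A L} (hx : x ∈ B.fil A k) :
    B.loopExtend A ψ x ∈ B.fil A (k + 1) := by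
  intro j i hne
  rw [← B.sum_coord x, map_sum, map_sum] at hne
  obtain ⟨q, _, hq⟩ := Finset.exists_ne_zero_of_sum_ne_zero hne
  rw [loopExtend_tmul] at hq
  obtain ⟨p, r, hpr, h3, h4⟩ := B.exists_of_cf_smul_ne_zero hq
  have h5 := hx q p h3
  rw [cf_tau] at h4
  split_ifs at h4 with h6
  · rw [← hpr, mul_add]; omega
  · exact absurd rfl h4

lemma exists_loopInverse (A : Type*) [CommRing A] [Algebra ℂ A] (hn : 0 < n) :
    ∃ Ψ : Loop A L →ₗ[Series A] Loop A L,
      (∀ x, x = loopKerProj A Λ x + ⁅constLoop A S.cyclicElement, Ψ x⁆) ∧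
      (∀ x, x = loopKerProj A Λ x + Ψ ⁅constLoop A S.cyclicElement, x⁆) ∧
      ∀ k, ∀ x ∈ B.fil A k, Ψ x ∈ B.fil A (k + 1) := by
  obtain ⟨ψ, h1, h2⟩ := B.exists_partialInverse (B.lie_ell Λ) (B.form_ell Λ) hn
  exact ⟨B.loopExtend A ψ, B.loopExtend_right Λ hn h1, B.loopExtend_left Λ hn h2,
    fun k x hx => B.loopExtend_mem ψ hx⟩

/-! ### The dressing -/

lemma cf_smul (a : A) (x : Loop A L) (j : Fin N) (i : ℤ) : B.cf j i (a • x) = a * B.cf j i x := by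
  have : a • x = Series.C A a • x := by
    rw [← algebraMap_smul (Series A) a x]; rfl
  rw [this, cf_eq, map_smul, smul_eq_mul, Series.coeff_C_mul, cf_eq]

lemma smul_mem_fil (a : A) {x : Loop A L} {k : ℤ} (hx : x ∈ B.fil A k) : a • x ∈ B.fil A k := by
  intro j i h
  rw [cf_smul] at h
  exact hx j i (right_ne_zero_of_mul h)

lemma span_le_fil (k : ℤ) (T : Submodule ℂ (Loop ℂ L)) {x : Loop A L}
    (hx : x ∈ Submodule.span A (constLoop A '' (T ⊓ S.homogeneous k : Submodule ℂ (Loop ℂ L)))) :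
    x ∈ B.fil A (-k) := by
  induction hx using Submodule.span_induction with
  | mem y hy =>
    obtain ⟨z, hz, rfl⟩ := hy
    obtain ⟨v, _, rfl⟩ := B.exists_tau hz.2
    rw [B.constLoop_tau]
    exact B.tau_mem_fil _ _
  | zero => exact zero_mem _
  | add y z _ _ hy hz => exact add_mem hy hz
  | smul c y _ hy => exact B.smul_mem_fil c hy

lemma lie_kerPart {k : ℤ} {x : Loop A L} (hx : x ∈ S.kerPart A k) :
    ⁅constLoop A S.cyclicElement, x⁆ = 0 := by
  induction hx using Submodule.span_induction with
  | mem y hy =>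
    obtain ⟨z, hz, rfl⟩ := hy
    rw [← constLoop_lie, show ⁅S.cyclicElement, z⁆ = 0 from hz.1, map_zero]
  | zero => rw [lie_zero]
  | add y z _ _ hy hz => rw [lie_add, hy, hz, add_zero]
  | smul c y _ hy => rw [← algebraMap_smul (Series A) c y, lie_smul_loop, hy, smul_zero]

lemma tau_mem_kerPart (hn : 0 < n) (m : ℤ) {v : L} (hv : ⁅S.cyclic, v⁆ = 0) :
    B.tau A m v ∈ S.kerPart A m := by
  refine Submodule.subset_span ⟨B.tau ℂ m v, ⟨?_, B.tau_mem_homogeneous m v⟩, B.constLoop_tau m v⟩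
  change ⁅S.cyclicElement, B.tau ℂ m v⁆ = 0
  rw [← B.tau_cyclic_complex hn, B.tau_lie (B.cyclic_mem_Cls hn), hv, map_zero]

lemma tau_mem_imPart (hn : 0 < n) (m : ℤ) (v : L) :
    B.tau A m ⁅S.cyclic, v⁆ ∈ S.imPart A m := by
  refine Submodule.subset_span ⟨B.tau ℂ m ⁅S.cyclic, v⁆,
    ⟨⟨B.tau ℂ (m - 1) v, ?_⟩, B.tau_mem_homogeneous _ _⟩, B.constLoop_tau _ _⟩
  change ⁅S.cyclicElement, B.tau ℂ (m - 1) v⁆ = _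
  rw [← B.tau_cyclic_complex hn, B.tau_lie (B.cyclic_mem_Cls hn), add_sub_cancel]

-- Only the component of `z` of degree exactly `-k` has to be matched. Apply `v = kerProj v + [I₊ +
-- E_{-θ}, ψ v]` to its value at `λ = 1`, with coefficients in `A`.
include Λ in
lemma exists_decomposition (hn : 0 < n) (k : ℤ) {z : Loop A L} (hz : z ∈ B.fil A k) :
    ∃ κ ∈ S.kerPart A (-k), ∃ y ∈ S.imPart A (-(k + 1)),
      z - κ - ⁅constLoop A S.cyclicElement, y⁆ ∈ B.fil A (k + 1) := by
  classical
  have hh := h_pos S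
  obtain ⟨ψ, h1, h2⟩ := B.exists_partialInverse (B.lie_ell Λ) (B.form_ell Λ) hn
  set P := kerProj S (B.ell Λ) with hP
  have hw : ∀ w, w - P w = ⁅S.cyclic, ψ w⁆ := fun w => by
    nth_rw 1 [h1 w]; rw [add_sub_cancel_left]
  -- `λ^{-i} e_j` has degree `-k` only for `i = (d_j + k)/h`.
  set a : Fin N → A := fun j =>
    if (S.h : ℤ) ∣ -k - B.d j then B.cf j ((B.d j + k) / S.h) z else 0 with ha
  refine ⟨∑ j, a j • B.tau A (-k) (P (B.e j)), ?_,
    -- Subtracting `P (ψ e_j)` does not change the bracket with `Λ` and puts the element in the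
    -- image of `ad_Λ`.
    ∑ j, a j • B.tau A (-(k + 1)) (ψ (B.e j) - P (ψ (B.e j))), ?_, ?_⟩
  · exact Submodule.sum_mem _ fun j _ => Submodule.smul_mem _ _
      (B.tau_mem_kerPart hn _ (lie_kerProj (B.lie_ell Λ) _))
  · refine Submodule.sum_mem _ fun j _ => Submodule.smul_mem _ _ ?_
    rw [hw]
    exact B.tau_mem_imPart hn _ _
  · have h3 : ⁅constLoop A S.cyclicElement,
        ∑ j, a j • B.tau A (-(k + 1)) (ψ (B.e j) - P (ψ (B.e j)))⁆ =
        ∑ j, a j • B.tau A (-k) ⁅S.cyclic, ψ (B.e j)⁆ := by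
      rw [lie_sum]
      refine Finset.sum_congr rfl fun j _ => ?_
      rw [← algebraMap_smul (Series A) (a j), ← algebraMap_smul (Series A) (a j), lie_smul_loop,
        ← B.tau_cyclic hn, B.tau_lie (B.cyclic_mem_Cls hn), lie_sub,
        lie_kerProj (B.lie_ell Λ), sub_zero]
      congr 3
      ring
    rw [h3, sub_sub, ← Finset.sum_add_distrib]
    simp only [← smul_add, ← map_add, ← h1]
    intro j i hne
    rw [map_sub, map_sum, Finset.sum_eq_single j, cf_smul, cf_tau] at hne
    · simp only [Module.Basis.repr_self, Finsupp.single_eq_same, map_one, mul_ite, mul_one,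
        mul_zero] at hne
      split_ifs at hne with h4
      · exfalso
        apply hne
        rw [ha]
        simp only
        rw [if_pos ⟨-i, by rw [mul_neg]; omega⟩, show B.d j + k = S.h * i by omega,
          Int.mul_ediv_cancel_left _ (by omega), sub_self]
      · rw [sub_zero] at hne
        have := hz j i hne
        omega
    · intro q _ hq
      rw [cf_smul, cf_tau]
      simp [hq]
    · simp

lemma coord_W_sub (j : Fin N) : B.coord j (B.W - constLoop B.Poly S.cyclicElement) =
    B.uSeries j := by
  rw [W, add_sub_cancel_left, map_sum, Finset.sum_eq_single j]
  · rw [coord_tmul]; simp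
  · intro k _ hk; rw [coord_tmul]; simp [hk]
  · simp

lemma cf_W_sub (j : Fin N) (i : ℤ) : B.cf j i (B.W - constLoop B.Poly S.cyclicElement) =
    B.u j (i - 1) := by
  rw [cf_eq, coord_W_sub]; rfl

/-- `u^j_k` multiplies `λ^{-k-1} e_j`, of degree `d_j - h(k+1)`. The restriction on `k` thus says
exactly that `W - Λ` has no part of positive degree. -/
lemma u_of_lt {j : Fin N} {k : ℤ} (h : S.h * (k + 1) < B.d j) : B.u j k = 0 := by
  have hh := h_pos S
  rw [u, dif_neg]
  intro hc
  have h0 : (0 : ℚ) < S.h := by exact_mod_cast hh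
  rw [sub_le_iff_le_add, div_le_iff₀ h0] at hc
  have h1 : B.d j ≤ (k + 1) * S.h := by exact_mod_cast hc
  rw [mul_comm] at h1
  omega

lemma W_sub_mem : B.W - constLoop B.Poly S.cyclicElement ∈ B.fil B.Poly 0 := by
  intro j i hne
  rw [cf_W_sub] at hne
  by_contra h
  exact hne (B.u_of_lt (by rw [sub_add_cancel]; omega))

lemma cyclic_mem_fil (hn : 0 < n) : constLoop A S.cyclicElement ∈ B.fil A (-1) := by
  rw [← B.tau_cyclic hn]; exact B.tau_mem_fil _ _

include Λ in
lemma isDressingPair (hn : 0 < n) : B.IsDressingPair B.dressingPair := by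
  refine Classical.epsilon_spec ?_
  obtain ⟨U, K, f, g, hf, hU, hg, hK, hexp⟩ := LieFiltration.exists_dressing
    (F := B.filtration B.Poly) (B.cyclic_mem_fil hn) B.W_sub_mem
    (fun k => (S.kerPart B.Poly (-k)).restrictScalars ℂ)
    (fun k => (S.imPart B.Poly (-(k + 1))).restrictScalars ℂ)
    (fun k x hx => by simpa using B.span_le_fil _ _ hx)
    (fun k x hx => by simpa using B.span_le_fil _ _ hx)
    (fun k z hz => B.exists_decomposition Λ hn k hz)
  refine ⟨(U, K), ⟨f, hf, B.hasFormalSum_of_isSum hU⟩, ⟨g, hg, B.hasFormalSum_of_isSum hK⟩, ?_⟩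
  rw [B.isExpAd_iff (neg_mem hU.mem), hexp]

end Setup.HomogeneousBasis

end

/-! ### Dressing identities, resolvents and hamiltonians. -/

section

namespace Setup.HomogeneousBasis

variable {L : Type*} [LieRing L] [LieAlgebra ℂ L] [FiniteDimensional ℂ L]
  [LieAlgebra.IsSimple ℂ L] {H : LieSubalgebra ℂ L} [H.IsCartanSubalgebra] {n N : ℕ}
  {S : Setup H n} (B : S.HomogeneousBasis N) (Λ : S.KernelBasis)
  {A : Type*} [CommRing A] [Algebra ℂ A]

-- Bracketing `[x, I₊] = 0` with `F_k` shows that every simple root vanishes on `x`. Then `x`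
-- commutes with all `E_k`, so it is orthogonal to `h_k = [E_k, F_k]` and hence to `𝔤`.
include B in
lemma eq_zero_of_lie_of_mem_zero {x : L} (hx : x ∈ principalPart S.gen 0)
    (h : ⁅principalNilpotent S.gen, x⁆ = 0) : x = 0 := by
  have hxH := B.mem_cartan_of_mem hx
  have he : ∀ i, ⁅x, S.gen.e i⁆ = S.gen.baseSupp i ⟨x, hxH⟩ • S.gen.e i := fun i =>
    (S.gen.baseSupp_apply_smul_e i ⟨x, hxH⟩).symm
  have hzero : ∀ k, ⁅x, S.gen.e k⁆ = 0 := by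
    intro k
    rw [← lie_skew, neg_eq_zero, principalNilpotent, lie_sum] at h
    have h1 : ⁅∑ i, ⁅x, S.gen.e i⁆, S.gen.f k⁆ = S.gen.baseSupp k ⟨x, hxH⟩ • S.gen.h k := by
      rw [sum_lie, Finset.sum_eq_single k]
      · rw [he, smul_lie, (S.gen.sl2 k).lie_e_f]
      · intro i _ hik
        rw [he, smul_lie, S.gen.lie_e_f_ne i k hik, smul_zero]
      · simp
    rw [h, zero_lie] at h1
    rw [he, (smul_eq_zero.1 h1.symm).resolve_right (S.gen.linInd.ne_zero k), zero_smul]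
  refine S.eq_zero_of_form fun y => ?_
  refine B.induction (p := fun y => S.form x y = 0) (by simp)
    (fun y z hy hz => by rw [map_add, hy, hz, add_zero]) (fun k y hy => ?_) y
  by_cases hk : k = 0
  · subst hk
    have hspan : ∀ z ∈ Submodule.span ℂ (Set.range S.gen.h), S.form x z = 0 := by
      intro z hz
      induction hz using Submodule.span_induction with
      | mem y hy' =>
        obtain ⟨k, rfl⟩ := hy'
        rw [← (S.gen.sl2 k).lie_e_f, ← S.form_lie, hzero, map_zero, LinearMap.zero_apply]
      | zero => rw [map_zero]
      | add y z _ _ hy hz => rw [map_add, hy, hz, add_zero]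
      | smul c y _ hy => rw [map_smul, hy, smul_zero]
    have hyH : y ∈ H.toSubmodule := B.mem_cartan_of_mem hy
    rw [S.gen.coe_cartan_eq_span] at hyH
    exact hspan y hyH
  · exact S.form_eq_zero_of_degree hx hy (by omega)

-- If `m_a = 0`, the degrees in `ell a` are multiples of `h` strictly between `-h` and `h`. So `ell
-- a` has degree `0` and commutes with `I₊`; then it vanishes, against the Gram matrix.
include B Λ in
lemma exponent_pos (a : Fin n) : 0 < exponent S.gen a := by
  have hh := h_pos S
  by_contra h0
  have h0 : exponent S.gen a = 0 := by omega
  have hmem : B.ell Λ a ∈ principalPart S.gen 0 := by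
    refine B.mem_of_repr fun j hj => ?_
    by_contra hne
    obtain ⟨p, hp⟩ := B.ell_mem Λ a j hne
    rw [h0] at hp
    have h1 := B.d_lt j
    have h2 := B.neg_lt_d j
    have h3 : p ≠ 0 := by rintro rfl; rw [mul_zero] at hp; omega
    rcases lt_or_gt_of_ne h3 with h | h
    · have : (S.h : ℤ) * p ≤ S.h * (-1) := mul_le_mul_of_nonneg_left (by omega) (by omega)
      omega
    · have : (S.h : ℤ) * 1 ≤ S.h * p := mul_le_mul_of_nonneg_left (by omega) (by omega)
      omega
  have hlie := B.lie_proj_of_nonneg a.pos (B.lie_ell Λ a) le_rfl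
  rw [B.proj_of_mem hmem, if_pos (Set.mem_singleton _)] at hlie
  have h1 := B.form_ell Λ a a.rev
  rw [B.eq_zero_of_lie_of_mem_zero hmem hlie, map_zero, LinearMap.zero_apply, eta_eq, if_pos rfl,
    mul_one] at h1
  exact h_ne_zero S h1.symm

include B Λ in
lemma exponent_lt (a : Fin n) : (exponent S.gen a : ℤ) < S.h := by
  have h1 := B.exponent_add_rev Λ a
  have h2 := B.exponent_pos Λ a.rev
  omega

section Dressing

variable (hn : 0 < n)

include Λ hn in
lemma U_mem : B.dressingPair.1 ∈ B.fil B.Poly 1 := by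
  obtain ⟨⟨f, hf, hU⟩, -, -⟩ := B.isDressingPair Λ hn
  refine (B.isSum_of_hasFormalSum (j := 1) (fun k => ?_) hU).mem
  have := B.span_le_fil _ _ (hf k)
  rwa [neg_neg, add_comm] at this

include Λ hn in
lemma exists_isSum_H : ∃ g : ℕ → Loop B.Poly L,
    (∀ k, ⁅constLoop B.Poly S.cyclicElement, g k⁆ = 0) ∧
      (B.filtration B.Poly).IsSum 0 g B.dressingPair.2 := by
  obtain ⟨-, ⟨g, hg, hH⟩, -⟩ := B.isDressingPair Λ hn
  refine ⟨g, fun k => lie_kerPart (hg k), B.isSum_of_hasFormalSum (fun k => ?_) hH⟩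
  have := B.span_le_fil _ _ (hg k)
  rwa [neg_neg, ← zero_add (k : ℤ)] at this

include Λ hn in
lemma H_mem : B.dressingPair.2 ∈ B.fil B.Poly 0 := by
  obtain ⟨g, -, hg⟩ := B.exists_isSum_H Λ hn
  exact hg.mem

include Λ hn in
lemma cyclic_lie_H : ⁅constLoop B.Poly S.cyclicElement, B.dressingPair.2⁆ = 0 := by
  obtain ⟨g, hg0, hg⟩ := B.exists_isSum_H Λ hn
  refine (B.filtration B.Poly).eq_of_sub_mem (-1) fun K => ?_
  have := (B.filtration B.Poly).lie_mem (B.cyclic_mem_fil hn) (hg.2 K)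
  rw [lie_sub, lie_sum, Finset.sum_eq_zero fun k _ => hg0 k, zero_add] at this
  exact this

include Λ hn in
lemma exp_U : (B.filtration B.Poly).exp B.dressingPair.1
    (constLoop B.Poly S.cyclicElement + B.dressingPair.2) = B.W := by
  obtain ⟨-, -, h⟩ := B.isDressingPair Λ hn
  have hU := B.U_mem Λ hn
  rw [B.isExpAd_iff (neg_mem hU)] at h
  rw [h, LieFiltration.exp_exp_neg hU]

end Dressing

include B in
lemma eq_loopKerProj {x : Loop A L} (hn : 0 < n)
    (hx : ⁅constLoop A S.cyclicElement, x⁆ = 0) : x = loopKerProj A Λ x := by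
  obtain ⟨Ψ, -, h, -⟩ := B.exists_loopInverse Λ A hn
  have := h x
  rwa [hx, map_zero, add_zero] at this

-- `x` is a combination, over the series, of the mutually commuting `Λ_{m_b}`.
include B in
lemma lie_const_of_lie_cyclic {x : Loop A L} (hx : ⁅constLoop A S.cyclicElement, x⁆ = 0)
    (a : Fin n) : ⁅x, constLoop A (Λ.Λ a)⁆ = 0 := by
  rw [B.eq_loopKerProj Λ a.pos hx, loopKerProj_apply, sum_lie]
  exact Finset.sum_eq_zero fun b _ => by rw [smul_lie_loop, B.lie_const, smul_zero]

lemma resolvent_eq (a : Fin n) : B.resolvent Λ a =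
    (B.filtration B.Poly).exp B.dressingPair.1 (constLoop B.Poly (Λ.Λ a)) :=
  B.expAd_eq (B.U_mem Λ a.pos) _

lemma resolvent_mem (a : Fin n) : B.resolvent Λ a ∈ B.fil B.Poly (-exponent S.gen a) := by
  rw [resolvent_eq]
  exact LieFiltration.exp_mem (F := B.filtration B.Poly) (B.U_mem Λ a.pos) (B.const_mem_fil Λ a)

lemma form_resolvent (a b : Fin n) :
    loopForm B.Poly S.form (B.resolvent Λ a) (B.resolvent Λ b) =
      ((S.h : ℂ) * S.eta a b) • lam B.Poly 1 := by
  rw [resolvent_eq, resolvent_eq, B.form_exp_exp (B.U_mem Λ a.pos), B.form_const]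

lemma lie_resolvent (a b : Fin n) : ⁅B.resolvent Λ a, B.resolvent Λ b⁆ = 0 := by
  have hU := B.U_mem Λ a.pos
  rw [resolvent_eq, resolvent_eq, ← LieFiltration.exp_lie (F := B.filtration B.Poly) hU,
    B.lie_const, LieFiltration.exp_zero hU]

lemma W_lie_resolvent (a : Fin n) : ⁅B.W, B.resolvent Λ a⁆ = 0 := by
  have hU := B.U_mem Λ a.pos
  rw [resolvent_eq, ← B.exp_U Λ a.pos, ← LieFiltration.exp_lie (F := B.filtration B.Poly) hU,
    add_lie, cyclic_lie_const, B.lie_const_of_lie_cyclic Λ (B.cyclic_lie_H Λ a.pos), add_zero,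
    LieFiltration.exp_zero hU]

/-! ### The hamiltonians -/

/-- Pairing with `Λ_{m_b}` isolates one summand, so the expansion of `H` determines its
coefficients. This gives access to a family specified by `Classical.epsilon`. -/
lemma form_hamiltonianFamily {g : Fin n → ℕ → B.Poly} (hg : B.IsHamiltonianFamily Λ g)
    (b : Fin n) : loopForm B.Poly S.form B.dressingPair.2 (constLoop B.Poly (Λ.Λ b)) =
      Series.ofCoeffs (g b) := by
  rw [IsHamiltonianFamily] at hg
  rw [hg]
  simp only [map_sum, LinearMap.sum_apply]
  rw [Finset.sum_eq_single b.rev]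
  · rw [← algebraMap_smul (Series B.Poly) ((S.h : ℂ)⁻¹), map_smul, map_smul, LinearMap.smul_apply,
      LinearMap.smul_apply, B.form_const, eta_eq, Fin.rev_rev, if_pos rfl, mul_one,
      algebraMap_smul, smul_eq_mul, mul_smul_comm, smul_smul, inv_mul_cancel₀ (h_ne_zero S),
      one_smul, mul_right_comm, Series.lam_mul_lam, neg_add_cancel, Series.lam_zero, one_mul]
  · intro a _ ha
    rw [← algebraMap_smul (Series B.Poly) ((S.h : ℂ)⁻¹), map_smul, map_smul, LinearMap.smul_apply,
      LinearMap.smul_apply, B.form_const, eta_eq, if_neg, mul_zero, zero_smul, smul_zero, smul_zero]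
    rintro rfl
    exact ha (Fin.rev_rev a).symm
  · simp

/-- `(H|Λ_{m_b})` has degree at most `m_b < h`, so it contains no positive power of `λ`; this is why
the expansion of `H` starts at `k = -1`. -/
lemma coeff_form_H_eq_zero (b : Fin n) {i : ℤ} (hi : i < 0) : Series.coeff ℂ i
    (loopForm B.Poly S.form B.dressingPair.2 (constLoop B.Poly (Λ.Λ b))) = 0 := by
  refine B.coeff_form_eq_zero (B.H_mem Λ b.pos) (B.const_mem_fil Λ b) ?_
  have := B.exponent_lt Λ b
  have hh := h_pos S
  have : (S.h : ℤ) * i ≤ S.h * (-1) := mul_le_mul_of_nonneg_left (by omega) (by omega)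
  omega

lemma isHamiltonianFamily_coeff (hn : 0 < n) : B.IsHamiltonianFamily Λ fun b k =>
    Series.coeff ℂ (k : ℤ)
      (loopForm B.Poly S.form B.dressingPair.2 (constLoop B.Poly (Λ.Λ b))) := by
  have hs : ∀ b, Series.ofCoeffs (fun k : ℕ => Series.coeff ℂ (k : ℤ)
      (loopForm B.Poly S.form B.dressingPair.2 (constLoop B.Poly (Λ.Λ b)))) =
      loopForm B.Poly S.form B.dressingPair.2 (constLoop B.Poly (Λ.Λ b)) := by
    intro b
    ext i
    rw [Series.coeff_ofCoeffs]
    split_ifs with hi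
    · rw [Int.toNat_of_nonneg hi]
    · rw [B.coeff_form_H_eq_zero Λ b (by omega)]
  rw [IsHamiltonianFamily]
  simp only [hs]
  nth_rw 1 [B.eq_loopKerProj Λ hn (B.cyclic_lie_H Λ hn)]
  rw [loopKerProj_apply, ← Equiv.sum_comp Fin.revPerm]
  refine Finset.sum_congr rfl fun b _ => ?_
  rw [Fin.revPerm_apply, Fin.rev_rev, ← algebraMap_smul (Series B.Poly) ((S.h : ℂ)⁻¹), smul_smul,
    mul_assoc]

lemma hamiltonian_eq (b : Fin n) (k : ℕ) : B.hamiltonian Λ b k = Series.coeff ℂ (k + 1 : ℤ)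
    (loopForm B.Poly S.form B.dressingPair.2 (constLoop B.Poly (Λ.Λ b))) := by
  have h : B.IsHamiltonianFamily Λ (Classical.epsilon (B.IsHamiltonianFamily Λ)) :=
    Classical.epsilon_spec ⟨_, B.isHamiltonianFamily_coeff Λ b.pos⟩
  rw [B.form_hamiltonianFamily Λ h, Series.coeff_ofCoeffs, if_pos (by omega), hamiltonian]
  congr 1

/-! ### Derivations of the coefficients -/

/-- The coefficientwise action of a derivation. -/
def coeffDeriv (D : Derivation ℂ A A) : Loop A L →ₗ[ℂ] Loop A L :=
  loopMap (Series.mapCoeff fun _ => (D : A →ₗ[ℂ] A))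

lemma mapCoeff_derivation (D : Derivation ℂ A A) (s t : Series A) :
    Series.mapCoeff (fun _ => (D : A →ₗ[ℂ] A)) (s * t) =
      Series.mapCoeff (fun _ => (D : A →ₗ[ℂ] A)) s * t +
        s * Series.mapCoeff (fun _ => (D : A →ₗ[ℂ] A)) t :=
  Series.mapCoeff_mul _ (fun i j x y => by
    simp only [Derivation.coeFn_coe, Derivation.leibniz, smul_eq_mul]; ring) s t

lemma coeffDeriv_lie (D : Derivation ℂ A A) (x y : Loop A L) :
    coeffDeriv D ⁅x, y⁆ = ⁅coeffDeriv D x, y⁆ + ⁅x, coeffDeriv D y⁆ :=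
  loopMap_lie (mapCoeff_derivation D) x y

lemma cf_loopMap (δ : ℤ → A →ₗ[ℂ] A) (x : Loop A L) (j : Fin N) (i : ℤ) :
    B.cf j i (loopMap (Series.mapCoeff δ) x) = δ i (B.cf j i x) := by
  nth_rw 1 [← B.sum_coord x]
  rw [map_sum, map_sum, Finset.sum_eq_single j]
  · rw [loopMap_tmul, cf_tmul]; simp [cf_eq]
  · intro k _ hk; rw [loopMap_tmul, cf_tmul]; simp [hk]
  · simp

lemma loopMap_mem_fil (δ : ℤ → A →ₗ[ℂ] A) {k : ℤ} {x : Loop A L} (hx : x ∈ B.fil A k) :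
    loopMap (Series.mapCoeff δ) x ∈ B.fil A k := by
  intro j i h
  rw [cf_loopMap] at h
  exact hx j i fun h0 => h (by rw [h0, map_zero])

lemma cf_coeffDeriv (D : Derivation ℂ A A) (x : Loop A L) (j : Fin N) (i : ℤ) :
    B.cf j i (coeffDeriv D x) = D (B.cf j i x) := B.cf_loopMap _ x j i

include B in
lemma coeffDeriv_const (D : Derivation ℂ A A) (x : Loop ℂ L) :
    coeffDeriv D (constLoop A x) = 0 := by
  refine B.loop_ext fun j i => ?_
  rw [cf_coeffDeriv, ← B.sum_coord x, map_sum, map_sum, map_sum, map_zero]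
  refine Finset.sum_eq_zero fun k _ => ?_
  rw [constLoop_tmul, cf_tmul, D.map_smul, Series.coeff_constSeries, Derivation.map_algebraMap,
    smul_zero]

lemma coeff_form_deriv (D : Derivation ℂ A A) (x y : Loop A L) (i : ℤ) :
    D (Series.coeff ℂ i (loopForm A S.form x y)) =
      Series.coeff ℂ i (loopForm A S.form (coeffDeriv D x) y) +
        Series.coeff ℂ i (loopForm A S.form x (coeffDeriv D y)) := by
  rw [← map_add, coeffDeriv, ← loopMap_form (mapCoeff_derivation D)]
  rfl

/-- The variation of the dressing under a derivation of the coefficients. -/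
lemma exists_variation (hn : 0 < n) (D : Derivation ℂ B.Poly B.Poly) : ∃ Y : Loop B.Poly L,
    (∀ a, coeffDeriv D (B.resolvent Λ a) = ⁅Y, B.resolvent Λ a⁆) ∧
    coeffDeriv D B.W = (B.filtration B.Poly).exp B.dressingPair.1
      (coeffDeriv D B.dressingPair.2) + ⁅Y, B.W⁆ := by
  obtain ⟨Y, -, hY⟩ := LieFiltration.exists_derivation_exp (F := B.filtration B.Poly)
    (B.U_mem Λ hn) (coeffDeriv D) (coeffDeriv_lie D) (fun i x hx => B.loopMap_mem_fil _ hx)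
  refine ⟨Y, fun a => ?_, ?_⟩
  · rw [resolvent_eq, hY, B.coeffDeriv_const, LieFiltration.exp_zero (B.U_mem Λ hn), zero_add]
  · nth_rw 1 [← B.exp_U Λ hn]
    rw [hY, B.exp_U Λ hn, map_add, B.coeffDeriv_const, zero_add]

/-- The variation of the hamiltonians. -/
lemma deriv_hamiltonian (D : Derivation ℂ B.Poly B.Poly) (b : Fin n) (k : ℕ) :
    D (B.hamiltonian Λ b k) = Series.coeff ℂ (k + 1 : ℤ)
      (loopForm B.Poly S.form (coeffDeriv D B.W) (B.resolvent Λ b)) := by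
  obtain ⟨Y, -, hY⟩ := B.exists_variation Λ b.pos D
  -- `(DH|Λ_{m_b}) = (e^{ad_U} DH|R_b)`, and the remaining part `[Y, W]` of `DW` is orthogonal to
  -- `R_b` because `[W, R_b] = 0`.
  rw [hamiltonian_eq, coeff_form_deriv, B.coeffDeriv_const, map_zero, map_zero, add_zero, hY,
    map_add, LinearMap.add_apply, loopForm_lie S.form_lie, W_lie_resolvent, map_zero, add_zero,
    resolvent_eq, B.form_exp_exp (B.U_mem Λ b.pos)]

end Setup.HomogeneousBasis

end

/-! ### From the Poisson bracket to the Lax form of the flows. -/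

section

namespace Setup.HomogeneousBasis

variable {L : Type*} [LieRing L] [LieAlgebra ℂ L] [FiniteDimensional ℂ L]
  [LieAlgebra.IsSimple ℂ L] {H : LieSubalgebra ℂ L} [H.IsCartanSubalgebra] {n N : ℕ}
  {S : Setup H n} (B : S.HomogeneousBasis N) (Λ : S.KernelBasis)
  {A : Type*} [CommRing A] [Algebra ℂ A]

/-! ### The dual basis -/

lemma form_dual (i j : Fin N) : S.form (B.dual i) (B.e j) = if i = j then 1 else 0 := by
  have hdet : IsUnit (Matrix.of fun p q => S.form (B.e p) (B.e q)).det := by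
    rw [isUnit_iff_ne_zero]
    have := (LinearMap.BilinForm.nondegenerate_iff_det_ne_zero (B := S.form) B.e).1
      S.form_nondegenerate
    convert this using 2
    ext p q
    simp [LinearMap.BilinForm.toMatrix_apply]
  have h := congrFun (congrFun (Matrix.nonsing_inv_mul _ hdet) i) j
  rw [Matrix.one_apply, Matrix.mul_apply] at h
  rw [dual, map_sum, LinearMap.sum_apply, ← h]
  refine Finset.sum_congr rfl fun k _ => ?_
  rw [map_smul, LinearMap.smul_apply, smul_eq_mul, Matrix.of_apply]

lemma form_dual_right (x : L) (j : Fin N) : S.form x (B.dual j) = B.e.repr x j := by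
  nth_rw 1 [← B.e.sum_repr x]
  rw [map_sum, LinearMap.sum_apply, Finset.sum_eq_single j]
  · rw [S.form_comm, map_smul, form_dual, if_pos rfl, smul_eq_mul, mul_one]
  · intro k _ hk
    rw [S.form_comm, map_smul, form_dual, if_neg (Ne.symm hk), smul_zero]
  · simp

lemma structureConst_eq (i j k : Fin N) :
    B.structureConst i j k = -B.e.repr ⁅B.e k, B.dual j⁆ i := by
  rw [structureConst, S.form_lie, S.form_comm, form_dual_right, ← lie_skew, map_neg]
  rfl

/-- `ad E_{-θ}` lowers degrees by `h - 1` and so lands in degrees at most `0`. This matches the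
absence of `u^j_{-1}` for `d_j > 0`. -/
lemma repr_lie_Eneg (hn : 0 < n) (v : L) {j : Fin N} (hj : 0 < B.d j) :
    B.e.repr ⁅v, S.Eneg⁆ j = 0 := by
  rw [← B.e.sum_repr v, sum_lie, map_sum, Finsupp.coe_finsetSum, Finset.sum_apply]
  refine Finset.sum_eq_zero fun k _ => ?_
  rw [smul_lie, map_smul, Finsupp.smul_apply,
    B.repr_eq_zero (lie_mem_principalPart (B.mem k) (B.Eneg_mem hn)), smul_zero]
  have := B.d_lt k
  omega

lemma coeff_form_dual (x : Loop A L) (j : Fin N) (i : ℤ) :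
    Series.coeff ℂ i (loopForm A S.form x ((1 : Series A) ⊗ₜ B.dual j)) = B.cf j i x := by
  rw [← B.sum_coord x]
  simp only [map_sum, LinearMap.sum_apply]
  refine Finset.sum_congr rfl fun k _ => ?_
  rw [loopForm_tmul, mul_one, map_smul, form_dual_right, cf_tmul]

lemma cf_lie_tmul (x : Loop A L) (v : L) (j : Fin N) (i : ℤ) :
    B.cf j i ⁅x, (1 : Series A) ⊗ₜ[ℂ] v⁆ = ∑ k, B.e.repr ⁅B.e k, v⁆ j • B.cf k i x := by
  nth_rw 1 [← B.sum_coord x]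
  rw [sum_lie, map_sum]
  refine Finset.sum_congr rfl fun k _ => ?_
  rw [LieAlgebra.ExtendScalars.bracket_tmul, mul_one, cf_tmul]
  rfl

/-! ### Truncations -/

/-- The part with negative powers of `λ`. -/
def negPart (x : Loop A L) : Loop A L :=
  loopMap (Series.mapCoeff fun i => if 1 ≤ i then LinearMap.id else 0) x

/-- The part with nonnegative powers of `λ`. -/
def nonnegPart (x : Loop A L) : Loop A L :=
  loopMap (Series.mapCoeff fun i => if 1 ≤ i then 0 else LinearMap.id) x

lemma cf_negPart (x : Loop A L) (j : Fin N) (i : ℤ) :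
    B.cf j i (negPart x) = if 1 ≤ i then B.cf j i x else 0 := by
  rw [negPart, cf_loopMap]; split_ifs <;> rfl

lemma cf_nonnegPart (x : Loop A L) (j : Fin N) (i : ℤ) :
    B.cf j i (nonnegPart x) = if 1 ≤ i then 0 else B.cf j i x := by
  rw [nonnegPart, cf_loopMap]; split_ifs <;> rfl

include B in
lemma nonnegPart_add_negPart (x : Loop A L) : nonnegPart x + negPart x = x := by
  refine B.loop_ext fun j i => ?_
  rw [map_add, cf_negPart, cf_nonnegPart]
  split_ifs <;> simp

lemma cf_lie_negPart (x y : Loop A L) (j : Fin N) : B.cf j 1 ⁅negPart x, negPart y⁆ = 0 := by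
  by_contra h
  obtain ⟨p, i₁, q, i₂, h1, -, h3, h4⟩ := B.exists_of_cf_lie_ne_zero h
  rw [cf_negPart] at h3 h4
  split_ifs at h3 h4 with h5 h6
  · omega
  all_goals contradiction

lemma cf_lie_nonnegPart (x y : Loop A L) (j : Fin N) :
    B.cf j 1 ⁅nonnegPart x, nonnegPart y⁆ = 0 := by
  by_contra h
  obtain ⟨p, i₁, q, i₂, h1, -, h3, h4⟩ := B.exists_of_cf_lie_ne_zero h
  rw [cf_nonnegPart] at h3 h4
  split_ifs at h3 h4 with h5 h6
  any_goals contradiction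
  omega

/-- The residue of a bracket vanishes when both arguments have only negative powers (it starts at
`λ^{-2}`), or both only nonnegative ones. -/
lemma cf_lie_negPart_comm {x y : Loop A L} (h : ⁅x, y⁆ = 0) (j : Fin N) :
    B.cf j 1 ⁅x, negPart y⁆ = -B.cf j 1 ⁅negPart x, y⁆ := by
  have h1 : ⁅x, negPart y⁆ = ⁅nonnegPart x, y⁆ - ⁅nonnegPart x, nonnegPart y⁆ +
      ⁅negPart x, negPart y⁆ := by
    have hy : negPart y = y - nonnegPart y := by
      rw [eq_sub_iff_add_eq, add_comm, B.nonnegPart_add_negPart]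
    rw [← lie_sub, ← hy, ← add_lie, B.nonnegPart_add_negPart]
  have h2 : ⁅nonnegPart x, y⁆ = -⁅negPart x, y⁆ := by
    rw [eq_neg_iff_add_eq_zero, ← add_lie, B.nonnegPart_add_negPart, h]
  rw [h1, map_add, map_sub, cf_lie_nonnegPart, cf_lie_negPart, h2, map_neg, sub_zero, add_zero]

/-! ### The flows -/

lemma u_of_le {j : Fin N} {k : ℤ} (h : B.d j ≤ S.h * (k + 1)) :
    ∃ hk, B.u j k = MvPolynomial.X ⟨(j, k), hk⟩ := by
  have h0 : (0 : ℚ) < S.h := by exact_mod_cast h_pos S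
  have hk : (B.d j : ℚ) / S.h - 1 ≤ (k : ℚ) := by
    rw [sub_le_iff_le_add, div_le_iff₀ h0, mul_comm]
    exact_mod_cast h
  exact ⟨hk, by rw [u, dif_pos hk]⟩

lemma cf_cyclic (j : Fin N) (i : ℤ) : B.cf j i (constLoop A S.cyclicElement) =
    B.e.repr (principalNilpotent S.gen) j • (if i = 0 then 1 else 0) +
      B.e.repr S.Eneg j • (if i = -1 then 1 else 0) := by
  rw [cyclicElement, map_add, constLoop_tmul, constLoop_tmul, ← Series.lam_zero,
    Series.constSeries_lam, Series.constSeries_lam, map_add, cf_tmul, cf_tmul, Series.coeff_lam,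
    Series.coeff_lam, neg_zero]

lemma cf_W (j : Fin N) (i : ℤ) : B.cf j i B.W =
    B.cf j i (constLoop B.Poly S.cyclicElement) + B.u j (i - 1) := by
  rw [← cf_W_sub, map_sub, add_sub_cancel]

lemma cf_deriv_W (D : Derivation ℂ B.Poly B.Poly) (j : Fin N) (i : ℤ) :
    B.cf j i (coeffDeriv D B.W) = D (B.u j (i - 1)) := by
  have h := congrArg (fun x => B.cf j i (coeffDeriv D x))
    (sub_add_cancel B.W (constLoop B.Poly S.cyclicElement))
  simp only [map_add, B.coeffDeriv_const, add_zero] at h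
  rw [← h, cf_coeffDeriv, cf_W_sub]

/-- The derivation `{·, u^j_s}`. -/
def bracketWith (y : B.Index) : Derivation ℂ B.Poly B.Poly :=
  MvPolynomial.mkDerivation ℂ fun x => B.genBracket x y

lemma poisson_X (f : B.Poly) (y : B.Index) :
    B.poisson f (MvPolynomial.X y) = B.bracketWith y f := by
  rw [poisson, MvPolynomial.mkDerivation_X]; rfl

/-- `{W(λ), u^j_s} = [(λ^s W)_-, e^j]` for `s ≥ 0`: the truncation appears because the bracket with
`u^j_s` is nonzero only on `u^i_r` with `r ≥ 0`. -/
lemma bracketWith_W_of_nonneg {j : Fin N} {s : ℤ} (hs : 0 ≤ s) (hk) :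
    coeffDeriv (B.bracketWith ⟨(j, s), hk⟩) B.W =
      ⁅negPart (lam B.Poly s • B.W), (1 : Series B.Poly) ⊗ₜ[ℂ] B.dual j⁆ := by
  refine B.loop_ext fun i r => ?_
  have hh := h_pos S
  have hd := B.d_lt i
  have hd' := B.neg_lt_d i
  rw [cf_deriv_W, cf_lie_tmul]
  simp only [cf_negPart, cf_lam_smul]
  split_ifs with hr
  · obtain ⟨hk', hu⟩ := B.u_of_le (j := i) (k := r - 1) (by
      have : (S.h : ℤ) * 1 ≤ S.h * (r - 1 + 1) := mul_le_mul_of_nonneg_left (by omega) (by omega)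
      omega)
    rw [hu, bracketWith, MvPolynomial.mkDerivation_X, genBracket,
      if_pos ⟨by simp only; omega, hs⟩, ← Finset.sum_neg_distrib]
    refine Finset.sum_congr rfl fun k _ => ?_
    rw [structureConst_eq, neg_smul, neg_neg, cf_W, cf_cyclic, if_neg (by omega),
      if_neg (by omega), smul_zero, smul_zero, add_zero, zero_add]
    congr 2
    simp only
    omega
  · simp only [smul_zero, Finset.sum_const_zero]
    by_cases hi : B.d i ≤ S.h * (r - 1 + 1)
    · obtain ⟨hk', hu⟩ := B.u_of_le hi
      rw [hu, bracketWith, MvPolynomial.mkDerivation_X, genBracket, if_neg, if_neg]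
      · simp only; omega
      · simp only; omega
    · rw [B.u_of_lt (by omega), map_zero]

/-- For `u^j_{-1}` only the constant term `([e^i, e^j]|E_{-θ})` of the Poisson bracket survives. -/
lemma bracketWith_W_neg_one (hn : 0 < n) {j : Fin N} (hk) :
    coeffDeriv (B.bracketWith ⟨(j, -1), hk⟩) B.W =
      (1 : Series B.Poly) ⊗ₜ[ℂ] ⁅B.dual j, S.Eneg⁆ := by
  refine B.loop_ext fun i r => ?_
  have hh := h_pos S
  have hd := B.d_lt i
  have hd' := B.neg_lt_d i
  rw [cf_deriv_W, cf_tmul, Series.coeff_one]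
  by_cases hi : B.d i ≤ S.h * (r - 1 + 1)
  · obtain ⟨hk', hu⟩ := B.u_of_le hi
    rw [hu, bracketWith, MvPolynomial.mkDerivation_X, genBracket, if_neg (by simp only; omega)]
    by_cases hr : r = 0
    · rw [if_pos ⟨by simp only; omega, rfl⟩, if_pos hr, S.form_lie, S.form_comm, form_dual_right,
        ← MvPolynomial.algebraMap_eq, Algebra.algebraMap_eq_smul_one]
    · rw [if_neg (by simp only; omega), if_neg hr, smul_zero]
  · rw [B.u_of_lt (by omega), map_zero]
    split_ifs with hr
    · subst hr
      rw [B.repr_lie_Eneg hn _ (by simpa using hi), zero_smul]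
    · rw [smul_zero]

/-- The coefficient of `λ^{-m-1}` in `({W, y}|R_b)`, written as a residue. -/
lemma flow_X (b : Fin n) (m : ℕ) (y : B.Index) :
    B.flow Λ b m (MvPolynomial.X y) = Series.coeff ℂ 1 (loopForm B.Poly S.form
      (coeffDeriv (B.bracketWith y) B.W) (lam B.Poly m • B.resolvent Λ b)) := by
  rw [flow, poisson_X, deriv_hamiltonian, map_smul, smul_eq_mul, Series.coeff_lam_mul, add_comm]

/-- The only positive power of `λ` in `W` is in `λ E_{-θ}`, and the rest of `W` cannot raise a
negative power to `λ^0`. -/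
lemma cf_zero_lie_W (x : Loop B.Poly L) (j : Fin N) : B.cf j 0 ⁅negPart x, B.W⁆ =
    B.cf j 1 ⁅x, (1 : Series B.Poly) ⊗ₜ[ℂ] S.Eneg⁆ := by
  have hh := h_pos S
  set E : Loop B.Poly L := (1 : Series B.Poly) ⊗ₜ[ℂ] S.Eneg with hE
  have h1 : B.cf j 0 ⁅negPart x, B.W - lam B.Poly 1 • E⁆ = 0 := by
    by_contra h
    obtain ⟨p, i₁, q, i₂, h1, -, h3, h4⟩ := B.exists_of_cf_lie_ne_zero h
    rw [cf_negPart] at h3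
    split_ifs at h3 with h5
    · have hq := B.neg_lt_d q
      have hlt : (S.h : ℤ) * i₂ ≤ S.h * (-1) := mul_le_mul_of_nonneg_left (by omega) (by omega)
      rw [map_sub, cf_lam_smul, hE, cf_tmul, Series.coeff_one, cf_W, cf_cyclic,
        if_neg (by omega), smul_zero, zero_add, B.u_of_lt (by rw [sub_add_cancel]; omega),
        add_zero, if_congr (show i₂ + 1 = 0 ↔ i₂ = -1 by omega) rfl rfl, sub_self] at h4
      exact h4 rfl
    · exact h3 rfl
  rw [lie_sub, map_sub, sub_eq_zero, lie_smul_loop, cf_lam_smul] at h1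
  rw [h1, hE, zero_add, cf_lie_tmul, cf_lie_tmul]
  simp only [cf_negPart, le_refl, if_true]

/-- The flows in Lax form. -/
lemma flow_W (b : Fin n) (m : ℕ) : coeffDeriv (B.flow Λ b m) B.W =
    -⁅negPart (lam B.Poly m • B.resolvent Λ b), B.W⁆ := by
  have hn := b.pos
  have hh := h_pos S
  set X := lam B.Poly m • B.resolvent Λ b with hX
  have hXW : ∀ s : ℤ, ⁅X, lam B.Poly s • B.W⁆ = 0 := by
    intro s
    rw [lie_smul_loop, hX, smul_lie_loop, ← lie_skew, W_lie_resolvent, neg_zero, smul_zero,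
      smul_zero]
  refine B.loop_ext fun j i => ?_
  have hd := B.d_lt j
  have hd' := B.neg_lt_d j
  rw [cf_deriv_W, map_neg]
  rcases lt_trichotomy i 0 with hi | hi | hi
  · have hlt : (S.h : ℤ) * i ≤ S.h * (-1) := mul_le_mul_of_nonneg_left (by omega) (by omega)
    rw [B.u_of_lt (by rw [sub_add_cancel]; omega), map_zero, zero_eq_neg]
    by_contra h
    obtain ⟨p, i₁, q, i₂, h1, -, h3, h4⟩ := B.exists_of_cf_lie_ne_zero h
    rw [cf_negPart] at h3
    split_ifs at h3 with h5
    · have hq := B.neg_lt_d q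
      have hlt2 : (S.h : ℤ) * i₂ ≤ S.h * (-2) := mul_le_mul_of_nonneg_left (by omega) (by omega)
      rw [cf_W, cf_cyclic, if_neg (by omega), if_neg (by omega),
        B.u_of_lt (by rw [sub_add_cancel]; omega)] at h4
      simp at h4
    · exact h3 rfl
  · subst hi
    have hlie : B.cf j 0 ⁅negPart X, B.W⁆ =
        B.cf j 1 ⁅X, (1 : Series B.Poly) ⊗ₜ[ℂ] S.Eneg⁆ := B.cf_zero_lie_W X j
    rw [hlie]
    by_cases hj : B.d j ≤ 0
    · obtain ⟨hk, hu⟩ := B.u_of_le (j := j) (k := 0 - 1) (by simpa using hj)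
      rw [hu, flow_X, ← hX]
      have h0 : (⟨(j, 0 - 1), hk⟩ : B.Index) = ⟨(j, -1), by simpa using hk⟩ := by
        simp
      rw [h0, bracketWith_W_neg_one B hn, loopForm_comm S.form_comm, ← lie_skew,
        TensorProduct.tmul_neg, map_neg, map_neg]
      have h2 : (1 : Series B.Poly) ⊗ₜ[ℂ] ⁅S.Eneg, B.dual j⁆ =
          ⁅(1 : Series B.Poly) ⊗ₜ[ℂ] S.Eneg, (1 : Series B.Poly) ⊗ₜ[ℂ] B.dual j⁆ := by
        rw [LieAlgebra.ExtendScalars.bracket_tmul, mul_one]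
      rw [h2, ← loopForm_lie S.form_lie, coeff_form_dual]
    -- For `d_j > 0` there is no `u^j_{-1}`, and the right-hand side vanishes for degree reasons.
    · rw [B.u_of_lt (by simpa using hj), map_zero, zero_eq_neg, cf_lie_tmul]
      exact Finset.sum_eq_zero fun k _ => by rw [B.repr_lie_Eneg hn _ (by omega), zero_smul]
  · obtain ⟨hk, hu⟩ := B.u_of_le (j := j) (k := i - 1) (by
      have : (S.h : ℤ) * 1 ≤ S.h * (i - 1 + 1) := mul_le_mul_of_nonneg_left (by omega) (by omega)
      omega)
    -- The residue of `[X, (λ^s W)_-]`, with `s = i - 1`, is minus that of `[X_-, λ^s W]` because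
    -- `X` and `W` commute; the latter is the coefficient of `λ^{-i}` in `[X_-, W]`.
    rw [hu, flow_X, ← hX, B.bracketWith_W_of_nonneg (by omega), loopForm_comm S.form_comm,
      ← loopForm_lie S.form_lie, coeff_form_dual, B.cf_lie_negPart_comm (hXW _), lie_smul_loop,
      cf_lam_smul, add_sub_cancel]

/-- The flows of the basic resolvents. -/
lemma flow_resolvent (a b : Fin n) (m : ℕ) : coeffDeriv (B.flow Λ b m) (B.resolvent Λ a) =
    -⁅negPart (lam B.Poly m • B.resolvent Λ b), B.resolvent Λ a⁆ := by
  have hn := b.pos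
  have hU := B.U_mem Λ hn
  have hU' : -B.dressingPair.1 ∈ B.fil B.Poly 1 := neg_mem hU
  obtain ⟨Y, hR, hW⟩ := B.exists_variation Λ hn (B.flow Λ b m)
  set F := B.filtration B.Poly with hF
  set X := negPart (lam B.Poly m • B.resolvent Λ b) with hX
  -- `Y + X` measures how far the variation of the dressing is from the desired `-X`. The goal is
  -- that it commutes with `R_a`, equivalently that `Z` commutes with `Λ_{m_a}`.
  set Z := F.exp (-B.dressingPair.1) (Y + X) with hZ
  have hYX : F.exp B.dressingPair.1 Z = Y + X := LieFiltration.exp_exp_neg (F := F) hU _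
  have hDH : coeffDeriv (B.flow Λ b m) B.dressingPair.2 =
      -⁅Z, constLoop B.Poly S.cyclicElement + B.dressingPair.2⁆ := by
    rw [← LieFiltration.exp_neg_exp (F := F) hU (coeffDeriv (B.flow Λ b m) B.dressingPair.2),
      ← LieFiltration.exp_neg_exp (F := F) hU (-⁅Z, _⁆), LieFiltration.exp_neg hU,
      LieFiltration.exp_lie hU, hYX, B.exp_U Λ hn, add_lie]
    rw [flow_W, ← sub_eq_iff_eq_add] at hW
    rw [← hW]
    congr 1
    abel
  -- Differentiate `[Λ, H] = 0` and insert `dH = -[Z, Λ + H]`.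
  have h0 : ⁅constLoop B.Poly S.cyclicElement,
      ⁅Z, constLoop B.Poly S.cyclicElement + B.dressingPair.2⁆⁆ = 0 := by
    have h1 := coeffDeriv_lie (B.flow Λ b m) (constLoop B.Poly S.cyclicElement) B.dressingPair.2
    rw [B.cyclic_lie_H Λ hn, map_zero, B.coeffDeriv_const, zero_lie, zero_add, hDH, lie_neg,
      zero_eq_neg] at h1
    exact h1
  obtain ⟨Ψ, h1, h2, h3⟩ := B.exists_loopInverse Λ B.Poly hn
  have hΛZ := LieFiltration.lie_eq_zero_of_lie_lie (F := F) (B.H_mem Λ hn) (B.cyclic_lie_H Λ hn)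
    (loopKerProj B.Poly Λ) Ψ h2 (loopKerProj_lie Λ) h3 h0
  have h4 : ⁅Y + X, B.resolvent Λ a⁆ = 0 := by
    rw [← hYX, resolvent_eq, ← LieFiltration.exp_lie (F := F) hU,
      B.lie_const_of_lie_cyclic Λ hΛZ, LieFiltration.exp_zero hU]
  rw [hR, eq_neg_iff_add_eq_zero, ← add_lie, h4]

end Setup.HomogeneousBasis

end

/-! ### Division by `λ - μ` and by the Vandermonde product. -/

section

section MulDiff

variable {A : Type*} [CommRing A]

/-- The equation makes `F` constant along `i + j = const`, and `F` vanishes far out on each such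
line. A bound in one variable suffices. -/
lemma eq_zero_of_mulDiff {F : Series₂ A} {a : ℤ} (hF : ∀ i, a < i → ∀ j, F i j = 0)
    (h : mulDiff F = 0) : F = 0 := by
  have key : ∀ k : ℕ, ∀ i, a < i + k → ∀ j, F i j = 0 := by
    intro k
    induction k with
    | zero => intro i hi; exact hF i (by simpa using hi)
    | succ k ih =>
      intro i hi j
      have h1 := congrFun (congrFun h (i + 1)) j
      simp only [mulDiff, add_sub_cancel_right, Pi.zero_apply, sub_eq_zero] at h1
      rw [h1]
      exact ih (i + 1) (by push_cast at hi; omega) _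
  funext i j
  exact key (a - i + 1).toNat i (by omega) j

lemma mulDiff_sub (F G : Series₂ A) : mulDiff (F - G) = mulDiff F - mulDiff G := by
  funext i j
  simp only [mulDiff, Pi.sub_apply]
  ring

lemma mulDiff_eq_zero_of_lt {F : Series₂ A} {a : ℤ} (hF : ∀ i, a < i → ∀ j, F i j = 0) :
    ∀ i, a + 1 < i → ∀ j, mulDiff F i j = 0 := by
  intro i hi j
  rw [mulDiff, hF _ (by omega), hF _ (by omega), sub_zero]

lemma negSeries_eq_zero (w : ℕ → ℕ → A) : ∀ i, -1 < i → ∀ j, negSeries w i j = 0 :=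
  fun i hi j => if_neg fun h => by omega

lemma negSeries_apply (w : ℕ → ℕ → A) (k l : ℕ) : negSeries w (-k - 1) (-l - 1) = w k l := by
  rw [negSeries, if_pos ⟨by omega, by omega⟩]
  congr 1 <;> omega

lemma negSeries_injective {w w' : ℕ → ℕ → A} (h : negSeries w = negSeries w') : w = w' := by
  funext k l
  rw [← negSeries_apply w, h, negSeries_apply]

lemma eq_of_mulDiff_mulDiff {w w' : ℕ → ℕ → A}
    (h : mulDiff (mulDiff (negSeries w)) = mulDiff (mulDiff (negSeries w'))) : w = w' := by
  refine negSeries_injective (sub_eq_zero.1 ?_)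
  have h0 : ∀ i, -1 < i → ∀ j, (negSeries w - negSeries w') i j = 0 := by
    intro i hi j
    rw [Pi.sub_apply, Pi.sub_apply, negSeries_eq_zero w i hi, negSeries_eq_zero w' i hi, sub_zero]
  refine eq_zero_of_mulDiff h0 (eq_zero_of_mulDiff (mulDiff_eq_zero_of_lt h0) ?_)
  rw [mulDiff_sub, mulDiff_sub, h, sub_self]

/-- The quotient of a series by `λ - μ`. -/
def divDiff (a : ℤ) (F : Series₂ A) : Series₂ A :=
  fun i j => ∑ p ∈ Finset.Ioc i a, F p (i + j + 1 - p)

lemma mulDiff_divDiff {a : ℤ} {F : Series₂ A} (hF : ∀ i, a < i → ∀ j, F i j = 0) :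
    mulDiff (divDiff a F) = F := by
  funext i j
  rw [mulDiff, divDiff, divDiff]
  have h1 : ∀ p, i - 1 + j + 1 - p = i + j - p := fun p => by ring
  have h2 : ∀ p, i + (j - 1) + 1 - p = i + j - p := fun p => by ring
  simp only [h1, h2]
  by_cases hi : i ≤ a
  · have : Finset.Ioc (i - 1) a = insert i (Finset.Ioc i a) := by
      ext p; simp only [Finset.mem_Ioc, Finset.mem_insert]; omega
    rw [this, Finset.sum_insert (by simp), add_sub_cancel_right, add_sub_cancel_left]
  · rw [hF i (by omega), Finset.Ioc_eq_empty (by omega), Finset.Ioc_eq_empty (by omega)]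
    simp

lemma divDiff_eq_zero_left (a : ℤ) (F : Series₂ A) : ∀ i, a - 1 < i → ∀ j, divDiff a F i j = 0 := by
  intro i hi j
  rw [divDiff, Finset.Ioc_eq_empty (by omega), Finset.sum_empty]

/-- For large powers of `μ` the partial antidiagonal sum becomes a complete one, a coefficient of
`F(λ, λ)`. So vanishing on the diagonal bounds the quotient in `μ` as well. -/
lemma divDiff_eq_zero_right {a b : ℤ} {F : Series₂ A} (hF : ∀ i j, b < j → F i j = 0)
    (hs : ∀ s, ∑ p ∈ Finset.Icc (s - b) a, F p (s - p) = 0) :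
    ∀ i j, b - 1 < j → divDiff a F i j = 0 := by
  intro i j hj
  rw [divDiff, ← hs (i + j + 1)]
  symm
  refine Finset.sum_subset (fun p hp => ?_) fun p hp hp' => hF _ _ ?_
  · simp only [Finset.mem_Icc, Finset.mem_Ioc] at hp ⊢; omega
  · simp only [Finset.mem_Icc, Finset.mem_Ioc] at hp hp'; omega

/-- On the diagonal the quotient equals the derivative of `F` in `λ`; exchanging the summations
produces the weight `p` of `hs'`. -/
lemma sum_divDiff {a b : ℤ} {F : Series₂ A}
    (hs : ∀ s, ∑ p ∈ Finset.Icc (s - b) a, F p (s - p) = 0)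
    (hs' : ∀ s, ∑ p ∈ Finset.Icc (s - b) a, (p : A) * F p (s - p) = 0) (s : ℤ) :
    ∑ i ∈ Finset.Icc (s - (b - 1)) (a - 1), divDiff a F i (s - i) = 0 := by
  simp only [divDiff]
  rw [Finset.sum_comm' (s' := fun p => Finset.Ico (s + 1 - b) p) (t' := Finset.Icc (s + 1 - b) a)]
  · have h1 : ∀ p ∈ Finset.Icc (s + 1 - b) a,
        ∑ i ∈ Finset.Ico (s + 1 - b) p, F p (i + (s - i) + 1 - p) =
          (p : A) * F p (s + 1 - p) - ((s + 1 - b : ℤ) : A) * F p (s + 1 - p) := by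
      intro p hp
      have hp' := (Finset.mem_Icc.1 hp).1
      rw [← sub_mul]
      simp only [add_sub_cancel, Finset.sum_const, Int.card_Ico]
      rw [nsmul_eq_mul, ← Int.cast_sub]
      congr 1
      rw [← Int.cast_natCast, Int.toNat_of_nonneg (by omega)]
    rw [Finset.sum_congr rfl h1, Finset.sum_sub_distrib, hs', ← Finset.mul_sum, hs, mul_zero,
      sub_zero]
  · intro i p
    simp only [Finset.mem_Icc, Finset.mem_Ioc, Finset.mem_Ico]
    omega

lemma exists_negSeries {F : Series₂ A} (h : ∀ i j, -1 < i ∨ -1 < j → F i j = 0) :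
    ∃ w, negSeries w = F := by
  refine ⟨fun k l => F (-k - 1) (-l - 1), ?_⟩
  funext i j
  rw [negSeries]
  split_ifs with hij
  · congr 1 <;> omega
  · rw [h i j (by omega)]

/-- `hs` and `hs'` say that `F` and `λ∂_λ F` vanish on the diagonal. Each division lowers both
bounds on the powers by one, from `1` to `-1`. -/
lemma exists_mulDiff_mulDiff {F : Series₂ A} (h1 : ∀ i, 1 < i → ∀ j, F i j = 0)
    (h2 : ∀ i j, 1 < j → F i j = 0)
    (hs : ∀ s, ∑ p ∈ Finset.Icc (s - 1) 1, F p (s - p) = 0)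
    (hs' : ∀ s, ∑ p ∈ Finset.Icc (s - 1) 1, ((p : ℤ) : A) * F p (s - p) = 0) :
    ∃ w, mulDiff (mulDiff (negSeries w)) = F := by
  have h3 := divDiff_eq_zero_left 1 F
  have h4 := divDiff_eq_zero_right h2 hs
  have h5 := sum_divDiff hs hs'
  have h6 := divDiff_eq_zero_left (1 - 1) (divDiff 1 F)
  have h7 := divDiff_eq_zero_right h4 h5
  obtain ⟨w, hw⟩ := exists_negSeries (F := divDiff (1 - 1) (divDiff 1 F)) fun i j hij => by
    rcases hij with h | h
    · exact h6 i (by omega) j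
    · exact h7 i j (by omega)
  exact ⟨w, by rw [hw, mulDiff_divDiff h3, mulDiff_divDiff h1]⟩

/-- Multiplication by `(ν - λ) (ν - μ) (λ - μ)` of a series in `ν, λ, μ`. -/
def mulVandermonde (F : ℤ → ℤ → ℤ → A) : ℤ → ℤ → ℤ → A := fun p i j =>
  (F (p - 2) (i - 1) j - F (p - 2) i (j - 1)) - (F (p - 1) (i - 2) j - F (p - 1) i (j - 2)) +
    (F p (i - 2) (j - 1) - F p (i - 1) (j - 2))

lemma mulVandermonde_eq (F : ℤ → ℤ → ℤ → A) (p i j : ℤ) : mulVandermonde F p i j =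
    mulDiff (F (p - 2)) i j - mulDiff (F (p - 1)) (i - 1) j - mulDiff (F (p - 1)) i (j - 1) +
      mulDiff (F p) (i - 1) (j - 1) := by
  simp only [mulVandermonde, mulDiff, sub_sub]
  norm_num
  ring

/-- The factors `ν - μ`, `ν - λ` and `λ - μ` are cancelled in this order, using the bound in `ν`
twice and then the bound in `λ`. -/
lemma eq_zero_of_mulVandermonde {F : ℤ → ℤ → ℤ → A} {a : ℤ} (hp : ∀ p, a < p → F p = 0)
    (hi : ∀ p i, a < i → ∀ j, F p i j = 0) (h : mulVandermonde F = 0) : F = 0 := by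
  have h1 : ∀ i, mulDiff (fun p j => mulDiff (F (p - 1)) i j - mulDiff (F p) (i - 1) j) =
      fun p j => mulVandermonde F p i j := by
    intro i
    funext p j
    rw [mulVandermonde_eq]
    simp only [mulDiff, sub_sub]
    norm_num
    ring
  have h0 : ∀ p, a < p → ∀ i j, mulDiff (F p) i j = 0 := by
    intro p hpa i j
    rw [hp p hpa]; simp [mulDiff]
  have h2 : ∀ i, (fun p j => mulDiff (F (p - 1)) i j - mulDiff (F p) (i - 1) j) = 0 := by
    intro i
    refine eq_zero_of_mulDiff (a := a + 1) (fun p hpa j => ?_) ?_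
    · rw [h0 _ (by omega), h0 _ (by omega), sub_zero]
    · rw [h1, h]; rfl
  have h3 : ∀ j, (fun p i => mulDiff (F p) i j) = 0 := by
    intro j
    refine eq_zero_of_mulDiff (a := a) (fun p hpa i => h0 p hpa i j) ?_
    funext p i
    exact congrFun (congrFun (h2 i) p) j
  funext p
  refine eq_zero_of_mulDiff (a := a) (fun i hia => hi p i hia) ?_
  funext i j
  exact congrFun (congrFun (h3 j) p) i

end MulDiff

end

/-! ### Existence, uniqueness and symmetry of the two-point functions. -/

section

namespace Setup.HomogeneousBasis

variable {L : Type*} [LieRing L] [LieAlgebra ℂ L] [FiniteDimensional ℂ L]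
  [LieAlgebra.IsSimple ℂ L] {H : LieSubalgebra ℂ L} [H.IsCartanSubalgebra] {n N : ℕ}
  {S : Setup H n} (B : S.HomogeneousBasis N) (Λ : S.KernelBasis)
  {A : Type*} [CommRing A] [Algebra ℂ A]

/-- `R_a` has degree at most `m_a < h` and `𝔤` has degrees above `-h`, so no power beyond `λ^1` can
occur. -/
lemma coeffAt_resolvent (a : Fin n) {i : ℤ} (hi : i < -1) : coeffAt i (B.resolvent Λ a) = 0 := by
  have h0 : coeffAt i (B.resolvent Λ a) = coeffAt i (0 : Loop B.Poly L) := by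
    rw [B.coeffAt_eq_iff]
    intro j
    rw [map_zero]
    by_contra h
    have h1 := B.resolvent_mem Λ a j i h
    have h2 := B.neg_lt_d j
    have h3 := B.exponent_lt Λ a
    have : (S.h : ℤ) * i ≤ S.h * (-2) := mul_le_mul_of_nonneg_left (by omega) (by omega)
    omega
  rw [h0, map_zero]

lemma cf_resolvent (a : Fin n) (j : Fin N) {i : ℤ} (hi : i < -1) :
    B.cf j i (B.resolvent Λ a) = 0 := by
  rw [cf_of_coeffAt, B.coeffAt_resolvent Λ a hi]; simp

/-! ### The Euler operator -/

/-- The Euler operator `λ d/dλ`. -/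
def euler (A : Type*) [CommRing A] [Algebra ℂ A] : Loop A L →ₗ[ℂ] Loop A L :=
  loopMap (Series.mapCoeff fun i => (-i : ℂ) • LinearMap.id)

lemma euler_mul (s t : Series A) :
    Series.mapCoeff (fun i => (-i : ℂ) • LinearMap.id) (s * t) =
      Series.mapCoeff (fun i => (-i : ℂ) • LinearMap.id) s * t +
        s * Series.mapCoeff (fun i => (-i : ℂ) • LinearMap.id) t := by
  refine Series.mapCoeff_mul _ (fun i j x y => ?_) s t
  simp only [LinearMap.smul_apply, LinearMap.id_apply, smul_mul_assoc, mul_smul_comm, ← add_smul]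
  congr 1
  push_cast
  ring

lemma cf_euler (x : Loop A L) (j : Fin N) (i : ℤ) :
    B.cf j i (euler A x) = (-i : ℂ) • B.cf j i x := by
  rw [euler, cf_loopMap]; rfl

lemma coeffAt_euler (x : Loop A L) (i : ℤ) :
    coeffAt i (euler A x) = (-i : ℂ) • coeffAt i x := by
  induction x using TensorProduct.induction_on with
  | zero => simp
  | add x y hx hy => simp only [map_add, hx, hy, smul_add]
  | tmul s v =>
    rw [euler, loopMap_tmul, coeffAt_tmul, coeffAt_tmul, Series.coeff_mapCoeff,
      TensorProduct.smul_tmul']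
    rfl

lemma repr_lie_principalElement (v : L) (j : Fin N) :
    B.e.repr ⁅principalElement S.gen, v⁆ j = (B.d j : ℂ) * B.e.repr v j := by
  rw [← B.e.sum_repr v]
  simp only [lie_sum, lie_smul, map_sum, map_smul, Finsupp.coe_finsetSum, Finset.sum_apply]
  rw [Finset.mul_sum]
  refine Finset.sum_congr rfl fun k _ => ?_
  rw [mem_principalPart.1 (B.mem k), map_smul, Finsupp.smul_apply, Finsupp.smul_apply,
    Module.Basis.repr_self, smul_eq_mul, smul_eq_mul]
  by_cases hk : k = j
  · rw [hk, Finsupp.smul_apply, smul_eq_mul]; ring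
  · simp [hk]

lemma smul_euler_tau (m : ℤ) (v : L) : (S.h : ℂ) • euler A (B.tau A m v) =
    (m : ℂ) • B.tau A m v - B.tau A m ⁅principalElement S.gen, v⁆ := by
  refine B.loop_ext fun j i => ?_
  rw [map_smul, cf_euler, map_sub, map_smul, cf_tau, cf_tau, repr_lie_principalElement]
  split_ifs with h
  · rw [h, map_mul, Algebra.smul_def, Algebra.smul_def, Algebra.smul_def]
    rw [← mul_assoc, ← map_mul, ← sub_mul, ← map_sub]
    congr 2
    push_cast
    ring
  · simp

-- `h λ∂_λ + ad ρ^∨` acts on `Λ_{m_a}` as the scalar `m_a`. The term `([ρ^∨, Λ_{m_a}]|Λ_{m_b})`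
-- vanishes because the `Λ`'s commute.
include B in
lemma form_euler_const (a b : Fin n) :
    loopForm A S.form (euler A (constLoop A (Λ.Λ a))) (constLoop A (Λ.Λ b)) =
      ((exponent S.gen a : ℂ) * S.eta a b) • lam A 1 := by
  have h1 := B.smul_euler_tau (A := A) (exponent S.gen a) (B.ell Λ a)
  have h2 := B.tau_lie (A := A) B.principalElement_mem_Cls (exponent S.gen a) (B.ell Λ a)
  rw [zero_add] at h2
  rw [← h2, B.tau_ell] at h1
  have h3 := congrArg (fun x => loopForm A S.form x (constLoop A (Λ.Λ b))) h1
  simp only [map_sub, LinearMap.sub_apply] at h3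
  rw [loopForm_lie S.form_lie, B.lie_const, map_zero, sub_zero,
    ← algebraMap_smul (Series A) (S.h : ℂ),
    ← algebraMap_smul (Series A) (((exponent S.gen a : ℕ) : ℤ) : ℂ), map_smul, map_smul,
    LinearMap.smul_apply, LinearMap.smul_apply, B.form_const, algebraMap_smul, algebraMap_smul,
    smul_smul] at h3
  have h4 := congrArg (fun x => (S.h : ℂ)⁻¹ • x) h3
  simp only [smul_smul] at h4
  rw [inv_mul_cancel₀ (h_ne_zero S), one_smul] at h4
  rw [h4]
  congr 1
  field_simp [h_ne_zero S]
  push_cast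
  ring

/-- Conjugation by `e^{ad_U}` adds `[Y, R_a]` to `λ∂_λ R_a`. This is orthogonal to `R_b`, which
commutes with `R_a`. -/
lemma form_euler_resolvent (a b : Fin n) :
    loopForm B.Poly S.form (euler B.Poly (B.resolvent Λ a)) (B.resolvent Λ b) =
      ((exponent S.gen a : ℂ) * S.eta a b) • lam B.Poly 1 := by
  have hU := B.U_mem Λ a.pos
  obtain ⟨Y, -, hY⟩ := LieFiltration.exists_derivation_exp (F := B.filtration B.Poly) hU
    (euler B.Poly) (loopMap_lie euler_mul) (fun i x hx => B.loopMap_mem_fil _ hx)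
  have h1 : euler B.Poly (B.resolvent Λ a) = (B.filtration B.Poly).exp B.dressingPair.1
      (euler B.Poly (constLoop B.Poly (Λ.Λ a))) + ⁅Y, B.resolvent Λ a⁆ := by
    rw [resolvent_eq, hY]
  rw [h1, map_add, LinearMap.add_apply, loopForm_lie S.form_lie, lie_resolvent, map_zero, add_zero,
    B.resolvent_eq Λ b, B.form_exp_exp hU, B.form_euler_const]

/-! ### Existence of the two-point functions -/

/-- Antidiagonal sums of the coefficients of `(x(λ)|y(μ))` are the coefficients of its restriction
to `λ = μ`. -/
lemma sum_polyForm {x y : Loop B.Poly L} (hx : ∀ i < -1, coeffAt i x = 0)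
    (hy : ∀ i < -1, coeffAt i y = 0) (s : ℤ) :
    ∑ p ∈ Finset.Icc (s - 1) 1, B.polyForm (coeffAt (-p) x) (coeffAt (-(s - p)) y) =
      Series.coeff ℂ (-s) (loopForm B.Poly S.form x y) := by
  have hx' : ∀ j, ∀ i < -1, B.cf j i x = 0 := fun j i hi => by
    rw [cf_of_coeffAt, hx i hi]; simp
  have hy' : ∀ j, ∀ i < -1, B.cf j i y = 0 := fun j i hi => by
    rw [cf_of_coeffAt, hy i hi]; simp
  rw [B.coeff_form hx' hy']
  refine Finset.sum_nbij' (fun p => -p) (fun p => -p) ?_ ?_ ?_ ?_ ?_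
  · intro p hp; simp only [Finset.mem_Icc] at hp ⊢; omega
  · intro p hp; simp only [Finset.mem_Icc] at hp ⊢; omega
  · intro p _; simp
  · intro p _; simp
  · intro p _
    rw [polyForm, show -(s - p) = -s - -p by ring]

/-- The coefficients of `m_a λ + m_b μ`. -/
lemma sum_linear (x y : ℂ) (s : ℤ) : ∑ p ∈ Finset.Icc (s - 1) 1,
    ((if p = 1 ∧ s - p = 0 then x else 0) + (if p = 0 ∧ s - p = 1 then y else 0)) =
      if s = 1 then x + y else 0 := by
  split_ifs with hs
  · subst hs
    rw [show Finset.Icc ((1 : ℤ) - 1) 1 = {0, 1} from rfl]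
    simp [add_comm]
  · refine Finset.sum_eq_zero fun p _ => ?_
    rw [if_neg (by omega), if_neg (by omega), add_zero]

lemma sum_linear' (x y : ℂ) (s : ℤ) : ∑ p ∈ Finset.Icc (s - 1) 1, (p : ℂ) *
    ((if p = 1 ∧ s - p = 0 then x else 0) + (if p = 0 ∧ s - p = 1 then y else 0)) =
      if s = 1 then x else 0 := by
  rw [← add_zero x, ← sum_linear x 0 s]
  refine Finset.sum_congr rfl fun p _ => ?_
  by_cases h1 : p = 1
  · subst h1; simp
  · rw [if_neg (by omega)]
    by_cases h0 : p = 0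
    · subst h0; simp
    · rw [if_neg (by omega), if_neg (by omega)]; simp

lemma coeff_smul_lam (c : ℂ) (s : ℤ) : Series.coeff ℂ (-s) (c • lam A 1) =
    if s = 1 then algebraMap ℂ A c else 0 := by
  rw [map_smul, Series.coeff_lam, if_congr (neg_inj) rfl rfl]
  split_ifs
  · rw [Algebra.algebraMap_eq_smul_one]
  · rw [smul_zero]

/-- On the diagonal the numerator is `η_{ab} (h - m_a - m_b) λ`. -/
lemma sum_tauNumerator (a b : Fin n) (s : ℤ) :
    ∑ p ∈ Finset.Icc (s - 1) 1, B.tauNumerator Λ a b p (s - p) = 0 := by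
  simp only [tauNumerator]
  rw [Finset.sum_sub_distrib, B.sum_polyForm (fun i => B.coeffAt_resolvent Λ a)
    (fun i => B.coeffAt_resolvent Λ b), form_resolvent, coeff_smul_lam, ← map_sum,
    ← Finset.mul_sum, sum_linear, ← MvPolynomial.algebraMap_eq, sub_eq_zero]
  split_ifs
  · by_cases hab : S.eta a b = 0
    · rw [hab, mul_zero, zero_mul]
    · have := B.exponent_add Λ a b hab
      rw [mul_comm]
      congr 2
      exact_mod_cast this.symm
  · rw [mul_zero, map_zero]

/-- The factor `p` applies `λ∂_λ`, so this is `(λ∂_λ R_a|R_b) - η_{ab} m_a λ` on the diagonal. -/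
lemma sum_mul_tauNumerator (a b : Fin n) (s : ℤ) :
    ∑ p ∈ Finset.Icc (s - 1) 1, ((p : ℤ) : B.Poly) * B.tauNumerator Λ a b p (s - p) = 0 := by
  have h1 : ∀ p : ℤ, (p : B.Poly) * B.polyForm (coeffAt (-p) (B.resolvent Λ a))
      (coeffAt (-(s - p)) (B.resolvent Λ b)) =
      B.polyForm (coeffAt (-p) (euler B.Poly (B.resolvent Λ a)))
        (coeffAt (-(s - p)) (B.resolvent Λ b)) := by
    intro p
    have hp : algebraMap ℂ B.Poly (-((-p : ℤ) : ℂ)) = (p : B.Poly) := by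
      rw [← Int.cast_neg, neg_neg, map_intCast]
    rw [coeffAt_euler, ← algebraMap_smul B.Poly (-((-p : ℤ) : ℂ)), map_smul, LinearMap.smul_apply,
      smul_eq_mul, hp]
  have h2 : ∀ (p : ℤ) (c : ℂ), (p : B.Poly) * MvPolynomial.C c = MvPolynomial.C ((p : ℂ) * c) := by
    intro p c
    rw [MvPolynomial.C_mul, ← map_intCast (MvPolynomial.C : ℂ →+* B.Poly) p]
  simp only [tauNumerator, mul_sub, h1, h2, mul_left_comm _ (S.eta a b)]
  rw [Finset.sum_sub_distrib, B.sum_polyForm (fun i hi => by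
      rw [coeffAt_euler, B.coeffAt_resolvent Λ a hi, smul_zero])
    (fun i => B.coeffAt_resolvent Λ b), form_euler_resolvent, coeff_smul_lam, ← map_sum,
    ← Finset.mul_sum, sum_linear', ← MvPolynomial.algebraMap_eq, sub_eq_zero]
  split_ifs
  · rw [mul_comm]
  · rw [mul_zero, map_zero]

lemma exists_isOmega : ∃ ω : Fin n → ℕ → Fin n → ℕ → B.Poly, B.IsOmega Λ ω := by
  have h : ∀ a b, ∃ w, mulDiff (mulDiff (negSeries w)) = B.tauNumerator Λ a b := by
    intro a b
    refine exists_mulDiff_mulDiff (fun i hi j => ?_) (fun i j hj => ?_)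
      (B.sum_tauNumerator Λ a b) (B.sum_mul_tauNumerator Λ a b)
    · rw [tauNumerator, B.coeffAt_resolvent Λ a (by omega), if_neg (by omega), if_neg (by omega)]
      simp
    · rw [tauNumerator, B.coeffAt_resolvent Λ b (by omega), if_neg (by omega), if_neg (by omega)]
      simp
  choose w hw using h
  exact ⟨fun a k b l => w a b k l, hw⟩

variable {B Λ}

lemma IsOmega.unique {ω ω' : Fin n → ℕ → Fin n → ℕ → B.Poly} (h : B.IsOmega Λ ω)
    (h' : B.IsOmega Λ ω') : ω = ω' := by
  funext a k b l
  exact congrFun (congrFun (eq_of_mulDiff_mulDiff ((h a b).trans (h' a b).symm)) k) l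

lemma tauNumerator_symm (a b : Fin n) (i j : ℤ) :
    B.tauNumerator Λ a b i j = B.tauNumerator Λ b a j i := by
  have he : S.eta a b = S.eta b a := by
    simp only [eta]; congr 1; rw [add_comm (a : ℕ)]
  rw [tauNumerator, tauNumerator, polyForm, baseChange_comm S.form_comm, he, add_comm (ite _ _ _)]
  simp only [and_comm]

lemma IsOmega.symm {ω : Fin n → ℕ → Fin n → ℕ → B.Poly} (h : B.IsOmega Λ ω) (a : Fin n) (k : ℕ)
    (b : Fin n) (l : ℕ) : ω a k b l = ω b l a k := by
  have h1 : B.IsOmega Λ fun a k b l => ω b l a k := by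
    intro a b
    have hswap : ∀ F : Series₂ B.Poly, mulDiff (mulDiff fun i j => F j i) =
        fun i j => mulDiff (mulDiff F) j i := by
      intro F
      funext i j
      simp only [mulDiff]
      ring
    have hneg : (negSeries fun k l => ω b l a k) =
        fun i j => negSeries (fun k l => ω b k a l) j i := by
      funext i j
      simp only [negSeries, and_comm]
    rw [hneg, hswap, h b a]
    funext i j
    exact tauNumerator_symm b a j i
  exact congrFun (congrFun (congrFun (congrFun (h.unique h1) a) k) b) l

end Setup.HomogeneousBasis

end

/-! ### Three-point functions and the `τ`-symmetry. -/

section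

namespace Setup.HomogeneousBasis

variable {L : Type*} [LieRing L] [LieAlgebra ℂ L] [FiniteDimensional ℂ L]
  [LieAlgebra.IsSimple ℂ L] {H : LieSubalgebra ℂ L} [H.IsCartanSubalgebra] {n N : ℕ}
  {S : Setup H n} (B : S.HomogeneousBasis N) (Λ : S.KernelBasis)
  {A : Type*} [CommRing A] [Algebra ℂ A]

/-- The coefficient of `λ^{-k}`, considered as a constant element of the loop algebra. -/
def cst (k : ℤ) : Loop A L →ₗ[ℂ] Loop A L :=
  LinearMap.rTensor L ((IsScalarTower.toAlgHom ℂ A (Series A)).toLinearMap ∘ₗ Series.coeff ℂ k)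

lemma cst_tmul (k : ℤ) (s : Series A) (v : L) :
    cst k (s ⊗ₜ[ℂ] v) = Series.C A (Series.coeff ℂ k s) ⊗ₜ v := rfl

lemma coeffAt_lie_cst (k i : ℤ) (x y : Loop A L) :
    coeffAt i ⁅cst k x, y⁆ = ⁅coeffAt k x, coeffAt i y⁆ := by
  induction x using TensorProduct.induction_on with
  | zero => simp
  | add a b ha hb => simp only [map_add, add_lie, ha, hb]
  | tmul s v =>
    induction y using TensorProduct.induction_on with
    | zero => simp
    | add a b ha hb => simp only [map_add, lie_add, ha, hb]
    | tmul t w =>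
      rw [cst_tmul, LieAlgebra.ExtendScalars.bracket_tmul, coeffAt_tmul, coeffAt_tmul,
        coeffAt_tmul, LieAlgebra.ExtendScalars.bracket_tmul, Series.coeff_C_mul]

lemma cf_cst (k : ℤ) (x : Loop A L) (j : Fin N) (i : ℤ) :
    B.cf j i (cst k x) = if i = 0 then B.cf j k x else 0 := by
  nth_rw 1 [← B.sum_coord x]
  rw [map_sum, map_sum, Finset.sum_eq_single j]
  · rw [cst_tmul, cf_tmul, Series.coeff_C]
    simp [cf_eq]
  · intro q _ hq; rw [cst_tmul, cf_tmul]; simp [hq]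
  · simp

lemma coeffAt_lam_smul (p i : ℤ) (x : Loop A L) : coeffAt i (lam A p • x) = coeffAt (i + p) x := by
  induction x using TensorProduct.induction_on with
  | zero => simp
  | add a b ha hb => simp only [map_add, smul_add, ha, hb]
  | tmul s v =>
    rw [TensorProduct.smul_tmul', smul_eq_mul, coeffAt_tmul, coeffAt_tmul, Series.coeff_lam_mul]

/-- `-[(λ^m x)_-, y]`. -/
def laxBracket (m : ℤ) (x y : Loop A L) : Loop A L := -⁅negPart (lam A m • x), y⁆

include B in
lemma negPart_lam_succ (m : ℤ) (x : Loop A L) :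
    negPart (lam A (m + 1) • x) = lam A 1 • negPart (lam A m • x) - cst (m + 1) x := by
  refine B.loop_ext fun j i => ?_
  rw [map_sub, cf_negPart, cf_lam_smul, cf_lam_smul, cf_negPart, cf_lam_smul, cf_cst]
  have h : i + 1 + m = i + (m + 1) := by ring
  rw [h]
  rcases lt_trichotomy i 0 with hi | hi | hi
  · rw [if_neg (by omega), if_neg (by omega), if_neg (by omega), sub_zero]
  · rw [hi, if_neg (by omega), if_pos (by omega), if_pos rfl, zero_add, sub_self]
  · rw [if_pos (by omega), if_pos (by omega), if_neg (by omega), sub_zero]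

include B in
lemma coeffAt_laxBracket_succ (m i : ℤ) (x y : Loop A L) : coeffAt i (laxBracket (m + 1) x y) =
    coeffAt (i + 1) (laxBracket m x y) + ⁅coeffAt (m + 1) x, coeffAt i y⁆ := by
  rw [laxBracket, B.negPart_lam_succ, sub_lie, neg_sub, smul_lie_loop, map_sub, coeffAt_lie_cst,
    coeffAt_lam_smul, laxBracket, map_neg]
  abel

-- `x` stops at `λ^1`, so for `m < -1` truncation leaves `λ^m x` unchanged. Letting `m` run over all
-- integers gives a recursion in `ν` without boundary terms.
include B in
lemma laxBracket_of_lt {m : ℤ} (hm : m < -1) {x y : Loop A L} (hxy : ⁅x, y⁆ = 0)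
    (hx : ∀ j, ∀ i < -1, B.cf j i x = 0) : laxBracket m x y = 0 := by
  have h : negPart (lam A m • x) = lam A m • x := by
    refine B.loop_ext fun j i => ?_
    rw [cf_negPart, cf_lam_smul]
    split_ifs with hi
    · rfl
    · rw [hx _ _ (by omega)]
  rw [laxBracket, h, smul_lie_loop, hxy, smul_zero, neg_zero]

include B in
lemma coeffAt_laxBracket_neg_one (i : ℤ) {x y : Loop A L} (hxy : ⁅x, y⁆ = 0)
    (hx : ∀ j, ∀ i < -1, B.cf j i x = 0) :
    coeffAt i (laxBracket (-1) x y) = ⁅coeffAt (-1) x, coeffAt i y⁆ := by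
  have h := B.coeffAt_laxBracket_succ (-2) i x y
  rw [B.laxBracket_of_lt (m := -2) (by norm_num) hxy hx, map_zero, zero_add] at h
  exact h

lemma polyForm_comm (x y : B.Poly ⊗[ℂ] L) : B.polyForm x y = B.polyForm y x :=
  baseChange_comm S.form_comm x y

lemma polyForm_lie (x y z : B.Poly ⊗[ℂ] L) : B.polyForm ⁅x, y⁆ z = B.polyForm x ⁅y, z⁆ :=
  baseChange_lie S.form_lie x y z

lemma polyForm_lie_left (x y z : B.Poly ⊗[ℂ] L) : B.polyForm y ⁅x, z⁆ = -B.polyForm ⁅x, y⁆ z := by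
  rw [← polyForm_lie, ← lie_skew, map_neg, LinearMap.neg_apply]

lemma deriv_polyForm (D : Derivation ℂ B.Poly B.Poly) (i j : ℤ) (x y : Loop B.Poly L) :
    D (B.polyForm (coeffAt i x) (coeffAt j y)) =
      B.polyForm (coeffAt i (coeffDeriv D x)) (coeffAt j y) +
        B.polyForm (coeffAt i x) (coeffAt j (coeffDeriv D y)) := by
  induction x using TensorProduct.induction_on with
  | zero => simp
  | add a b ha hb => simp only [map_add, LinearMap.add_apply, ha, hb]; abel
  | tmul s v =>
    induction y using TensorProduct.induction_on with
    | zero => simp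
    | add a b ha hb => simp only [map_add, ha, hb]; abel
    | tmul t w =>
      have hD : ∀ (s : Series B.Poly) (v : L) k, coeffAt k (coeffDeriv D (s ⊗ₜ[ℂ] v)) =
        D (Series.coeff ℂ k s) ⊗ₜ[ℂ] v := fun _ _ _ => rfl
      simp only [hD, coeffAt_tmul, polyForm, LinearMap.BilinForm.baseChange_tmul, D.map_smul,
        D.leibniz, smul_add, smul_eq_mul]
      rw [add_comm, mul_comm (Series.coeff ℂ j t)]

/-- The coefficients of `([R_c(ν), R_a(λ)] | R_b(μ))`. -/
def threePoint (c a b : Fin n) (p i j : ℤ) : B.Poly :=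
  B.polyForm ⁅coeffAt (-p) (B.resolvent Λ c), coeffAt (-i) (B.resolvent Λ a)⁆
    (coeffAt (-j) (B.resolvent Λ b))

lemma threePoint_cyclic (c a b : Fin n) (p i j : ℤ) :
    B.threePoint Λ c a b p i j = B.threePoint Λ b c a j p i := by
  rw [threePoint, threePoint, polyForm_comm, polyForm_lie]

/-- The first half of the derivative of `(R_a(λ)|R_b(μ))` along the flows of `R_c`. -/
def flowLeft (c a b : Fin n) (p i j : ℤ) : B.Poly :=
  B.polyForm (coeffAt (-i) (laxBracket (-p - 1) (B.resolvent Λ c) (B.resolvent Λ a)))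
    (coeffAt (-j) (B.resolvent Λ b))

/-- The second half of the derivative of `(R_a(λ)|R_b(μ))` along the flows of `R_c`. -/
def flowRight (c a b : Fin n) (p i j : ℤ) : B.Poly :=
  B.polyForm (coeffAt (-i) (B.resolvent Λ a))
    (coeffAt (-j) (laxBracket (-p - 1) (B.resolvent Λ c) (B.resolvent Λ b)))

/-- With `ν^p` marking `m = -p - 1`, this is `(ν - λ) · flowLeft = threePoint`. -/
lemma flowLeft_sub (c a b : Fin n) (p i j : ℤ) :
    B.flowLeft Λ c a b (p - 1) i j - B.flowLeft Λ c a b p (i - 1) j = B.threePoint Λ c a b p i j := by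
  rw [flowLeft, flowLeft, threePoint, show -(p - 1) - 1 = -p - 1 + 1 by ring,
    B.coeffAt_laxBracket_succ, map_add, LinearMap.add_apply, show -(i - 1) = -i + 1 by ring,
    add_sub_cancel_left, show -p - 1 + 1 = -p by ring]

lemma flowRight_sub (c a b : Fin n) (p i j : ℤ) :
    B.flowRight Λ c a b (p - 1) i j - B.flowRight Λ c a b p i (j - 1) =
      -B.threePoint Λ c a b p i j := by
  rw [flowRight, flowRight, threePoint, show -(p - 1) - 1 = -p - 1 + 1 by ring,
    B.coeffAt_laxBracket_succ, map_add, show -(j - 1) = -j + 1 by ring,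
    add_sub_cancel_left, show -p - 1 + 1 = -p by ring, polyForm_lie_left]

/-- The unphysical indices `m = -p - 1 < 0` contribute nothing: for `m = -1` both halves are
brackets with the coefficient of `λ` in `R_c` and cancel by invariance; for `m < -1` each is zero.
-/
lemma flowLeft_add_flowRight (c a b : Fin n) {p : ℤ} (hp : 0 ≤ p) (i j : ℤ) :
    B.flowLeft Λ c a b p i j + B.flowRight Λ c a b p i j = 0 := by
  have hc : ∀ j, ∀ i < -1, B.cf j i (B.resolvent Λ c) = 0 := fun j i => B.cf_resolvent Λ c j
  rw [flowLeft, flowRight]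
  rcases hp.eq_or_lt with rfl | hp
  · rw [show -(0 : ℤ) - 1 = -1 by norm_num, B.coeffAt_laxBracket_neg_one _ (B.lie_resolvent Λ c a) hc,
      B.coeffAt_laxBracket_neg_one _ (B.lie_resolvent Λ c b) hc, B.polyForm_lie_left, add_neg_cancel]
  · rw [B.laxBracket_of_lt (by omega) (B.lie_resolvent Λ c a) hc,
      B.laxBracket_of_lt (by omega) (B.lie_resolvent Λ c b) hc]
    simp

lemma flow_tauNumerator (c a b : Fin n) (m : ℕ) (i j : ℤ) :
    B.flow Λ c m (B.tauNumerator Λ a b i j) =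
      B.flowLeft Λ c a b (-m - 1) i j + B.flowRight Λ c a b (-m - 1) i j := by
  rw [tauNumerator, map_sub, ← MvPolynomial.algebraMap_eq, Derivation.map_algebraMap, sub_zero,
    deriv_polyForm, flow_resolvent, flow_resolvent, flowLeft, flowRight,
    show -(-(m : ℤ) - 1) - 1 = m by ring]
  rfl

variable {B Λ}

/-- The series of the derivatives `dω_{a,k;b,l} / dT^c_m`. -/
def flowSeries (Λ : S.KernelBasis) (ω : Fin n → ℕ → Fin n → ℕ → B.Poly) (c a b : Fin n)
    (p i j : ℤ) : B.Poly :=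
  if p < 0 then B.flow Λ c (-p - 1).toNat (negSeries (fun k l => ω a k b l) i j) else 0

variable {ω : Fin n → ℕ → Fin n → ℕ → B.Poly}

lemma flowSeries_apply (c a b : Fin n) (m k l : ℕ) :
    flowSeries Λ ω c a b (-m - 1) (-k - 1) (-l - 1) = B.flow Λ c m (ω a k b l) := by
  rw [flowSeries, if_pos (by omega), negSeries_apply (fun k l => ω a k b l)]
  congr 2
  omega

lemma flowSeries_eq_zero_left (c a b : Fin n) {p : ℤ} (hp : 0 ≤ p) :
    flowSeries Λ ω c a b p = 0 := by
  funext i j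
  rw [flowSeries, if_neg (by omega)]; rfl

lemma flowSeries_eq_zero_mid (c a b : Fin n) (p : ℤ) {i : ℤ} (hi : 0 ≤ i) (j : ℤ) :
    flowSeries Λ ω c a b p i j = 0 := by
  rw [flowSeries, negSeries, if_neg (c := i < 0 ∧ j < 0) (by omega), map_zero, ite_self]

lemma flowSeries_eq_zero_right (c a b : Fin n) (p i : ℤ) {j : ℤ} (hj : 0 ≤ j) :
    flowSeries Λ ω c a b p i j = 0 := by
  rw [flowSeries, negSeries, if_neg (c := i < 0 ∧ j < 0) (by omega), map_zero, ite_self]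

lemma mulDiff_mulDiff_flowSeries (h : B.IsOmega Λ ω) (c a b : Fin n) (p i j : ℤ) :
    mulDiff (mulDiff (flowSeries Λ ω c a b p)) i j =
      B.flowLeft Λ c a b p i j + B.flowRight Λ c a b p i j := by
  by_cases hp : p < 0
  · have h1 := congrArg (B.flow Λ c (-p - 1).toNat) (congrFun (congrFun (h a b) i) j)
    rw [flow_tauNumerator, show -((-p - 1).toNat : ℤ) - 1 = p by omega] at h1
    rw [← h1]
    simp only [mulDiff, flowSeries, if_pos hp, map_sub]
  · rw [flowLeft_add_flowRight B Λ c a b (by omega), flowSeries_eq_zero_left c a b (by omega)]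
    simp [mulDiff]

lemma threePoint_eq_zero (c a b : Fin n) (p : ℤ) {i : ℤ} (hi : 1 < i) (j : ℤ) :
    B.threePoint Λ c a b p i j = 0 := by
  rw [threePoint, B.coeffAt_resolvent Λ a (by omega)]; simp

/-- Writing `T` for `threePoint`, `(λ-μ)² Φ = flowLeft + flowRight`. Multiplication by `(ν-λ)(ν-μ)`
gives `(ν-μ)T - (ν-λ)T = (λ-μ)T`, and one factor `λ - μ` is cancelled. -/
lemma mulVandermonde_flowSeries (h : B.IsOmega Λ ω) (c a b : Fin n) :
    mulVandermonde (flowSeries Λ ω c a b) = B.threePoint Λ c a b := by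
  set Φ := flowSeries Λ ω c a b with hΦ
  funext p
  refine sub_eq_zero.1 (eq_zero_of_mulDiff (a := 1) (fun i hi j => ?_) ?_)
  · have h0 : ∀ p j i, 0 ≤ i → Φ p i j = 0 := fun p j i hi => flowSeries_eq_zero_mid c a b p hi j
    rw [Pi.sub_apply, Pi.sub_apply, threePoint_eq_zero c a b p hi, mulVandermonde]
    simp only [h0 _ _ i (by omega), h0 _ _ (i - 1) (by omega), h0 _ _ (i - 2) (by omega), sub_zero,
      add_zero]
  · rw [mulDiff_sub, sub_eq_zero]
    have h1 : ∀ p i j, mulDiff (mulDiff (Φ p)) i j =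
      B.flowLeft Λ c a b p i j + B.flowRight Λ c a b p i j :=
        fun p i j => mulDiff_mulDiff_flowSeries h c a b p i j
    funext i j
    have h2 : mulDiff (mulVandermonde Φ p) i j = mulDiff (mulDiff (Φ (p - 1 - 1))) i j -
        mulDiff (mulDiff (Φ (p - 1))) (i - 1) j - mulDiff (mulDiff (Φ (p - 1))) i (j - 1) +
        mulDiff (mulDiff (Φ p)) (i - 1) (j - 1) := by
      rw [mulDiff, mulVandermonde_eq, mulVandermonde_eq, show p - 2 = p - 1 - 1 by ring]
      simp only [mulDiff]
      ring
    rw [h2, h1, h1, h1, h1, mulDiff]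
    have e1 := B.flowLeft_sub Λ c a b (p - 1) i j
    have e2 := B.flowLeft_sub Λ c a b p i (j - 1)
    have e3 := B.flowRight_sub Λ c a b (p - 1) i j
    have e4 := B.flowRight_sub Λ c a b p (i - 1) j
    linear_combination e1 - e2 + e3 - e4

/-- Both the three-point function and the Vandermonde product are invariant under cyclic
permutations. The difference of the two sides is therefore annihilated by the product, and it is
bounded above in `ν` and `λ`. -/
lemma flowSeries_cyclic (h : B.IsOmega Λ ω) (c a b : Fin n) (p i j : ℤ) :
    flowSeries Λ ω c a b p i j = flowSeries Λ ω b c a j p i := by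
  have h1 : (flowSeries Λ ω c a b - fun p i j => flowSeries Λ ω b c a j p i) = 0 := by
    refine eq_zero_of_mulVandermonde (a := -1) (fun p hp => ?_) (fun p i hi j => ?_) ?_
    · funext i j
      rw [Pi.sub_apply, flowSeries_eq_zero_left c a b (by omega), Pi.sub_apply, Pi.sub_apply,
        flowSeries_eq_zero_mid b c a j (by omega)]
      exact sub_zero _
    · rw [Pi.sub_apply, Pi.sub_apply, Pi.sub_apply, flowSeries_eq_zero_mid c a b p (by omega),
        flowSeries_eq_zero_right b c a j p (by omega), sub_self]
    · funext p i j
      have e1 := congrFun (congrFun (congrFun (mulVandermonde_flowSeries h c a b) p) i) j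
      have e2 := congrFun (congrFun (congrFun (mulVandermonde_flowSeries h b c a) j) p) i
      rw [← threePoint_cyclic, ← e1] at e2
      simp only [mulVandermonde, Pi.sub_apply, Pi.zero_apply] at e2 ⊢
      linear_combination -e2
  exact sub_eq_zero.1 (congrFun (congrFun (congrFun h1 p) i) j)

lemma IsOmega.flow_symm (h : B.IsOmega Λ ω) (a : Fin n) (k : ℕ) (b : Fin n) (l : ℕ) (c : Fin n)
    (m : ℕ) : B.flow Λ c m (ω a k b l) = B.flow Λ b l (ω c m a k) := by
  rw [← flowSeries_apply c a b m k l, flowSeries_cyclic h, flowSeries_apply]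

end Setup.HomogeneousBasis

end

end DSTau

end

theorem mainTheorem6 {L : Type*} [LieRing L] [LieAlgebra ℂ L] [FiniteDimensional ℂ L]
    [LieAlgebra.IsSimple ℂ L] (H : LieSubalgebra ℂ L) [H.IsCartanSubalgebra] {n N : ℕ}
    (S : DSTau.Setup H n) (B : S.HomogeneousBasis N) (Λ : S.KernelBasis) :
    (∃! ω : Fin n → ℕ → Fin n → ℕ → B.Poly, B.IsOmega Λ ω) ∧
    ∀ ω : Fin n → ℕ → Fin n → ℕ → B.Poly, B.IsOmega Λ ω →
      (∀ a k b l, ω a k b l = ω b l a k) ∧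
      (∀ a k b l c m,
        B.flow Λ c m (ω a k b l) = B.flow Λ b l (ω c m a k) ∧
        B.flow Λ b l (ω c m a k) = B.flow Λ a k (ω b l c m)) := by
  obtain ⟨ω₀, hω₀⟩ := B.exists_isOmega Λ
  exact ⟨⟨ω₀, hω₀, fun ω hω => hω.unique hω₀⟩, fun ω hω => ⟨hω.symm, fun a k b l c m =>
    ⟨hω.flow_symm a k b l c m, hω.flow_symm c m a k b l⟩⟩⟩
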